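/- Let $I=[0,\pi]$ or $I=[\pi,2\pi)$, and let $\psi:\mathbb{R}^2\to\mathbb{C}$ be a smooth function with compact support not containing $0$. For $x,y\in\mathbb{R}^2$ write $\theta_1,\theta_2\in[0,2\pi)$ for the polar angles of $x$ and $y$, i.e. $x=|x|(\cos\theta_1,\sin\theta_1)$ and $y=|y|(\cos\theta_2,\sin\theta_2)$; the angle of the origin is set to $0$. For $\lambda\ge 1$ define $$T_G^\lambda f(x)=\int_{\mathbb{R}^2}e^{2\pi i\lambda|x-y|}\,\psi(x-y)\,\mathbf{1}_I(|\theta_1-\theta_2|)\,f(y)\,dy .$$ Let $4<q\le\infty$ and let $r$ satisfy $\frac3q+\frac1r=1$. Then there is a constant $C>0$, depending only on $\psi$, $q$, $r$ and $I$, such that for every $\lambda\ge1$ and every $f\in L^r(\mathbb{R}^2)$ the integral defining $T_G^\lambda f(x)$ converges absolutely for every $x$, $T_G^\lambda f\in L^q(\mathbb{R}^2)$, and $$\|T_G^\lambda f\|_{L^q(\mathbb{R}^2)}\le C\,\lambda^{-2/q}\,\|f\|_{L^r(\mathbb{R}^2)} .$$ -/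

import Mathlib

open MeasureTheory
open scoped ENNReal ContDiff

noncomputable section

/-- The Euclidean plane. -/
abbrev Plane : Type := EuclideanSpace ℝ (Fin 2)

/-- The polar angle of `x`, normalised to lie in `[0, 2π)` (with value `0` at the origin). -/
def polarAngle (x : Plane) : ℝ :=
  toIcoMod Real.two_pi_pos 0 (Complex.arg ⟨x 0, x 1⟩)

theorem polarAngle_mem (x : Plane) : polarAngle x ∈ Set.Ico 0 (2 * Real.pi) := by
  have h := toIcoMod_mem_Ico Real.two_pi_pos 0 (Complex.arg ⟨x 0, x 1⟩)
  simpa [polarAngle] using h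

theorem polarAngle_spec (x : Plane) :
    x 0 = ‖x‖ * Real.cos (polarAngle x) ∧ x 1 = ‖x‖ * Real.sin (polarAngle x) := by
  have hn : ‖(⟨x 0, x 1⟩ : ℂ)‖ = ‖x‖ := by
    rw [Complex.norm_def, EuclideanSpace.norm_eq, Complex.normSq_mk]
    simp [Fin.sum_univ_two, pow_two]
  have hp : polarAngle x = Complex.arg ⟨x 0, x 1⟩
      - toIcoDiv Real.two_pi_pos 0 (Complex.arg ⟨x 0, x 1⟩) * (2 * Real.pi) := by
    rw [polarAngle, toIcoMod, zsmul_eq_mul]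
  rw [hp, Real.cos_sub_int_mul_two_pi, Real.sin_sub_int_mul_two_pi, ← hn,
    Complex.norm_mul_cos_arg, Complex.norm_mul_sin_arg]
  exact ⟨rfl, rfl⟩

/-- The oscillatory kernel `e^{2πiλ|x-y|} ψ(x-y) 1_I(|θ₁-θ₂|)`, where `θ₁, θ₂ ∈ [0, 2π)` are the
polar angles of `x` and `y`. -/
def kernelTG (I : Set ℝ) (ψ : Plane → ℂ) (lam : ℝ) (x y : Plane) : ℂ :=
  Complex.exp (2 * Real.pi * Complex.I * lam * ‖x - y‖) * ψ (x - y) *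
    I.indicator (fun _ => (1 : ℂ)) |polarAngle x - polarAngle y|

/-- The operator with kernel `kernelTG`. -/
def opTG (I : Set ℝ) (ψ : Plane → ℂ) (lam : ℝ) (f : Plane → ℂ) (x : Plane) : ℂ :=
  ∫ y, kernelTG I ψ lam x y * f y

end

/-! Put L = 2πλ. The case q = ∞ is immediate because the kernel is bounded. For finite q the plan is
to prove the estimate for the convolution operator without the angular cutoff, and then to insert
the cutoff by the Christ–Kiselev lemma.

The convolution estimate is a Carleson–Sjölin argument. If ψ is supported away from the horizontal
axis, f may be restricted to a short horizontal segment [0, ε], which gives an operator from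
functions of one variable s to functions on the plane. Its square is an integral over pairs (s₁,
s₂); by symmetry ordered pairs suffice, and these are split according to s₁ - s₂ ~ 2^(-k). Composing
the bilinear operator with its adjoint gives a kernel in two pairs z, w whose phase is a four-term
sum of distances. Such a sum depends smoothly on s₁ + s₂ and (s₁ - s₂)², with differences V and W of
these coordinates between z and w. The derivative of the phase in the horizontal direction sees V,
and the derivative along rays through the origin sees W, since its mixed derivative in s vanishes at
s = 0 but the next one does not. One of the two is always comparable to |V| + |W|, so three
integrations by parts give the bound (L(|V| + |W|))^(-3) (`exists_norm_integral_quadKernel_le`). On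
the k-th piece |W| is at least 2^(-k) times the difference of the s₁ - s₂, and Schur's test gives an
L² bound with constant L^(-2) 2^k.

Combined with the trivial sup bound and summed in k, which needs q/2 > 2, this yields a restricted
estimate for functions dominated by the indicator of a set E, with right side L^(-2)|E|^(q-3)
(`exists_line_restricted`). Real interpolation with L¹ → L^∞ makes it strong type
(`exists_strong_type`). Integrating over horizontal slices gives the estimate on a small square,
averaging over translates removes the square, and a cutoff together with a coordinate swap removes
the condition on the support of ψ (`exists_plane_strong`).

For fixed x the condition |θ₁ - θ₂| ∈ I cuts out an initial or a final segment in θ₂. Since q/r = q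
- 3 > 1, bisecting the mass of |f|^r by angle and absorbing the two halves preserves the bound up to
a constant (`lintegral_cutoff_le`). -/

/-! ### Nonstationary phase in one variable. -/

/-- One integration by parts against an oscillating exponential. -/
theorem integral_exp_mul_deriv_mul {α β L : ℝ} (hαβ : α ≤ β) {g g1 : ℝ → ℝ} {u u1 : ℝ → ℂ}
    (hg : ∀ t ∈ Set.Icc α β, HasDerivAt g (g1 t) t)
    (hu : ∀ t ∈ Set.Icc α β, HasDerivAt u (u1 t) t)
    (hg1 : ContinuousOn g1 (Set.Icc α β)) (hu1 : ContinuousOn u1 (Set.Icc α β))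
    (hα : u α = 0) (hβ : u β = 0) (hL : 0 < L) :
    ‖∫ t in α..β, Complex.exp (Complex.I * L * g t) * (g1 t * u t)‖
      = L⁻¹ * ‖∫ t in α..β, Complex.exp (Complex.I * L * g t) * u1 t‖ := by
  have huc : ContinuousOn u (Set.Icc α β) := fun t ht => (hu t ht).continuousAt.continuousWithinAt
  have hgc : ContinuousOn g (Set.Icc α β) := fun t ht => (hg t ht).continuousAt.continuousWithinAt
  have hec : ContinuousOn (fun t => Complex.exp (Complex.I * L * g t)) (Set.Icc α β) := by
    fun_prop
  have he : ∀ t ∈ Set.uIcc α β, HasDerivAt (fun t => Complex.exp (Complex.I * L * g t))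
      (Complex.exp (Complex.I * L * g t) * (Complex.I * L * g1 t)) t := by
    intro t ht
    rw [Set.uIcc_of_le hαβ] at ht
    exact ((hg t ht).ofReal_comp.const_mul (Complex.I * L)).cexp
  have hI := intervalIntegral.integral_deriv_mul_eq_sub (a := α) (b := β) he
    (v := u) (v' := u1) (fun t ht => hu t (by rwa [Set.uIcc_of_le hαβ] at ht))
    (ContinuousOn.intervalIntegrable (by
      rw [Set.uIcc_of_le hαβ]; fun_prop))
    (ContinuousOn.intervalIntegrable (by rwa [Set.uIcc_of_le hαβ]))
  rw [hα, hβ, mul_zero, mul_zero, sub_zero, intervalIntegral.integral_add] at hI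
  · have h2 : (∫ t in α..β, Complex.exp (Complex.I * L * g t) * (Complex.I * L * g1 t) * u t)
        = (Complex.I * L) * ∫ t in α..β, Complex.exp (Complex.I * L * g t) * (g1 t * u t) := by
      rw [← intervalIntegral.integral_const_mul]
      congr 1; ext t; ring
    rw [h2] at hI
    have h3 := eq_neg_of_add_eq_zero_left hI
    have h4 := congrArg norm h3
    rw [norm_neg, norm_mul, norm_mul, Complex.norm_I, one_mul, Complex.norm_real,
      Real.norm_of_nonneg hL.le] at h4
    rw [← h4]
    field_simp
  · refine ContinuousOn.intervalIntegrable ?_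
    rw [Set.uIcc_of_le hαβ]; fun_prop
  · refine ContinuousOn.intervalIntegrable ?_
    rw [Set.uIcc_of_le hαβ]; fun_prop

theorem norm_exp_I_mul_mul (L x : ℝ) : ‖Complex.exp (Complex.I * L * x)‖ = 1 := by
  rw [show Complex.I * L * x = ((L * x : ℝ) : ℂ) * Complex.I by push_cast; ring]
  exact Complex.norm_exp_ofReal_mul_I _

/-- Nonstationary phase with three integrations by parts. -/
theorem exists_norm_integral_exp_mul_le (M : ℝ) (hM : 1 ≤ M) : ∃ K : ℝ, 0 < K ∧
    ∀ (α β L : ℝ) (g g1 g2 g3 g4 : ℝ → ℝ) (a a1 a2 a3 : ℝ → ℂ), α ≤ β → 0 < L →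
    (∀ t ∈ Set.Icc α β, HasDerivAt g (g1 t) t) → (∀ t ∈ Set.Icc α β, HasDerivAt g1 (g2 t) t) →
    (∀ t ∈ Set.Icc α β, HasDerivAt g2 (g3 t) t) → (∀ t ∈ Set.Icc α β, HasDerivAt g3 (g4 t) t) →
    ContinuousOn g4 (Set.Icc α β) →
    (∀ t ∈ Set.Icc α β, HasDerivAt a (a1 t) t) → (∀ t ∈ Set.Icc α β, HasDerivAt a1 (a2 t) t) →
    (∀ t ∈ Set.Icc α β, HasDerivAt a2 (a3 t) t) → ContinuousOn a3 (Set.Icc α β) →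
    (∀ t ∈ Set.Icc α β, M⁻¹ ≤ |g1 t|) → (∀ t ∈ Set.Icc α β, |g2 t| ≤ M) →
    (∀ t ∈ Set.Icc α β, |g3 t| ≤ M) → (∀ t ∈ Set.Icc α β, |g4 t| ≤ M) →
    (∀ t ∈ Set.Icc α β, ‖a t‖ ≤ M) → (∀ t ∈ Set.Icc α β, ‖a1 t‖ ≤ M) →
    (∀ t ∈ Set.Icc α β, ‖a2 t‖ ≤ M) → (∀ t ∈ Set.Icc α β, ‖a3 t‖ ≤ M) →
    a α = 0 → a β = 0 → a1 α = 0 → a1 β = 0 → a2 α = 0 → a2 β = 0 →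
    ‖∫ t in α..β, Complex.exp (Complex.I * L * g t) * a t‖ ≤ K * (β - α) / L ^ 3 := by
  -- The `R`s bound the derivatives of 1/g', the `U`s those of a/g', and the `V`s those of
  -- (a/g')'/g'. Only a lower bound on |g'| is used, so `K` depends on `M` alone.
  set R1 := M * M ^ 2 with hR1
  set R2 := M * M ^ 2 + 2 * M * M * R1 with hR2
  set R3 := M * M ^ 2 + 4 * M * M * R1 + 2 * M * R1 ^ 2 + 2 * M * M * R2 with hR3
  set U1 := M * M + M * R1 with hU1
  set U2 := M * M + 2 * M * R1 + M * R2 with hU2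
  set U3 := M * M + 3 * M * R1 + 3 * M * R2 + M * R3 with hU3
  set V1 := U2 * M + U1 * R1 with hV1
  set V2 := U3 * M + 2 * U2 * R1 + U1 * R2 with hV2
  have hM0 : 0 < M := by linarith
  refine ⟨V2 * M + V1 * R1, by positivity, ?_⟩
  intro α β L g g1 g2 g3 g4 a a1 a2 a3 hαβ hL hg hg1 hg2 hg3 hg4c ha ha1 ha2 ha3c
    bg1 bg2 bg3 bg4 ba ba1 ba2 ba3 eα eβ eα1 eβ1 eα2 eβ2
  have cont : ∀ {E : Type} [NormedAddCommGroup E] [NormedSpace ℝ E] {f f' : ℝ → E},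
      (∀ t ∈ Set.Icc α β, HasDerivAt f (f' t) t) → ContinuousOn f (Set.Icc α β) :=
    fun h t ht => (h t ht).continuousAt.continuousWithinAt
  have hne : ∀ t ∈ Set.Icc α β, g1 t ≠ 0 := by
    intro t ht h0
    have := bg1 t ht
    rw [h0, abs_zero] at this
    have : 0 < M⁻¹ := by positivity
    linarith
  set r : ℝ → ℝ := fun t => (g1 t)⁻¹ with hr
  set r1 : ℝ → ℝ := fun t => -g2 t * r t ^ 2 with hr1
  set r2 : ℝ → ℝ := fun t => -g3 t * r t ^ 2 - 2 * g2 t * r t * r1 t with hr2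
  set r3 : ℝ → ℝ := fun t => -g4 t * r t ^ 2 - 4 * g3 t * r t * r1 t - 2 * g2 t * r1 t ^ 2
    - 2 * g2 t * r t * r2 t with hr3
  have dr : ∀ t ∈ Set.Icc α β, HasDerivAt r (r1 t) t := by
    intro t ht
    refine HasDerivAt.congr_deriv ((hg1 t ht).inv (hne t ht)) ?_
    simp only [hr1, hr, div_eq_mul_inv, inv_pow]
  have dr1 : ∀ t ∈ Set.Icc α β, HasDerivAt r1 (r2 t) t := by
    intro t ht
    refine HasDerivAt.congr_deriv (((hg2 t ht).neg).mul ((dr t ht).pow 2)) ?_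
    simp only [hr2, Pi.neg_apply]; push_cast; ring
  have dr2 : ∀ t ∈ Set.Icc α β, HasDerivAt r2 (r3 t) t := by
    intro t ht
    refine HasDerivAt.congr_deriv ((((hg3 t ht).neg).mul ((dr t ht).pow 2)).sub
      ((((hg2 t ht).const_mul 2).mul (dr t ht)).mul (dr1 t ht))) ?_
    simp only [hr3, Pi.neg_apply, Pi.pow_apply, Pi.mul_apply]; push_cast; ring
  have cr3 : ContinuousOn r3 (Set.Icc α β) := by
    have := cont dr; have := cont dr1; have := cont dr2; have := cont hg2; have := cont hg3
    fun_prop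
  have br : ∀ t ∈ Set.Icc α β, |r t| ≤ M := by
    intro t ht
    rw [hr]; simp only [abs_inv]
    exact inv_le_of_inv_le₀ hM0 (bg1 t ht)
  have br1 : ∀ t ∈ Set.Icc α β, |r1 t| ≤ R1 := by
    intro t ht
    have h1 := br t ht; have h2 := bg2 t ht
    simp only [hr1, hR1, abs_mul, abs_neg, abs_pow]
    gcongr
  have br2 : ∀ t ∈ Set.Icc α β, |r2 t| ≤ R2 := by
    intro t ht
    have h1 := br t ht; have h2 := bg2 t ht; have h3 := bg3 t ht; have h4 := br1 t ht
    refine (abs_sub _ _).trans ?_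
    simp only [hR2, abs_mul, abs_neg, abs_pow, abs_two]
    gcongr
  have br3 : ∀ t ∈ Set.Icc α β, |r3 t| ≤ R3 := by
    intro t ht
    have h1 := br t ht; have h2 := bg2 t ht; have h3 := bg3 t ht; have h4 := br1 t ht
    have h5 := br2 t ht; have h6 := bg4 t ht
    refine (abs_sub _ _).trans (add_le_add ((abs_sub _ _).trans
      (add_le_add ((abs_sub _ _).trans (add_le_add ?_ ?_)) ?_)) ?_)
    all_goals
      simp only [abs_mul, abs_neg, abs_pow, abs_two, show |(4:ℝ)| = 4 by norm_num]
      gcongr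
  have nr : ∀ x : ℝ, ‖(x : ℂ)‖ = |x| := fun x => by simp
  set u1 : ℝ → ℂ := fun t => a1 t * r t + a t * r1 t with hu1
  set u2 : ℝ → ℂ := fun t => a2 t * r t + 2 * a1 t * r1 t + a t * r2 t with hu2
  set u3 : ℝ → ℂ := fun t => a3 t * r t + 3 * a2 t * r1 t + 3 * a1 t * r2 t + a t * r3 t with hu3
  set v1 : ℝ → ℂ := fun t => u2 t * r t + u1 t * r1 t with hv1
  set v2 : ℝ → ℂ := fun t => u3 t * r t + 2 * u2 t * r1 t + u1 t * r2 t with hv2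
  have du0 : ∀ t ∈ Set.Icc α β, HasDerivAt (fun t => a t * (r t : ℂ)) (u1 t) t := fun t ht =>
    (ha t ht).mul (dr t ht).ofReal_comp
  have du1 : ∀ t ∈ Set.Icc α β, HasDerivAt u1 (u2 t) t := by
    intro t ht
    refine HasDerivAt.congr_deriv (((ha1 t ht).mul (dr t ht).ofReal_comp).add ((ha t ht).mul (dr1 t ht).ofReal_comp)) ?_
    simp only [hu2]; ring
  have du2 : ∀ t ∈ Set.Icc α β, HasDerivAt u2 (u3 t) t := by
    intro t ht
    refine HasDerivAt.congr_deriv ((((ha2 t ht).mul (dr t ht).ofReal_comp).add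
      (((ha1 t ht).const_mul 2).mul (dr1 t ht).ofReal_comp)).add
      ((ha t ht).mul (dr2 t ht).ofReal_comp)) ?_
    simp only [hu3]; ring
  have dv0 : ∀ t ∈ Set.Icc α β, HasDerivAt (fun t => u1 t * (r t : ℂ)) (v1 t) t := fun t ht =>
    (du1 t ht).mul (dr t ht).ofReal_comp
  have dv1 : ∀ t ∈ Set.Icc α β, HasDerivAt v1 (v2 t) t := by
    intro t ht
    refine HasDerivAt.congr_deriv (((du2 t ht).mul (dr t ht).ofReal_comp).add ((du1 t ht).mul (dr1 t ht).ofReal_comp)) ?_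
    simp only [hv2]; ring
  have dw0 : ∀ t ∈ Set.Icc α β, HasDerivAt (fun t => v1 t * (r t : ℂ))
      (v2 t * r t + v1 t * r1 t) t := fun t ht =>
    (dv1 t ht).mul (dr t ht).ofReal_comp
  have cr := cont dr
  have cr1 := cont dr1
  have cr2 := cont dr2
  have ca := cont ha
  have ca1 := cont ha1
  have ca2 := cont ha2
  have cu1 := cont du1
  have cu2 := cont du2
  have cu3 : ContinuousOn u3 (Set.Icc α β) := by fun_prop
  have cv1 := cont dv1
  have cv2 : ContinuousOn v2 (Set.Icc α β) := by fun_prop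
  -- Writing w = g' · (w/g') prepares each integration by parts; it is applied to a, then (a/g')',
  -- then ((a/g')'/g')'.
  have key : ∀ w : ℝ → ℂ, ∀ t ∈ Set.uIcc α β, Complex.exp (Complex.I * L * g t) * w t
      = Complex.exp (Complex.I * L * g t) * (g1 t * (w t * (r t : ℂ))) := by
    intro w t ht
    rw [Set.uIcc_of_le hαβ] at ht
    have : (g1 t : ℂ) ≠ 0 := by exact_mod_cast hne t ht
    simp only [hr]; push_cast; field_simp
  rw [intervalIntegral.integral_congr (key a),
    integral_exp_mul_deriv_mul hαβ hg du0 (cont hg1) cu1 (by simp [eα]) (by simp [eβ]) hL,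
    intervalIntegral.integral_congr (key u1),
    integral_exp_mul_deriv_mul hαβ hg dv0 (cont hg1) cv1 (by simp [hu1, eα, eα1])
      (by simp [hu1, eβ, eβ1]) hL,
    intervalIntegral.integral_congr (key v1),
    integral_exp_mul_deriv_mul hαβ hg dw0 (cont hg1) (by fun_prop)
      (by simp [hv1, hu1, hu2, eα, eα1, eα2]) (by simp [hv1, hu1, hu2, eβ, eβ1, eβ2]) hL]
  have hb : ‖∫ t in α..β, Complex.exp (Complex.I * L * g t) * (v2 t * r t + v1 t * r1 t)‖
      ≤ (V2 * M + V1 * R1) * |β - α| := by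
    refine intervalIntegral.norm_integral_le_of_norm_le_const fun t ht => ?_
    rw [Set.uIoc_of_le hαβ] at ht
    have ht' := Set.Ioc_subset_Icc_self ht
    have h1 := br t ht'; have h4 := br1 t ht'
    have h5 := br2 t ht'; have h7 := br3 t ht'
    rw [← nr] at h1 h4 h5 h7
    have e0 := ba t ht'; have e1 := ba1 t ht'; have e2 := ba2 t ht'; have e3 := ba3 t ht'
    have n2 : ‖(2:ℂ)‖ = 2 := by norm_num
    have n3 : ‖(3:ℂ)‖ = 3 := by norm_num
    have k1 : ‖u1 t‖ ≤ U1 := by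
      refine norm_add_le_of_le ?_ ?_ <;> rw [norm_mul] <;> gcongr
    have k2 : ‖u2 t‖ ≤ U2 := by
      refine norm_add_le_of_le (norm_add_le_of_le ?_ ?_) ?_ <;> simp only [norm_mul, n2] <;> gcongr
    have k3 : ‖u3 t‖ ≤ U3 := by
      refine norm_add_le_of_le (norm_add_le_of_le (norm_add_le_of_le ?_ ?_) ?_) ?_ <;>
        simp only [norm_mul, n3] <;> gcongr
    have l1 : ‖v1 t‖ ≤ V1 := by
      refine norm_add_le_of_le ?_ ?_ <;> rw [norm_mul] <;> gcongr
    have l2 : ‖v2 t‖ ≤ V2 := by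
      refine norm_add_le_of_le (norm_add_le_of_le ?_ ?_) ?_ <;> simp only [norm_mul, n2] <;> gcongr
    rw [norm_mul, norm_exp_I_mul_mul, one_mul]
    refine norm_add_le_of_le ?_ ?_ <;> rw [norm_mul] <;> gcongr
  rw [abs_of_nonneg (sub_nonneg.2 hαβ)] at hb
  calc L⁻¹ * (L⁻¹ * (L⁻¹ * _)) ≤ L⁻¹ * (L⁻¹ * (L⁻¹ * ((V2 * M + V1 * R1) * (β - α)))) := by
        gcongr
    _ = _ := by field_simp

/-! ### Directional derivatives of smooth functions. -/

/-- Directional derivative of `f` along `v`, as a function of the base point. -/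
noncomputable def dirDeriv {E F : Type*} [NormedAddCommGroup E] [NormedSpace ℝ E]
    [NormedAddCommGroup F] [NormedSpace ℝ F] (v : E) (f : E → F) : E → F :=
  fun z => fderiv ℝ f z v

section dirDeriv
variable {E F : Type*} [NormedAddCommGroup E] [NormedSpace ℝ E]
    [NormedAddCommGroup F] [NormedSpace ℝ F]

theorem ContDiffOn.dirDeriv {f : E → F} {U : Set E} (hf : ContDiffOn ℝ ∞ f U) (hU : IsOpen U)
    (v : E) : ContDiffOn ℝ ∞ (dirDeriv v f) U :=
  (hf.fderiv_of_isOpen hU (m := ∞) (by simp)).clm_apply contDiffOn_const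

theorem hasDerivAt_comp_dirDeriv {f : E → F} {U : Set E} (hf : ContDiffOn ℝ ∞ f U)
    (hU : IsOpen U) {γ : ℝ → E} {v : E} {t : ℝ} (hγ : HasDerivAt γ v t) (ht : γ t ∈ U) :
    HasDerivAt (fun t => f (γ t)) (dirDeriv v f (γ t)) t :=
  (((hf.contDiffAt (hU.mem_nhds ht)).differentiableAt
    (by simp)).hasFDerivAt).comp_hasDerivAt t hγ

theorem exists_bound_of_contDiffOn {f : E → F} {U K : Set E} (hf : ContDiffOn ℝ ∞ f U)
    (hK : IsCompact K) (hKU : K ⊆ U) : ∃ M : ℝ, 1 ≤ M ∧ ∀ z ∈ K, ‖f z‖ ≤ M := by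
  obtain ⟨M, hM⟩ := hK.exists_bound_of_continuousOn (hf.continuousOn.mono hKU)
  exact ⟨max M 1, le_max_right _ _, fun z hz => (hM z hz).trans (le_max_left _ _)⟩

end dirDeriv

/-! ### Four-term sums in symmetric coordinates. -/

/-- At fixed sum v, Cauchy's mean value theorem compares h((v+η)/2) + h((v-η)/2) with η². The
resulting quotient (h'((v+η)/2) - h'((v-η)/2))/η is a value of h'' by a second mean value theorem,
so nothing is lost as η tends to 0. -/
theorem exists_add_eq_of_sub {h h1 h2 : ℝ → ℝ} (hh : ∀ s, HasDerivAt h (h1 s) s)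
    (hh1 : ∀ s, HasDerivAt h1 (h2 s) s) {v u w : ℝ} (hu : 0 ≤ u) (huw : u < w) :
    ∃ ξ, |ξ - v / 2| ≤ w / 2 ∧
      (h ((v + w) / 2) + h ((v - w) / 2)) - (h ((v + u) / 2) + h ((v - u) / 2))
        = (w ^ 2 - u ^ 2) / 4 * h2 ξ := by
  have d1 : ∀ η : ℝ, HasDerivAt (fun η => h ((v + η) / 2) + h ((v - η) / 2))
      ((h1 ((v + η) / 2) - h1 ((v - η) / 2)) / 2) η := by
    intro η
    have e1 : HasDerivAt (fun η : ℝ => (v + η) / 2) (1 / 2) η :=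
      ((hasDerivAt_id η).const_add v).div_const 2
    have e2 : HasDerivAt (fun η : ℝ => (v - η) / 2) (-1 / 2) η :=
      ((hasDerivAt_id η).const_sub v).div_const 2
    refine (((hh _).comp η e1).add ((hh _).comp η e2)).congr_deriv ?_
    ring
  have d2 : ∀ η : ℝ, HasDerivAt (fun η : ℝ => η ^ 2) (2 * η) η := by
    intro η; simpa using hasDerivAt_pow 2 η
  obtain ⟨η, hη, he⟩ := exists_ratio_hasDerivAt_eq_ratio_slope _ _ huw
    (fun x _ => (d1 x).continuousAt.continuousWithinAt) (fun x _ => d1 x) _ _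
    (fun x _ => (d2 x).continuousAt.continuousWithinAt) (fun x _ => d2 x)
  have hη0 : 0 < η := hu.trans_lt hη.1
  obtain ⟨ξ, hξ, hx⟩ := exists_hasDerivAt_eq_slope h1 h2 (a := (v - η) / 2) (b := (v + η) / 2)
    (by linarith) (fun x _ => (hh1 x).continuousAt.continuousWithinAt) (fun x _ => hh1 x)
  have hden : (v + η) / 2 - (v - η) / 2 = η := by ring
  rw [hden, eq_div_iff hη0.ne'] at hx
  refine ⟨ξ, ?_, ?_⟩
  · rw [abs_le]; constructor <;> linarith [hξ.1, hξ.2, hη.2]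
  · rw [← hx] at he
    have : η * ((w ^ 2 - u ^ 2) * h2 ξ / 4 -
      ((h ((v + w) / 2) + h ((v - w) / 2)) - (h ((v + u) / 2) + h ((v - u) / 2)))) = 0 := by
      linear_combination he / 2
    rcases mul_eq_zero.1 this with h0 | h0
    · exact absurd h0 hη0.ne'
    · linarith

/-- Mean value formula for four-term sums in the coordinates `s₁ + s₂` and `(s₁ - s₂)²`. -/
theorem exists_four_term_eq {h h1 h2 : ℝ → ℝ} (hh : ∀ s, HasDerivAt h (h1 s) s)
    (hh1 : ∀ s, HasDerivAt h1 (h2 s) s) {ε s1 s2 s3 s4 : ℝ} (m1 : s1 ∈ Set.Icc 0 ε)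
    (m2 : s2 ∈ Set.Icc 0 ε) (m3 : s3 ∈ Set.Icc 0 ε) (m4 : s4 ∈ Set.Icc 0 ε) (h12 : s2 ≤ s1)
    (h34 : s4 ≤ s3) : ∃ ξ1 ξ2 ξ3, |ξ1| ≤ 2 * ε ∧ |ξ2| ≤ 2 * ε ∧ |ξ3| ≤ 2 * ε ∧
      h s1 + h s2 - h s3 - h s4 = (s1 + s2 - s3 - s4) * ((h1 ξ1 + h1 ξ2) / 2)
        + ((s1 - s2) ^ 2 - (s3 - s4) ^ 2) / 4 * h2 ξ3 := by
  obtain ⟨l1, r1⟩ := m1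
  obtain ⟨l2, r2⟩ := m2
  obtain ⟨l3, r3⟩ := m3
  obtain ⟨l4, r4⟩ := m4
  set u := s1 - s2 with hu
  set F : ℝ → ℝ := fun v => h ((v + u) / 2) + h ((v - u) / 2) with hF
  have dF : ∀ v, HasDerivAt F ((h1 ((v + u) / 2) + h1 ((v - u) / 2)) / 2) v := by
    intro v
    have e1 : HasDerivAt (fun v : ℝ => (v + u) / 2) (1 / 2) v :=
      ((hasDerivAt_id v).add_const u).div_const 2
    have e2 : HasDerivAt (fun v : ℝ => (v - u) / 2) (1 / 2) v :=
      ((hasDerivAt_id v).sub_const u).div_const 2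
    refine (((hh _).comp v e1).add ((hh _).comp v e2)).congr_deriv ?_
    ring
  -- The path from (s₁, s₂) to (s₃, s₄) first moves the sum at fixed difference u, then the
  -- difference at fixed sum. The intermediate pairs may leave [0, ε], which is why the points are
  -- only bounded by 2ε.
  have A : ∃ ξ1 ξ2, |ξ1| ≤ 2 * ε ∧ |ξ2| ≤ 2 * ε ∧
      F (s1 + s2) - F (s3 + s4) = (s1 + s2 - s3 - s4) * ((h1 ξ1 + h1 ξ2) / 2) := by
    have B : ∃ v, 0 ≤ v ∧ v ≤ 2 * ε ∧ F (s1 + s2) - F (s3 + s4)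
        = (s1 + s2 - s3 - s4) * ((h1 ((v + u) / 2) + h1 ((v - u) / 2)) / 2) := by
      rcases lt_trichotomy (s1 + s2) (s3 + s4) with hlt | heq | hgt
      · obtain ⟨v, hv, he⟩ := exists_hasDerivAt_eq_slope F _ hlt
          (fun x _ => (dF x).continuousAt.continuousWithinAt) (fun x _ => dF x)
        rw [eq_div_iff (by linarith)] at he
        exact ⟨v, by linarith [hv.1], by linarith [hv.2], by linear_combination he⟩
      · exact ⟨0, le_rfl, by linarith, by rw [heq]; ring⟩
      · obtain ⟨v, hv, he⟩ := exists_hasDerivAt_eq_slope F _ hgt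
          (fun x _ => (dF x).continuousAt.continuousWithinAt) (fun x _ => dF x)
        rw [eq_div_iff (by linarith)] at he
        exact ⟨v, by linarith [hv.1], by linarith [hv.2], by linear_combination -he⟩
    obtain ⟨v, hv0, hv1, he⟩ := B
    refine ⟨_, _, ?_, ?_, he⟩ <;> rw [abs_le] <;> constructor <;> linarith
  have C : ∃ ξ3, |ξ3| ≤ 2 * ε ∧ F (s3 + s4) - (h s3 + h s4)
      = (u ^ 2 - (s3 - s4) ^ 2) / 4 * h2 ξ3 := by
    have e3 : h s3 = h ((s3 + s4 + (s3 - s4)) / 2) := by congr 1; ring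
    have e4 : h s4 = h ((s3 + s4 - (s3 - s4)) / 2) := by congr 1; ring
    rw [e3, e4]
    have aux : ∀ ξ w : ℝ, |ξ - (s3 + s4) / 2| ≤ w / 2 → w ≤ ε → |ξ| ≤ 2 * ε := by
      intro ξ w hξ hw
      rw [abs_le] at hξ ⊢; constructor <;> linarith [hξ.1, hξ.2]
    rcases lt_trichotomy u (s3 - s4) with hlt | heq | hgt
    · obtain ⟨ξ, hξ, he⟩ := exists_add_eq_of_sub hh hh1 (v := s3 + s4) (by linarith) hlt
      exact ⟨ξ, aux ξ _ hξ (by linarith), by simp only [hF]; linear_combination -he⟩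
    · refine ⟨0, by simp; linarith, ?_⟩
      simp only [hF, heq]; ring
    · obtain ⟨ξ, hξ, he⟩ := exists_add_eq_of_sub hh hh1 (v := s3 + s4) (by linarith) hgt
      exact ⟨ξ, aux ξ _ hξ (by linarith), by simp only [hF]; linear_combination he⟩
  obtain ⟨ξ1, ξ2, b1, b2, e12⟩ := A
  obtain ⟨ξ3, b3, e3⟩ := C
  refine ⟨ξ1, ξ2, ξ3, b1, b2, b3, ?_⟩
  have e1 : h s1 = h ((s1 + s2 + u) / 2) := by congr 1; rw [hu]; ring
  have e2 : h s2 = h ((s1 + s2 - u) / 2) := by congr 1; rw [hu]; ring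
  have : h s1 + h s2 = F (s1 + s2) := by rw [e1, e2]
  linear_combination this + e12 + e3

/-- The alternating sum of `h` over two pairs. -/
def fourSum (h : ℝ → ℝ) (z w : ℝ × ℝ) : ℝ := h z.1 + h z.2 - h w.1 - h w.2

/-- The distance of two pairs in the coordinates `s₁ + s₂` and `(s₁ - s₂)²`. -/
def pairDist (z w : ℝ × ℝ) : ℝ :=
  |z.1 + z.2 - w.1 - w.2| + |(z.1 - z.2) ^ 2 - (w.1 - w.2) ^ 2|

/-- Ordered pairs of points of `[0, ε]`. -/
def orderedPairs (ε : ℝ) : Set (ℝ × ℝ) := {z | 0 ≤ z.2 ∧ z.2 ≤ z.1 ∧ z.1 ≤ ε}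

theorem orderedPairs_mem {ε : ℝ} {z : ℝ × ℝ} (hz : z ∈ orderedPairs ε) :
    z.1 ∈ Set.Icc 0 ε ∧ z.2 ∈ Set.Icc 0 ε :=
  ⟨⟨hz.1.trans hz.2.1, hz.2.2⟩, ⟨hz.1, hz.2.1.trans hz.2.2⟩⟩

theorem isCompact_orderedPairs (ε : ℝ) : IsCompact (orderedPairs ε) := by
  refine (isCompact_Icc.prod isCompact_Icc : IsCompact (Set.Icc (0:ℝ) ε ×ˢ Set.Icc (0:ℝ) ε)).of_isClosed_subset ?_
    (fun z hz => ⟨(orderedPairs_mem hz).1, (orderedPairs_mem hz).2⟩)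
  exact (isClosed_le continuous_const continuous_snd).inter
    ((isClosed_le continuous_snd continuous_fst).inter
    (isClosed_le continuous_fst continuous_const))

/-- Makes every t-derivative of the four-term phase O(`pairDist`), so that division by `pairDist`
normalises the phase uniformly in both pairs. -/
theorem abs_fourSum_le {h h1 h2 : ℝ → ℝ} (hh : ∀ s, HasDerivAt h (h1 s) s)
    (hh1 : ∀ s, HasDerivAt h1 (h2 s) s) {ε M : ℝ} {z w : ℝ × ℝ} (hz : z ∈ orderedPairs ε)
    (hw : w ∈ orderedPairs ε) (b1 : ∀ s, |s| ≤ 2 * ε → |h1 s| ≤ M)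
    (b2 : ∀ s, |s| ≤ 2 * ε → |h2 s| ≤ M) : |fourSum h z w| ≤ M * pairDist z w := by
  obtain ⟨m1, m2⟩ := orderedPairs_mem hz
  obtain ⟨m3, m4⟩ := orderedPairs_mem hw
  obtain ⟨x1, x2, x3, c1, c2, c3, he⟩ := exists_four_term_eq hh hh1 m1 m2 m3 m4 hz.2.1 hw.2.1
  rw [fourSum, he, pairDist, mul_add]
  have d1 := b1 _ c1
  have d2 := b1 _ c2
  have d3 := b2 _ c3
  have hM : 0 ≤ M := (abs_nonneg _).trans d1
  refine (abs_add_le _ _).trans (add_le_add ?_ ?_)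
  · rw [abs_mul, mul_comm]
    gcongr
    rw [abs_div, abs_two]
    linarith [abs_add_le (h1 x1) (h1 x2)]
  · rw [abs_mul, mul_comm, abs_div, show |(4:ℝ)| = 4 by norm_num]
    gcongr
    linarith [abs_nonneg ((z.1 - z.2) ^ 2 - (w.1 - w.2) ^ 2)]

/-! ### Decay of oscillatory integrals with a four-term phase. -/

theorem HasDerivAt.fourSum {H H1 : ℝ → ℝ → ℝ} {t : ℝ} {z w : ℝ × ℝ}
    (h : ∀ s, HasDerivAt (fun t => H t s) (H1 t s) t) :
    HasDerivAt (fun t => fourSum (H t) z w) (fourSum (H1 t) z w) t :=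
  (((h _).add (h _)).sub (h _)).sub (h _)

/-- Supplies the vanishing of the amplitude's derivatives at the endpoints, which removes the
boundary terms in the integrations by parts. -/
theorem dirDeriv_eventually_zero {F : Type*} [NormedAddCommGroup F] [NormedSpace ℝ F]
    {f f1 : ℝ → F} {t : ℝ} (hf : ∀ t, HasDerivAt f (f1 t) t) (h : ∀ᶠ x in nhds t, f x = 0) :
    ∀ᶠ x in nhds t, f1 x = 0 := by
  filter_upwards [h.eventually_nhds] with x hx
  have : HasDerivAt f 0 x := (hasDerivAt_const x (0 : F)).congr_of_eventuallyEq hx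
  exact (hf x).unique this

/-- Decay of an oscillatory integral along a line, given a lower bound of the first derivative of
the four-term phase. -/
theorem exists_norm_integral_fourSum_le {H : ℝ × ℝ × ℝ → ℝ} {U : Set (ℝ × ℝ × ℝ)}
    (hU : IsOpen U) (hH : ContDiffOn ℝ ∞ H U) {Kp : Set ℝ} (hKp : IsCompact Kp) {α β : ℝ}
    (hαβ : α ≤ β) (hKU : ∀ p ∈ Kp, ∀ t ∈ Set.Icc α β, ∀ s, (p, t, s) ∈ U)
    {a : ℝ × ℝ × ((ℝ × ℝ) × (ℝ × ℝ)) → ℂ} (ha : ContDiff ℝ ∞ a) {ε m : ℝ} (hm : 0 < m) :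
    ∃ K : ℝ, 0 < K ∧ ∀ p ∈ Kp, ∀ z ∈ orderedPairs ε, ∀ w ∈ orderedPairs ε, ∀ L : ℝ, 0 < L →
      (∀ᶠ t in nhds α, a (p, t, z, w) = 0) → (∀ᶠ t in nhds β, a (p, t, z, w) = 0) →
      0 < pairDist z w →
      (∀ t ∈ Set.Icc α β, m * pairDist z w
        ≤ |fourSum (fun s => dirDeriv (0, 1, 0) H (p, t, s)) z w|) →
      ‖∫ t in α..β, Complex.exp (Complex.I * L * (fourSum (fun s => H (p, t, s)) z w : ℝ))
        * a (p, t, z, w)‖ ≤ K / (L * pairDist z w) ^ 3 := by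
  set H1 := dirDeriv (0, 1, 0) H with hH1
  set H2 := dirDeriv (0, 1, 0) H1 with hH2
  set H3 := dirDeriv (0, 1, 0) H2 with hH3
  set H4 := dirDeriv (0, 1, 0) H3 with hH4
  have sH1 : ContDiffOn ℝ ∞ H1 U := hH.dirDeriv hU _
  have sH2 : ContDiffOn ℝ ∞ H2 U := sH1.dirDeriv hU _
  have sH3 : ContDiffOn ℝ ∞ H3 U := sH2.dirDeriv hU _
  have sH4 : ContDiffOn ℝ ∞ H4 U := sH3.dirDeriv hU _
  -- The s-range is [-2ε, 2ε] because the mean value points of the four-term formula live there.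
  set Q : Set (ℝ × ℝ × ℝ) := Kp ×ˢ (Set.Icc α β ×ˢ Set.Icc (-(2 * ε)) (2 * ε)) with hQ
  have hQc : IsCompact Q := hKp.prod (isCompact_Icc.prod isCompact_Icc)
  have hQU : Q ⊆ U := fun x hx => hKU x.1 hx.1 x.2.1 hx.2.1 x.2.2
  have bound : ∀ {G : ℝ × ℝ × ℝ → ℝ}, ContDiffOn ℝ ∞ G U → ∃ M : ℝ, 1 ≤ M ∧
      ∀ p ∈ Kp, ∀ t ∈ Set.Icc α β, ∀ z ∈ orderedPairs ε, ∀ w ∈ orderedPairs ε,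
      |fourSum (fun s => G (p, t, s)) z w| ≤ M * pairDist z w := by
    intro G hG
    obtain ⟨M1, h1, b1⟩ := exists_bound_of_contDiffOn (hG.dirDeriv hU (0, 0, 1)) hQc hQU
    obtain ⟨M2, h2, b2⟩ := exists_bound_of_contDiffOn
      ((hG.dirDeriv hU (0, 0, 1)).dirDeriv hU (0, 0, 1)) hQc hQU
    refine ⟨max M1 M2, h1.trans (le_max_left _ _), fun p hp t ht z hz w hw => ?_⟩
    have ds : ∀ s : ℝ, HasDerivAt (fun s : ℝ => ((p, t, s) : ℝ × ℝ × ℝ)) (0, 0, 1) s := fun s =>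
      (hasDerivAt_const s p).prodMk ((hasDerivAt_const s t).prodMk (hasDerivAt_id s))
    exact abs_fourSum_le
      (fun s => hasDerivAt_comp_dirDeriv hG hU (ds s) (hKU p hp t ht s))
      (fun s => hasDerivAt_comp_dirDeriv (hG.dirDeriv hU _) hU (ds s) (hKU p hp t ht s)) hz hw
      (fun s hs => (b1 (p, t, s) ⟨hp, ht, abs_le.1 hs⟩).trans (le_max_left _ _))
      (fun s hs => (b2 (p, t, s) ⟨hp, ht, abs_le.1 hs⟩).trans (le_max_right _ _))
  obtain ⟨M2, g2, B2⟩ := bound sH2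
  obtain ⟨M3, g3, B3⟩ := bound sH3
  obtain ⟨M4, g4, B4⟩ := bound sH4
  have ha' : ContDiffOn ℝ ∞ a Set.univ := ha.contDiffOn
  have sa1 := ha'.dirDeriv isOpen_univ (0, 1, 0)
  have sa2 := sa1.dirDeriv isOpen_univ (0, 1, 0)
  have sa3 := sa2.dirDeriv isOpen_univ (0, 1, 0)
  set a1 := dirDeriv (0, 1, 0) a
  set a2 := dirDeriv (0, 1, 0) a1
  set a3 := dirDeriv (0, 1, 0) a2
  set Qa : Set (ℝ × ℝ × ((ℝ × ℝ) × (ℝ × ℝ))) :=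
    Kp ×ˢ (Set.Icc α β ×ˢ (orderedPairs ε ×ˢ orderedPairs ε)) with hQa
  have hQac : IsCompact Qa := hKp.prod (isCompact_Icc.prod
    ((isCompact_orderedPairs ε).prod (isCompact_orderedPairs ε)))
  obtain ⟨N0, n0, C0⟩ := exists_bound_of_contDiffOn ha' hQac (Set.subset_univ _)
  obtain ⟨N1, n1, C1⟩ := exists_bound_of_contDiffOn sa1 hQac (Set.subset_univ _)
  obtain ⟨N2, n2, C2⟩ := exists_bound_of_contDiffOn sa2 hQac (Set.subset_univ _)
  obtain ⟨N3, n3, C3⟩ := exists_bound_of_contDiffOn sa3 hQac (Set.subset_univ _)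
  -- The summand `m⁻¹` turns the lower bound `m` on the normalised first derivative into `M⁻¹`.
  set M : ℝ := m⁻¹ + M2 + M3 + M4 + N0 + N1 + N2 + N3 with hM
  have hm' : 0 < m⁻¹ := inv_pos.2 hm
  obtain ⟨K, hK, key⟩ := exists_norm_integral_exp_mul_le M (by linarith)
  refine ⟨K * (β - α + 1), mul_pos hK (by linarith), ?_⟩
  intro p hp z hz w hw L hL eα eβ hD hlow
  set D := pairDist z w with hDdef
  have dt : ∀ t : ℝ, ∀ s : ℝ, HasDerivAt (fun t : ℝ => ((p, t, s) : ℝ × ℝ × ℝ)) (0, 1, 0) t :=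
    fun t s => (hasDerivAt_const t p).prodMk ((hasDerivAt_id t).prodMk (hasDerivAt_const t s))
  have dta : ∀ t : ℝ, HasDerivAt (fun t : ℝ => ((p, t, z, w) : ℝ × ℝ × ((ℝ × ℝ) × (ℝ × ℝ))))
      (0, 1, 0) t := fun t =>
    (hasDerivAt_const t p).prodMk ((hasDerivAt_id t).prodMk (hasDerivAt_const t (z, w)))
  have hder : ∀ {G : ℝ × ℝ × ℝ → ℝ}, ContDiffOn ℝ ∞ G U → ∀ t ∈ Set.Icc α β,
      HasDerivAt (fun t => fourSum (fun s => G (p, t, s)) z w / D)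
        (fourSum (fun s => dirDeriv (0, 1, 0) G (p, t, s)) z w / D) t := by
    intro G hG t ht
    exact (HasDerivAt.fourSum (H := fun t s => G (p, t, s))
      (H1 := fun t s => dirDeriv (0, 1, 0) G (p, t, s)) fun s =>
      hasDerivAt_comp_dirDeriv hG hU (dt t s) (hKU p hp t ht s)).div_const D
  have hdera : ∀ {G : ℝ × ℝ × ((ℝ × ℝ) × (ℝ × ℝ)) → ℂ}, ContDiffOn ℝ ∞ G Set.univ → ∀ t,
      HasDerivAt (fun t => G (p, t, z, w)) (dirDeriv (0, 1, 0) G (p, t, z, w)) t := fun hG t =>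
    hasDerivAt_comp_dirDeriv hG isOpen_univ (dta t) trivial
  have eα1 := dirDeriv_eventually_zero (hdera ha') eα
  have eβ1 := dirDeriv_eventually_zero (hdera ha') eβ
  have eα2 := dirDeriv_eventually_zero (hdera sa1) eα1
  have eβ2 := dirDeriv_eventually_zero (hdera sa1) eβ1
  have up : ∀ {x B : ℝ}, B ≤ M → |x| ≤ B * D → |x / D| ≤ M := by
    intro x B hB hx
    rw [abs_div, abs_of_pos hD, div_le_iff₀ hD]
    exact hx.trans (by gcongr)
  have lowM : M⁻¹ ≤ m := inv_le_of_inv_le₀ hm (by linarith)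
  -- Phase divided by D, frequency multiplied by D: the normalised phase has derivatives bounded
  -- independently of z and w, and the decay is in L D.
  have h := key α β (L * D) (fun t => fourSum (fun s => H (p, t, s)) z w / D)
    (fun t => fourSum (fun s => H1 (p, t, s)) z w / D)
    (fun t => fourSum (fun s => H2 (p, t, s)) z w / D)
    (fun t => fourSum (fun s => H3 (p, t, s)) z w / D)
    (fun t => fourSum (fun s => H4 (p, t, s)) z w / D)
    (fun t => a (p, t, z, w)) (fun t => a1 (p, t, z, w)) (fun t => a2 (p, t, z, w))
    (fun t => a3 (p, t, z, w)) hαβ (by positivity) (hder hH) (hder sH1) (hder sH2) (hder sH3)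
    (fun t ht => (hder sH4 t ht).continuousAt.continuousWithinAt)
    (fun t _ => hdera ha' t) (fun t _ => hdera sa1 t) (fun t _ => hdera sa2 t)
    (fun t _ => (hdera sa3 t).continuousAt.continuousWithinAt)
    (fun t ht => by
      rw [abs_div, abs_of_pos hD, le_div_iff₀ hD]
      exact le_trans (by gcongr) (hlow t ht))
    (fun t ht => up (by linarith) (B2 p hp t ht z hz w hw))
    (fun t ht => up (by linarith) (B3 p hp t ht z hz w hw))
    (fun t ht => up (by linarith) (B4 p hp t ht z hz w hw))
    (fun t ht => (C0 (p, t, z, w) ⟨hp, ht, hz, hw⟩).trans (by linarith))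
    (fun t ht => (C1 (p, t, z, w) ⟨hp, ht, hz, hw⟩).trans (by linarith))
    (fun t ht => (C2 (p, t, z, w) ⟨hp, ht, hz, hw⟩).trans (by linarith))
    (fun t ht => (C3 (p, t, z, w) ⟨hp, ht, hz, hw⟩).trans (by linarith))
    eα.self_of_nhds eβ.self_of_nhds eα1.self_of_nhds eβ1.self_of_nhds eα2.self_of_nhds
    eβ2.self_of_nhds
  have e : ∀ t, Complex.exp (Complex.I * L * (fourSum (fun s => H (p, t, s)) z w : ℝ))
      = Complex.exp (Complex.I * (L * D : ℝ) * (fourSum (fun s => H (p, t, s)) z w / D : ℝ)) := by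
    intro t
    have : (D : ℂ) ≠ 0 := by exact_mod_cast hD.ne'
    congr 1; push_cast; field_simp
  simp_rw [e]
  refine h.trans ?_
  gcongr
  linarith

/-! ### The distance function, and lower bounds for derivatives of the phase. -/

/-- The Euclidean norm of `(a, b)`. -/
noncomputable def hyp (a b : ℝ) : ℝ := √(a ^ 2 + b ^ 2)

theorem hyp_sq (a b : ℝ) : hyp a b ^ 2 = a ^ 2 + b ^ 2 := Real.sq_sqrt (by positivity)

theorem hyp_pos {a b : ℝ} (hb : b ≠ 0) : 0 < hyp a b := Real.sqrt_pos.2 (by positivity)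

theorem abs_le_hyp_left (a b : ℝ) : |a| ≤ hyp a b :=
  Real.abs_le_sqrt (by linarith [sq_nonneg b])

theorem abs_le_hyp_right (a b : ℝ) : |b| ≤ hyp a b :=
  Real.abs_le_sqrt (by linarith [sq_nonneg a])

theorem hyp_le_add (a b : ℝ) : hyp a b ≤ |a| + |b| := by
  refine Real.sqrt_le_iff.2 ⟨by positivity, ?_⟩
  nlinarith [abs_nonneg a, abs_nonneg b, sq_abs a, sq_abs b]

theorem HasDerivAt.hyp {f g : ℝ → ℝ} {f' g' t : ℝ} (hf : HasDerivAt f f' t)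
    (hg : HasDerivAt g g' t) (h : g t ≠ 0) :
    HasDerivAt (fun t => hyp (f t) (g t)) ((f t * f' + g t * g') / hyp (f t) (g t)) t := by
  have h1 := ((hf.pow 2).add (hg.pow 2)).sqrt (by
    have := pow_pos (abs_pos.2 h) 2
    rw [sq_abs] at this
    simp only [Pi.add_apply, Pi.pow_apply]
    positivity)
  refine h1.congr_deriv ?_
  have := hyp_pos (a := f t) h
  simp only [Pi.add_apply, Pi.pow_apply]
  rw [show √(f t ^ 2 + g t ^ 2) = _root_.hyp (f t) (g t) from rfl]
  field_simp
  norm_num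
  ring

theorem hasDerivAt_hyp_sub {A y : ℝ} (hy : y ≠ 0) (s : ℝ) :
    HasDerivAt (fun s => hyp (A - s) y) (-(A - s) / hyp (A - s) y) s := by
  refine (((hasDerivAt_id s).const_sub A).hyp (hasDerivAt_const s y) hy).congr_deriv ?_
  simp

theorem hasDerivAt_hyp_horizontal {y : ℝ} (hy : y ≠ 0) (t s : ℝ) :
    HasDerivAt (fun t => hyp (t - s) y) ((t - s) / hyp (t - s) y) t := by
  refine (((hasDerivAt_id t).sub_const s).hyp (hasDerivAt_const t y) hy).congr_deriv ?_
  simp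

theorem hasDerivAt_hyp_radial {p t : ℝ} (ht : t ≠ 0) (s : ℝ) :
    HasDerivAt (fun t => hyp (t * p - s) t) (((t * p - s) * p + t) / hyp (t * p - s) t) t := by
  refine ((((hasDerivAt_id t).mul_const p).sub_const s).hyp (hasDerivAt_id t) ht).congr_deriv ?_
  simp

/-- This mixed derivative never vanishes for y ≠ 0, so the horizontal derivative of the phase
detects differences of s₁ + s₂. -/
theorem hasDerivAt_horizontal_one {t y : ℝ} (hy : y ≠ 0) (s : ℝ) :
    HasDerivAt (fun s => (t - s) / hyp (t - s) y) (-y ^ 2 / hyp (t - s) y ^ 3) s := by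
  have hp := hyp_pos (a := t - s) hy
  refine (((hasDerivAt_id s).const_sub t).div (hasDerivAt_hyp_sub hy s) hp.ne').congr_deriv ?_
  have := hyp_sq (t - s) y
  simp only [id]
  field_simp
  linear_combination -this

theorem hasDerivAt_horizontal_two {t y : ℝ} (hy : y ≠ 0) (s : ℝ) :
    HasDerivAt (fun s => -y ^ 2 / hyp (t - s) y ^ 3)
      (-3 * y ^ 2 * (t - s) / hyp (t - s) y ^ 5) s := by
  have hp := hyp_pos (a := t - s) hy
  refine ((hasDerivAt_const s (-y ^ 2)).div ((hasDerivAt_hyp_sub hy s).pow 3)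
    (pow_pos hp 3).ne').congr_deriv ?_
  simp only [Pi.pow_apply]
  push_cast
  field_simp
  ring

/-- Along a ray through the origin the distance to the origin grows at the maximal rate, so this
mixed derivative vanishes at s = 0. The contribution of s₁ + s₂ is therefore small near s = 0. -/
theorem hasDerivAt_radial_one {p t : ℝ} (ht : t ≠ 0) (s : ℝ) :
    HasDerivAt (fun s => ((t * p - s) * p + t) / hyp (t * p - s) t)
      (-(t * s) / hyp (t * p - s) t ^ 3) s := by
  have hp := hyp_pos (a := t * p - s) ht
  refine (((((hasDerivAt_id s).const_sub (t * p)).mul_const p).add_const t).div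
    (hasDerivAt_hyp_sub ht s) hp.ne').congr_deriv ?_
  have := hyp_sq (t * p - s) t
  simp only [id]
  generalize hyp (t * p - s) t = ρ at *
  field_simp
  linear_combination (-p) * this

/-- At s = 0 only the first term survives and it is nonzero: the radial derivative of the phase
detects differences of (s₁ - s₂)². -/
theorem hasDerivAt_radial_two {p t : ℝ} (ht : t ≠ 0) (s : ℝ) :
    HasDerivAt (fun s => -(t * s) / hyp (t * p - s) t ^ 3)
      (-t / hyp (t * p - s) t ^ 3 - 3 * t * s * (t * p - s) / hyp (t * p - s) t ^ 5) s := by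
  have hp := hyp_pos (a := t * p - s) ht
  refine ((((hasDerivAt_id s).const_mul t).neg).div ((hasDerivAt_hyp_sub ht s).pow 3)
    (pow_pos hp 3).ne').congr_deriv ?_
  simp only [Pi.pow_apply, Pi.neg_apply, id]
  push_cast
  field_simp

/-- Lower bound for the horizontal derivative of the phase when the sums dominate. -/
theorem exists_horizontal_lower {c B : ℝ} (hc : 0 < c) (hB : 0 < B) : ∃ κ m : ℝ, 0 < κ ∧ 0 < m ∧
    ∀ (ε y t : ℝ) (z w : ℝ × ℝ), z ∈ orderedPairs ε → w ∈ orderedPairs ε → c ≤ |y| →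
      (∀ s, |s| ≤ 2 * ε → hyp (t - s) y ≤ B) →
      |(z.1 - z.2) ^ 2 - (w.1 - w.2) ^ 2| ≤ κ * |z.1 + z.2 - w.1 - w.2| →
      m * pairDist z w ≤ |fourSum (fun s => (t - s) / hyp (t - s) y) z w| := by
  set c1 := c ^ 2 / B ^ 3 with hc1
  have hc1p : 0 < c1 := by positivity
  -- `c1` is a lower bound for y²/ρ³ and 3/c² an upper bound for the second s-derivative, so this κ
  -- makes the W-term at most c1|V|/4 against a main term of at least c1|V|. The 1 in the minimum
  -- gives |W| ≤ |V|.
  refine ⟨min 1 (c1 * c ^ 2 / 3), c1 / 4, by positivity, by positivity, ?_⟩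
  intro ε y t z w hz hw hy hρ hvw
  have hy0 : y ≠ 0 := by rintro rfl; simp at hy; linarith
  obtain ⟨m1, m2⟩ := orderedPairs_mem hz
  obtain ⟨m3, m4⟩ := orderedPairs_mem hw
  obtain ⟨x1, x2, x3, e1, e2, e3, he⟩ := exists_four_term_eq
    (hasDerivAt_horizontal_one (t := t) hy0) (hasDerivAt_horizontal_two hy0) m1 m2 m3 m4
    hz.2.1 hw.2.1
  rw [fourSum, he, pairDist]
  set V := z.1 + z.2 - w.1 - w.2
  set W := (z.1 - z.2) ^ 2 - (w.1 - w.2) ^ 2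
  have lo : ∀ s, |s| ≤ 2 * ε → -y ^ 2 / hyp (t - s) y ^ 3 ≤ -c1 := by
    intro s hs
    have hp := hyp_pos (a := t - s) hy0
    rw [neg_div, neg_le_neg_iff, hc1, ← sq_abs y]
    have := hρ s hs
    gcongr
  have up : |-3 * y ^ 2 * (t - x3) / hyp (t - x3) y ^ 5| ≤ 3 / c ^ 2 := by
    have hp := hyp_pos (a := t - x3) hy0
    have h1 := abs_le_hyp_left (t - x3) y
    have h2 := abs_le_hyp_right (t - x3) y
    have h3 : c ≤ hyp (t - x3) y := hy.trans h2
    rw [abs_div, abs_mul, abs_mul, abs_of_pos (pow_pos hp 5), abs_pow,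
      show |(-3:ℝ)| = 3 by norm_num]
    set ρ := hyp (t - x3) y
    calc 3 * |y| ^ 2 * |t - x3| / ρ ^ 5 ≤ 3 * ρ ^ 2 * ρ / ρ ^ 5 := by gcongr
      _ = 3 / ρ ^ 2 := by field_simp
      _ ≤ _ := by gcongr
  have A : c1 * |V| ≤ |V * ((-y ^ 2 / hyp (t - x1) y ^ 3 + -y ^ 2 / hyp (t - x2) y ^ 3) / 2)| := by
    rw [abs_mul, mul_comm]
    gcongr
    rw [abs_of_nonpos (by linarith [lo x1 e1, lo x2 e2])]
    linarith [lo x1 e1, lo x2 e2]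
  have B' : |W / 4 * (-3 * y ^ 2 * (t - x3) / hyp (t - x3) y ^ 5)| ≤ c1 / 4 * |V| := by
    rw [abs_mul, abs_div, show |(4:ℝ)| = 4 by norm_num]
    calc |W| / 4 * _ ≤ (c1 * c ^ 2 / 3 * |V|) / 4 * (3 / c ^ 2) := by
          gcongr
          exact hvw.trans (by gcongr; exact min_le_right _ _)
      _ = _ := by field_simp
  have hW : |W| ≤ |V| := hvw.trans (by
    calc _ ≤ 1 * |V| := by gcongr; exact min_le_left _ _
      _ = _ := one_mul _)
  have := abs_sub_abs_le_abs_sub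
    (V * ((-y ^ 2 / hyp (t - x1) y ^ 3 + -y ^ 2 / hyp (t - x2) y ^ 3) / 2))
    (-(W / 4 * (-3 * y ^ 2 * (t - x3) / hyp (t - x3) y ^ 5)))
  rw [sub_neg_eq_add, abs_neg] at this
  nlinarith [abs_nonneg V]

/-- Lower bound for the radial derivative of the phase when the differences dominate. -/
theorem exists_radial_lower {c B κ : ℝ} (hc : 0 < c) (hB : 0 < B) (hκ : 0 < κ) :
    ∃ ε₀ m : ℝ, 0 < ε₀ ∧ 0 < m ∧
    ∀ (ε p t : ℝ) (z w : ℝ × ℝ), ε ≤ ε₀ → z ∈ orderedPairs ε → w ∈ orderedPairs ε → c ≤ |t| →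
      (∀ s, |s| ≤ 2 * ε → hyp (t * p - s) t ≤ B) →
      κ * |z.1 + z.2 - w.1 - w.2| ≤ |(z.1 - z.2) ^ 2 - (w.1 - w.2) ^ 2| →
      m * pairDist z w ≤ |fourSum (fun s => ((t * p - s) * p + t) / hyp (t * p - s) t) z w| := by
  set c4 := c / (2 * B ^ 3) with hc4
  have hc4p : 0 < c4 := by positivity
  -- The bound c/12 keeps the second s-derivative within a factor 2 of its leading term -t/ρ³. The
  -- other bound makes the V-term at most half of the guaranteed size of the W-term.
  refine ⟨min (c / 12) (c4 * c ^ 2 * κ / 16), c4 / (8 * (1 + 1 / κ)), by positivity,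
    by positivity, ?_⟩
  intro ε p t z w hε hz hw ht hρ hvw
  have ht0 : t ≠ 0 := by rintro rfl; simp at ht; linarith
  obtain ⟨m1, m2⟩ := orderedPairs_mem hz
  obtain ⟨m3, m4⟩ := orderedPairs_mem hw
  have hε0 : 0 ≤ ε := m1.1.trans m1.2
  obtain ⟨x1, x2, x3, e1, e2, e3, he⟩ := exists_four_term_eq
    (hasDerivAt_radial_one (p := p) ht0) (hasDerivAt_radial_two ht0) m1 m2 m3 m4
    hz.2.1 hw.2.1
  rw [fourSum, he, pairDist]
  set V := z.1 + z.2 - w.1 - w.2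
  set W := (z.1 - z.2) ^ 2 - (w.1 - w.2) ^ 2
  have up : ∀ s, |s| ≤ 2 * ε → |-(t * s) / hyp (t * p - s) t ^ 3| ≤ 2 * ε / c ^ 2 := by
    intro s hs
    have hp := hyp_pos (a := t * p - s) ht0
    have h2 := abs_le_hyp_right (t * p - s) t
    have h3 : c ≤ hyp (t * p - s) t := ht.trans h2
    rw [abs_div, abs_neg, abs_mul, abs_of_pos (pow_pos hp 3)]
    set ρ := hyp (t * p - s) t
    calc |t| * |s| / ρ ^ 3 ≤ ρ * (2 * ε) / ρ ^ 3 := by gcongr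
      _ = 2 * ε / ρ ^ 2 := by field_simp
      _ ≤ _ := by gcongr
  have lo : c4 ≤ |-t / hyp (t * p - x3) t ^ 3
      - 3 * t * x3 * (t * p - x3) / hyp (t * p - x3) t ^ 5| := by
    have hp := hyp_pos (a := t * p - x3) ht0
    have h1 := abs_le_hyp_left (t * p - x3) t
    have h2 := abs_le_hyp_right (t * p - x3) t
    have h3 := hρ x3 e3
    set ρ := hyp (t * p - x3) t
    have e : -t / ρ ^ 3 - 3 * t * x3 * (t * p - x3) / ρ ^ 5
        = -(t / ρ ^ 3) * (1 + 3 * x3 * (t * p - x3) / ρ ^ 2) := by field_simp; ring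
    have hs : |3 * x3 * (t * p - x3) / ρ ^ 2| ≤ 1 / 2 := by
      rw [abs_div, abs_mul, abs_mul, abs_of_pos (pow_pos hp 2), show |(3:ℝ)| = 3 by norm_num]
      have hc12 : |x3| ≤ c / 6 := by
        have := hε.trans (min_le_left _ _)
        linarith
      calc 3 * |x3| * |t * p - x3| / ρ ^ 2 ≤ 3 * (c / 6) * ρ / ρ ^ 2 := by gcongr
        _ = c / ρ * (1 / 2) := by field_simp; norm_num
        _ ≤ 1 * (1 / 2) := by
          gcongr
          rw [div_le_one hp]
          exact ht.trans h2
        _ = _ := one_mul _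
    rw [e, abs_mul, abs_neg, abs_div, abs_of_pos (pow_pos hp 3)]
    have h5 : 1 / 2 ≤ |1 + 3 * x3 * (t * p - x3) / ρ ^ 2| := by
      rw [abs_le] at hs
      exact le_trans (by linarith [hs.1]) (le_abs_self _)
    calc c4 = c / B ^ 3 * (1 / 2) := by rw [hc4]; field_simp
      _ ≤ |t| / ρ ^ 3 * |1 + 3 * x3 * (t * p - x3) / ρ ^ 2| := by gcongr
  have A : c4 / 4 * |W| ≤ |W / 4 * (-t / hyp (t * p - x3) t ^ 3
      - 3 * t * x3 * (t * p - x3) / hyp (t * p - x3) t ^ 5)| := by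
    rw [abs_mul, abs_div, show |(4:ℝ)| = 4 by norm_num]
    calc c4 / 4 * |W| = |W| / 4 * c4 := by ring
      _ ≤ _ := by gcongr
  have hVW : |V| ≤ |W| / κ := by rwa [le_div_iff₀ hκ, mul_comm]
  have B' : |V * ((-(t * x1) / hyp (t * p - x1) t ^ 3
      + -(t * x2) / hyp (t * p - x2) t ^ 3) / 2)| ≤ c4 / 8 * |W| := by
    rw [abs_mul, abs_div, abs_two]
    have h1 := abs_add_le (-(t * x1) / hyp (t * p - x1) t ^ 3) (-(t * x2) / hyp (t * p - x2) t ^ 3)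
    have h2 := up x1 e1
    have h3 := up x2 e2
    have hεk : ε ≤ c4 * c ^ 2 * κ / 16 := hε.trans (min_le_right _ _)
    have h4 : |-(t * x1) / hyp (t * p - x1) t ^ 3 + -(t * x2) / hyp (t * p - x2) t ^ 3| / 2
        ≤ 2 * ε / c ^ 2 := by linarith
    calc _ ≤ |W| / κ * (2 * ε / c ^ 2) := by gcongr
      _ ≤ |W| / κ * (2 * (c4 * c ^ 2 * κ / 16) / c ^ 2) := by gcongr
      _ = _ := by field_simp; ring
  have hD : c4 / (8 * (1 + 1 / κ)) * (|V| + |W|) ≤ c4 / 8 * |W| := by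
    calc c4 / (8 * (1 + 1 / κ)) * (|V| + |W|)
        ≤ c4 / (8 * (1 + 1 / κ)) * (|W| / κ + |W|) := by gcongr
      _ = _ := by field_simp; ring
  refine hD.trans ?_
  have := abs_sub_abs_le_abs_sub (W / 4 * (-t / hyp (t * p - x3) t ^ 3
      - 3 * t * x3 * (t * p - x3) / hyp (t * p - x3) t ^ 5))
    (-(V * ((-(t * x1) / hyp (t * p - x1) t ^ 3 + -(t * x2) / hyp (t * p - x2) t ^ 3) / 2)))
  rw [sub_neg_eq_add, abs_neg, add_comm (W / 4 * _)] at this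
  linarith

/-! ### The kernel of the bilinear operator composed with its adjoint. -/

/-- The support of `ψ` lies in a box and stays away from the horizontal axis. -/
def SupportedOffAxis (ψ : ℝ × ℝ → ℂ) (c R : ℝ) : Prop :=
  ∀ z, ψ z ≠ 0 → c ≤ |z.2| ∧ |z.2| ≤ R ∧ |z.1| ≤ R

/-- Product of four translates of `ψ`. -/
noncomputable def quadAmp (ψ : ℝ × ℝ → ℂ) (x z w : ℝ × ℝ) : ℂ :=
  ψ (x.1 - z.1, x.2) * ψ (x.1 - z.2, x.2) *
    (starRingEnd ℂ (ψ (x.1 - w.1, x.2)) * starRingEnd ℂ (ψ (x.1 - w.2, x.2)))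

/-- All translates are horizontal by at most ε ≤ 1, hence the unchanged second coordinate and the
enlargement of R to R + 1 in the first. -/
theorem quadAmp_ne_zero {ψ : ℝ × ℝ → ℂ} {c R ε : ℝ} (hψ : SupportedOffAxis ψ c R) (hε : ε ≤ 1)
    {x z w : ℝ × ℝ} (hz : z ∈ orderedPairs ε) (h : quadAmp ψ x z w ≠ 0) :
    c ≤ |x.2| ∧ |x.2| ≤ R ∧ |x.1| ≤ R + 1 := by
  have h1 : ψ (x.1 - z.1, x.2) ≠ 0 := by
    intro h0; apply h; simp [quadAmp, h0]
  obtain ⟨a, b, d⟩ := hψ _ h1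
  refine ⟨a, b, ?_⟩
  obtain ⟨m1, -⟩ := orderedPairs_mem hz
  simp only at d
  rw [abs_le] at d ⊢
  constructor <;> linarith [m1.1, m1.2, d.1, d.2]

theorem contDiff_quadAmp {E : Type*} [NormedAddCommGroup E] [NormedSpace ℝ E]
    {ψ : ℝ × ℝ → ℂ} (hψ : ContDiff ℝ ∞ ψ) {x z w : E → ℝ × ℝ} (hx : ContDiff ℝ ∞ x)
    (hz : ContDiff ℝ ∞ z) (hw : ContDiff ℝ ∞ w) :
    ContDiff ℝ ∞ (fun e => quadAmp ψ (x e) (z e) (w e)) := by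
  have hc : ContDiff ℝ ∞ (fun v => starRingEnd ℂ (ψ v)) := Complex.conjCLE.contDiff.comp hψ
  unfold quadAmp
  exact ((hψ.comp ((hx.fst.sub hz.fst).prodMk hx.snd)).mul
    (hψ.comp ((hx.fst.sub hz.snd).prodMk hx.snd))).mul
    ((hc.comp ((hx.fst.sub hw.fst).prodMk hx.snd)).mul
    (hc.comp ((hx.fst.sub hw.snd).prodMk hx.snd)))

theorem ContDiffOn.hyp {E : Type*} [NormedAddCommGroup E] [NormedSpace ℝ E] {f g : E → ℝ}
    {U : Set E} (hf : ContDiffOn ℝ ∞ f U) (hg : ContDiffOn ℝ ∞ g U) (h : ∀ z ∈ U, g z ≠ 0) :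
    ContDiffOn ℝ ∞ (fun z => hyp (f z) (g z)) U :=
  ((hf.pow 2).add (hg.pow 2)).sqrt fun z hz => by
    have := pow_pos (abs_pos.2 (h z hz)) 2
    rw [sq_abs] at this
    positivity

theorem continuous_hyp : Continuous fun z : ℝ × ℝ => hyp z.1 z.2 := by
  unfold hyp; fun_prop

/-- The phase of the kernel of the composition of the bilinear operator with its adjoint. -/
noncomputable def quadKernel (L : ℝ) (ψ : ℝ × ℝ → ℂ) (x z w : ℝ × ℝ) : ℂ :=
  Complex.exp (Complex.I * L * (fourSum (fun s => hyp (x.1 - s) x.2) z w : ℝ)) * quadAmp ψ x z w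

theorem quadKernel_eq_zero {ψ : ℝ × ℝ → ℂ} {c R ε L : ℝ} (hψ : SupportedOffAxis ψ c R)
    (hε : ε ≤ 1) {x z w : ℝ × ℝ} (hz : z ∈ orderedPairs ε)
    (h : ¬ (c ≤ |x.2| ∧ |x.2| ≤ R ∧ |x.1| ≤ R + 1)) : quadKernel L ψ x z w = 0 := by
  rw [quadKernel, mul_eq_zero]
  right
  by_contra h0
  exact h (quadAmp_ne_zero hψ hε hz h0)

theorem continuous_quadKernel {L : ℝ} {ψ : ℝ × ℝ → ℂ} (hψ : Continuous ψ) :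
    Continuous fun v : (ℝ × ℝ) × (ℝ × ℝ) × (ℝ × ℝ) => quadKernel L ψ v.1 v.2.1 v.2.2 := by
  have h := continuous_hyp
  have hc : ∀ {f g : (ℝ × ℝ) × (ℝ × ℝ) × (ℝ × ℝ) → ℝ}, Continuous f → Continuous g →
      Continuous fun v => hyp (f v) (g v) := fun hf hg => h.comp (hf.prodMk hg)
  have h1 : Continuous fun v : (ℝ × ℝ) × (ℝ × ℝ) × (ℝ × ℝ) =>
      fourSum (fun s => hyp (v.1.1 - s) v.1.2) v.2.1 v.2.2 := by
    unfold fourSum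
    exact (((hc (by fun_prop) (by fun_prop)).add (hc (by fun_prop) (by fun_prop))).sub
      (hc (by fun_prop) (by fun_prop))).sub (hc (by fun_prop) (by fun_prop))
  have h2 : Continuous fun v : (ℝ × ℝ) × (ℝ × ℝ) × (ℝ × ℝ) => quadAmp ψ v.1 v.2.1 v.2.2 := by
    unfold quadAmp
    have hs : Continuous (starRingEnd ℂ) := Complex.continuous_conj
    fun_prop
  unfold quadKernel
  fun_prop

theorem norm_quadKernel_le {L : ℝ} {ψ : ℝ × ℝ → ℂ} {M : ℝ} (hM : ∀ z, ‖ψ z‖ ≤ M)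
    (x z w : ℝ × ℝ) : ‖quadKernel L ψ x z w‖ ≤ M * M * (M * M) := by
  have hM0 : 0 ≤ M := (norm_nonneg _).trans (hM 0)
  rw [quadKernel, norm_mul, norm_exp_I_mul_mul, one_mul, quadAmp, norm_mul, norm_mul, norm_mul]
  simp only [RCLike.norm_conj]
  have := fun z => hM z
  gcongr <;> exact this _

section kernelBounds
variable {ψ : ℝ × ℝ → ℂ} {c R ε : ℝ}

theorem integral_quadKernel_eq_iterated (hψ : Continuous ψ) (hs : SupportedOffAxis ψ c R)
    (hε : ε ≤ 1) {z w : ℝ × ℝ} (hz : z ∈ orderedPairs ε) (L : ℝ) :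
    ∫ x, quadKernel L ψ x z w = ∫ y, ∫ t, quadKernel L ψ (t, y) z w := by
  have hcont : Continuous fun x => quadKernel L ψ x z w :=
    (continuous_quadKernel hψ).comp (f := fun x => (x, z, w)) (by fun_prop)
  have hsupp : HasCompactSupport fun x => quadKernel L ψ x z w := by
    refine HasCompactSupport.intro (K := Set.Icc (-(R + 1)) (R + 1) ×ˢ Set.Icc (-R) R)
      (isCompact_Icc.prod isCompact_Icc) fun x hx => quadKernel_eq_zero hs hε hz fun h0 => ?_
    exact hx ⟨abs_le.1 h0.2.2, abs_le.1 h0.2.1⟩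
  exact integral_prod_symm _ (hcont.integrable_of_hasCompactSupport hsupp)

/-- The substitution t = y p has Jacobian |y|; at y = 0 it degenerates, but the kernel vanishes
there. After the exchange of integrals the inner integral runs along the line through the origin
with parameter p. -/
theorem integral_quadKernel_eq_radial (hψ : Continuous ψ) (hc : 0 < c)
    (hs : SupportedOffAxis ψ c R)
    (hε : ε ≤ 1) {z w : ℝ × ℝ} (hz : z ∈ orderedPairs ε) (L : ℝ) :
    ∫ x, quadKernel L ψ x z w = ∫ p, ∫ y, (|y| : ℝ) * quadKernel L ψ (y * p, y) z w := by
  rw [integral_quadKernel_eq_iterated hψ hs hε hz]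
  have h1 : ∀ y, ∫ t, quadKernel L ψ (t, y) z w = ∫ p, (|y| : ℝ) * quadKernel L ψ (y * p, y) z w := by
    intro y
    rcases eq_or_ne y 0 with rfl | hy
    · have : ∀ t, quadKernel L ψ (t, 0) z w = 0 := fun t =>
        quadKernel_eq_zero hs hε hz fun h => by simp at h; linarith [h.1]
      simp [this]
    · rw [integral_const_mul, Measure.integral_comp_mul_left (fun t => quadKernel L ψ (t, y) z w) y,
        abs_inv, Complex.real_smul, Complex.ofReal_inv, mul_inv_cancel_left₀]
      exact_mod_cast abs_ne_zero.2 hy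
  simp_rw [h1]
  refine integral_integral_swap ?_
  refine Continuous.integrable_of_hasCompactSupport (f := fun v : ℝ × ℝ =>
    ((|v.1| : ℝ) : ℂ) * quadKernel L ψ (v.1 * v.2, v.1) z w) ?_ ?_
  · have : Continuous fun v : ℝ × ℝ => quadKernel L ψ (v.1 * v.2, v.1) z w :=
      (continuous_quadKernel hψ).comp (f := fun v : ℝ × ℝ => ((v.1 * v.2, v.1), z, w))
        (by fun_prop)
    fun_prop
  · refine HasCompactSupport.intro
      (K := Set.Icc (-R) R ×ˢ Set.Icc (-((R + 1) / c)) ((R + 1) / c))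
      (isCompact_Icc.prod isCompact_Icc) fun v hv => ?_
    rw [quadKernel_eq_zero hs hε hz, mul_zero]
    intro h0
    refine hv ⟨abs_le.1 h0.2.1, abs_le.1 ?_⟩
    rw [le_div_iff₀ hc]
    have := h0.2.2
    rw [abs_mul] at this
    nlinarith [h0.1, abs_nonneg v.2]

theorem norm_integral_quadKernel_le_of_horizontal (hψ : Continuous ψ) (hR : 0 < R)
    (hs : SupportedOffAxis ψ c R) (hε : ε ≤ 1) {z w : ℝ × ℝ} (hz : z ∈ orderedPairs ε) {L B : ℝ}
    (hB0 : 0 ≤ B) (hB : ∀ y, c ≤ |y| → |y| ≤ R →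
      ‖∫ t in (-(R + 2))..(R + 2), quadKernel L ψ (t, y) z w‖ ≤ B) :
    ‖∫ x, quadKernel L ψ x z w‖ ≤ 2 * R * B := by
  rw [integral_quadKernel_eq_iterated hψ hs hε hz]
  have h0 : ∀ y, ¬ (c ≤ |y| ∧ |y| ≤ R) → ∫ t, quadKernel L ψ (t, y) z w = 0 := by
    intro y hy
    have : ∀ t, quadKernel L ψ (t, y) z w = 0 := fun t =>
      quadKernel_eq_zero hs hε hz fun h => hy ⟨h.1, h.2.1⟩
    simp [this]
  have hi : ∀ y, ∫ t, quadKernel L ψ (t, y) z w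
      = ∫ t in (-(R + 2))..(R + 2), quadKernel L ψ (t, y) z w := by
    intro y
    refine (intervalIntegral.integral_eq_integral_of_support_subset fun t ht => ?_).symm
    by_contra h
    apply ht
    refine quadKernel_eq_zero hs hε hz fun h1 => ?_
    have := abs_le.1 h1.2.2
    exact h ⟨by linarith [this.1], by linarith [this.2]⟩
  rw [← setIntegral_eq_integral_of_forall_compl_eq_zero (s := Set.Icc (-R) R)]
  · have := norm_setIntegral_le_of_norm_le_const (s := Set.Icc (-R) R) (μ := volume)
      (f := fun y => ∫ t, quadKernel L ψ (t, y) z w) (C := B) (by simp)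
      (fun y hy => by
        by_cases hc : c ≤ |y| ∧ |y| ≤ R
        · rw [hi]; exact hB y hc.1 hc.2
        · rw [h0 y hc]; simpa using hB0)
    refine this.trans (le_of_eq ?_)
    rw [measureReal_def, Real.volume_Icc, ENNReal.toReal_ofReal (by linarith)]
    ring
  · intro y hy
    exact h0 y fun h => hy (abs_le.1 h.2)

theorem norm_integral_quadKernel_le_of_radial (hψ : Continuous ψ) (hc : 0 < c) (hcR : c ≤ R)
    (hs : SupportedOffAxis ψ c R) (hε : ε ≤ 1) {z w : ℝ × ℝ} (hz : z ∈ orderedPairs ε) {L B : ℝ}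
    (hB : ∀ p, |p| ≤ (R + 1) / c →
      ‖∫ y in (c / 2)..(2 * R), y * quadKernel L ψ (y * p, y) z w‖ ≤ B ∧
      ‖∫ y in (-(2 * R))..(-(c / 2)), y * quadKernel L ψ (y * p, y) z w‖ ≤ B) :
    ‖∫ x, quadKernel L ψ x z w‖ ≤ 4 * ((R + 1) / c) * B := by
  have hR : 0 < R := hc.trans_le hcR
  rw [integral_quadKernel_eq_radial hψ hc hs hε hz]
  have h0 : ∀ p, ¬ |p| ≤ (R + 1) / c →
      ∫ y, ((|y| : ℝ) : ℂ) * quadKernel L ψ (y * p, y) z w = 0 := by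
    intro p hp
    have : ∀ y, ((|y| : ℝ) : ℂ) * quadKernel L ψ (y * p, y) z w = 0 := fun y => by
      rw [quadKernel_eq_zero hs hε hz, mul_zero]
      intro h
      apply hp
      rw [le_div_iff₀ hc]
      have := h.2.2
      rw [abs_mul] at this
      nlinarith [h.1, abs_nonneg p]
    simp [this]
  -- The half-lines y > 0 and y < 0 are treated separately so that |y| becomes ±y and the amplitude
  -- stays smooth. The limits c/2 and 2R lie strictly outside the support c ≤ |y| ≤ R, so the
  -- amplitude vanishes near the endpoints.
  have hi : ∀ p, ∫ y, ((|y| : ℝ) : ℂ) * quadKernel L ψ (y * p, y) z w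
      = -(∫ y in (-(2 * R))..(-(c / 2)), y * quadKernel L ψ (y * p, y) z w)
        + ∫ y in (c / 2)..(2 * R), y * quadKernel L ψ (y * p, y) z w := by
    intro p
    have hcont : Continuous fun y : ℝ => ((|y| : ℝ) : ℂ) * quadKernel L ψ (y * p, y) z w := by
      have : Continuous fun y : ℝ => quadKernel L ψ (y * p, y) z w :=
        (continuous_quadKernel hψ).comp (f := fun y : ℝ => ((y * p, y), z, w)) (by fun_prop)
      fun_prop
    have hii : ∀ a b, IntervalIntegrable
      (fun y : ℝ => ((|y| : ℝ) : ℂ) * quadKernel L ψ (y * p, y) z w) volume a b :=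
      fun a b => hcont.intervalIntegrable a b
    rw [← intervalIntegral.integral_eq_integral_of_support_subset (a := -(2 * R)) (b := 2 * R),
      ← intervalIntegral.integral_add_adjacent_intervals (hii _ (-(c / 2))) (hii _ _),
      ← intervalIntegral.integral_add_adjacent_intervals (hii (-(c / 2)) (c / 2)) (hii _ _)]
    · have e1 : ∫ y in (-(c / 2))..(c / 2), ((|y| : ℝ) : ℂ) * quadKernel L ψ (y * p, y) z w
          = 0 := by
        refine intervalIntegral.integral_zero_ae (Filter.Eventually.of_forall fun y hy => ?_)
        rw [Set.uIoc_of_le (by linarith)] at hy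
        rw [quadKernel_eq_zero hs hε hz, mul_zero]
        intro h
        have : |y| ≤ c / 2 := abs_le.2 ⟨hy.1.le, hy.2⟩
        linarith [h.1]
      have e2 : ∫ y in (c / 2)..(2 * R), ((|y| : ℝ) : ℂ) * quadKernel L ψ (y * p, y) z w
          = ∫ y in (c / 2)..(2 * R), y * quadKernel L ψ (y * p, y) z w := by
        refine intervalIntegral.integral_congr fun y hy => ?_
        rw [Set.uIcc_of_le (by linarith)] at hy
        rw [abs_of_nonneg (by linarith [hy.1])]
      have e3 : ∫ y in (-(2 * R))..(-(c / 2)), ((|y| : ℝ) : ℂ) * quadKernel L ψ (y * p, y) z w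
          = -∫ y in (-(2 * R))..(-(c / 2)), y * quadKernel L ψ (y * p, y) z w := by
        rw [← intervalIntegral.integral_neg]
        refine intervalIntegral.integral_congr fun y hy => ?_
        rw [Set.uIcc_of_le (by linarith)] at hy
        rw [abs_of_nonpos (by linarith [hy.2])]
        push_cast; ring
      rw [e1, e2, e3, zero_add]
    · intro y hy
      by_contra h
      apply hy
      change ((|y| : ℝ) : ℂ) * quadKernel L ψ (y * p, y) z w = 0
      rw [quadKernel_eq_zero hs hε hz, mul_zero]
      intro h1
      have := abs_le.1 h1.2.1
      exact h ⟨by linarith [this.1], by linarith [this.2]⟩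
  rw [← setIntegral_eq_integral_of_forall_compl_eq_zero
    (s := Set.Icc (-((R + 1) / c)) ((R + 1) / c))]
  · have := norm_setIntegral_le_of_norm_le_const
      (s := Set.Icc (-((R + 1) / c)) ((R + 1) / c)) (μ := volume)
      (f := fun p => ∫ y, ((|y| : ℝ) : ℂ) * quadKernel L ψ (y * p, y) z w) (C := 2 * B) (by simp)
      (fun p hp => by
        obtain ⟨b1, b2⟩ := hB p (abs_le.2 hp)
        rw [hi]
        exact (norm_add_le_of_le (by rwa [norm_neg]) b1).trans (two_mul B).ge)
    refine this.trans (le_of_eq ?_)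
    have : 0 < (R + 1) / c := by positivity
    rw [measureReal_def, Real.volume_Icc, ENNReal.toReal_ofReal (by linarith)]
    ring
  · intro p hp
    exact h0 p fun h => hp (abs_le.1 h)

/-- Pointwise bound of the kernel of the composition of the bilinear operator with its adjoint. -/
theorem exists_norm_integral_quadKernel_le (hψ : ContDiff ℝ ∞ ψ) (hc : 0 < c) (hcR : c ≤ R)
    (hs : SupportedOffAxis ψ c R) : ∃ ε K : ℝ, 0 < ε ∧ ε ≤ 1 / 2 ∧ 0 < K ∧
      ∀ z ∈ orderedPairs ε, ∀ w ∈ orderedPairs ε, ∀ L : ℝ, 0 < L →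
        ‖∫ x, quadKernel L ψ x z w‖ ≤ K ∧
        (0 < pairDist z w → ‖∫ x, quadKernel L ψ x z w‖ ≤ K / (L * pairDist z w) ^ 3) := by
  have hR : 0 < R := hc.trans_le hcR
  obtain ⟨M, hM⟩ : ∃ M, ∀ z, ‖ψ z‖ ≤ M := by
    refine Continuous.bounded_above_of_compact_support hψ.continuous
      (HasCompactSupport.intro (K := Set.Icc (-R) R ×ˢ Set.Icc (-R) R)
      (isCompact_Icc.prod isCompact_Icc) fun z hz => ?_)
    by_contra h
    obtain ⟨-, h1, h2⟩ := hs z h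
    exact hz ⟨abs_le.1 h2, abs_le.1 h1⟩
  obtain ⟨κ, m1, hκ, hm1, low1⟩ := exists_horizontal_lower hc (B := 2 * R + 4) (by linarith)
  set B2 : ℝ := 2 * R * ((R + 1) / c) + 1 + 2 * R with hB2
  have hP : 0 < (R + 1) / c := by positivity
  -- The κ from the horizontal bound is passed on here, so that the two regimes |W| ≤ κ|V| and κ|V|
  -- ≤ |W| cover all pairs. The radial bound is used with c/2 since the y-intervals start at c/2.
  obtain ⟨ε₀, m2, hε₀, hm2, low2⟩ := exists_radial_lower (c := c / 2) (B := B2) (κ := κ)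
    (by linarith) (by positivity) hκ
  set ε := min ε₀ (1 / 2) with hε
  have hε2 : ε ≤ 1 / 2 := min_le_right _ _
  have hεp : 0 < ε := by positivity
  have hε1 : ε ≤ 1 := by linarith
  -- horizontal direction
  have sH1 : ContDiffOn ℝ ∞ (fun v : ℝ × ℝ × ℝ => hyp (v.2.1 - v.2.2) v.1) {v | v.1 ≠ 0} :=
    ContDiffOn.hyp (by fun_prop) (by fun_prop) fun v hv => hv
  have oU1 : IsOpen {v : ℝ × ℝ × ℝ | v.1 ≠ 0} := isOpen_ne_fun continuous_fst continuous_const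
  have cK1 : IsCompact {y : ℝ | c ≤ |y| ∧ |y| ≤ R} :=
    (isCompact_Icc (a := -R) (b := R)).of_isClosed_subset
      ((isClosed_le continuous_const continuous_abs).inter
      (isClosed_le continuous_abs continuous_const)) fun y hy => abs_le.1 hy.2
  have ne1 : ∀ y : ℝ, c ≤ |y| → y ≠ 0 := by
    rintro y hy rfl
    simp at hy; linarith
  obtain ⟨K1, hK1, key1⟩ := exists_norm_integral_fourSum_le oU1 sH1 cK1 (α := -(R + 2))
    (β := R + 2) (by linarith) (fun y hy t _ s => ne1 y hy.1)
    (a := fun e => quadAmp ψ (e.2.1, e.1) e.2.2.1 e.2.2.2)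
    (contDiff_quadAmp hψ (by fun_prop) (by fun_prop) (by fun_prop)) (ε := ε) hm1
  -- radial direction
  have sH2 : ContDiffOn ℝ ∞ (fun v : ℝ × ℝ × ℝ => hyp (v.2.1 * v.1 - v.2.2) v.2.1)
      {v | v.2.1 ≠ 0} :=
    ContDiffOn.hyp (by fun_prop) (by fun_prop) fun v hv => hv
  have oU2 : IsOpen {v : ℝ × ℝ × ℝ | v.2.1 ≠ 0} :=
    isOpen_ne_fun (by fun_prop) continuous_const
  have sa2 : ContDiff ℝ ∞ (fun e : ℝ × ℝ × ((ℝ × ℝ) × (ℝ × ℝ)) =>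
      (e.2.1 : ℂ) * quadAmp ψ (e.2.1 * e.1, e.2.1) e.2.2.1 e.2.2.2) :=
    (Complex.ofRealCLM.contDiff.comp (by fun_prop : ContDiff ℝ ∞ fun e :
      ℝ × ℝ × ((ℝ × ℝ) × (ℝ × ℝ)) => e.2.1)).mul
      (contDiff_quadAmp hψ (by fun_prop) (by fun_prop) (by fun_prop))
  obtain ⟨K2, hK2, key2⟩ := exists_norm_integral_fourSum_le oU2 sH2
    (isCompact_Icc (a := -((R + 1) / c)) (b := (R + 1) / c)) (α := c / 2) (β := 2 * R)
    (by linarith) (fun p _ t ht s => by have := ht.1; exact (by linarith : 0 < t).ne')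
    sa2 (ε := ε) hm2
  obtain ⟨K3, hK3, key3⟩ := exists_norm_integral_fourSum_le oU2 sH2
    (isCompact_Icc (a := -((R + 1) / c)) (b := (R + 1) / c)) (α := -(2 * R)) (β := -(c / 2))
    (by linarith) (fun p _ t ht s => by have := ht.2; exact (by linarith : t < 0).ne)
    sa2 (ε := ε) hm2
  set K0 : ℝ := 2 * R * (M * M * (M * M) * (2 * (R + 2))) with hK0
  have hM0 : 0 ≤ M := (norm_nonneg _).trans (hM 0)
  refine ⟨ε, K0 + 2 * R * K1 + 4 * ((R + 1) / c) * (K2 + K3), hεp, hε2, by positivity, ?_⟩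
  intro z hz w hw L hL
  constructor
  · refine (norm_integral_quadKernel_le_of_horizontal hψ.continuous hR hs hε1 hz
      (B := M * M * (M * M) * (2 * (R + 2))) (by positivity) fun y _ _ => ?_).trans ?_
    · refine (intervalIntegral.norm_integral_le_of_norm_le_const fun t _ =>
        norm_quadKernel_le hM _ _ _).trans (le_of_eq ?_)
      rw [abs_of_nonneg (by linarith)]; ring
    · have : 0 < 2 * R * K1 := by positivity
      have : 0 < 4 * ((R + 1) / c) * (K2 + K3) := by positivity
      linarith
  · intro hD
    set D := pairDist z w with hDdef
    have hLD : 0 < (L * D) ^ 3 := by positivity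
    -- When V dominates, integrate by parts horizontally; when W dominates, radially.
    rcases le_total (|(z.1 - z.2) ^ 2 - (w.1 - w.2) ^ 2|) (κ * |z.1 + z.2 - w.1 - w.2|)
      with hcase | hcase
    · refine (norm_integral_quadKernel_le_of_horizontal hψ.continuous hR hs hε1 hz
        (B := K1 / (L * D) ^ 3) (by positivity) fun y hy1 hy2 => ?_).trans ?_
      · have hzero : ∀ t : ℝ, R + 1 < |t| → quadAmp ψ (t, y) z w = 0 := by
          intro t ht
          by_contra h
          have := (quadAmp_ne_zero hs hε1 hz h).2.2
          simp only at this; linarith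
        refine key1 y ⟨hy1, hy2⟩ z hz w hw L hL ?_ ?_ hD fun t ht => ?_
        · have : ∀ᶠ t : ℝ in nhds (-(R + 2)), t < -(R + 1) := eventually_lt_nhds (by linarith)
          filter_upwards [this] with t ht
          exact hzero t (by rw [abs_of_neg (by linarith)]; linarith)
        · have : ∀ᶠ t : ℝ in nhds (R + 2), R + 1 < t := eventually_gt_nhds (by linarith)
          filter_upwards [this] with t ht
          exact hzero t (by rw [abs_of_pos (by linarith)]; linarith)
        · have he : ∀ s, dirDeriv (0, 1, 0) (fun v : ℝ × ℝ × ℝ => hyp (v.2.1 - v.2.2) v.1)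
              (y, t, s) = (t - s) / hyp (t - s) y := fun s =>
            (hasDerivAt_comp_dirDeriv sH1 oU1 (γ := fun t => (y, t, s))
              ((hasDerivAt_const t y).prodMk ((hasDerivAt_id t).prodMk (hasDerivAt_const t s)))
              (ne1 y hy1)).unique (hasDerivAt_hyp_horizontal (ne1 y hy1) t s)
          simp_rw [he]
          refine low1 ε y t z w hz hw hy1 (fun s hs => ?_) hcase
          refine (hyp_le_add _ _).trans ?_
          have h1 := abs_sub t s
          have h2 := abs_le.2 ht
          linarith
      · rw [← mul_div_assoc]
        gcongr
        have : 0 ≤ K0 := by positivity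
        have : 0 < 4 * ((R + 1) / c) * (K2 + K3) := by positivity
        linarith
    · have hzero : ∀ p t : ℝ, (|t| < c ∨ R < |t|) →
          (t : ℂ) * quadAmp ψ (t * p, t) z w = 0 := by
        intro p t ht
        by_contra h
        obtain ⟨h1, h2, -⟩ := (quadAmp_ne_zero hs hε1 hz (right_ne_zero_of_mul h))
        simp only at h1 h2
        rcases ht with ht | ht <;> linarith
      have lower : ∀ p ∈ Set.Icc (-((R + 1) / c)) ((R + 1) / c), ∀ t : ℝ, c / 2 ≤ |t| →
          |t| ≤ 2 * R → m2 * D ≤ |fourSum (fun s => dirDeriv (0, 1, 0)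
          (fun v : ℝ × ℝ × ℝ => hyp (v.2.1 * v.1 - v.2.2) v.2.1) (p, t, s)) z w| := by
        intro p hp t ht1 ht2
        have ht0 : t ≠ 0 := by rintro rfl; simp at ht1; linarith
        have he : ∀ s, dirDeriv (0, 1, 0)
            (fun v : ℝ × ℝ × ℝ => hyp (v.2.1 * v.1 - v.2.2) v.2.1)
            (p, t, s) = ((t * p - s) * p + t) / hyp (t * p - s) t := fun s =>
          (hasDerivAt_comp_dirDeriv sH2 oU2 (γ := fun t => (p, t, s))
            ((hasDerivAt_const t p).prodMk ((hasDerivAt_id t).prodMk (hasDerivAt_const t s)))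
            ht0).unique (hasDerivAt_hyp_radial ht0 s)
        simp_rw [he]
        refine low2 ε p t z w (min_le_left _ _) hz hw ht1 (fun s hs => ?_) hcase
        refine (hyp_le_add _ _).trans ?_
        have h1 := abs_sub (t * p) s
        rw [abs_mul] at h1
        have h2 : |t| * |p| ≤ 2 * R * ((R + 1) / c) := by
          gcongr; exact abs_le.2 hp
        linarith
      have ecast : ∀ p y : ℝ, (y : ℂ) * quadKernel L ψ (y * p, y) z w
          = Complex.exp (Complex.I * L * (fourSum (fun s => hyp (y * p - s) y) z w : ℝ))
            * ((y : ℂ) * quadAmp ψ (y * p, y) z w) := fun p y => by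
        rw [quadKernel]; ring
      refine (norm_integral_quadKernel_le_of_radial hψ.continuous hc hcR hs hε1 hz
        (B := (K2 + K3) / (L * D) ^ 3) fun p hp => ?_).trans ?_
      · simp_rw [ecast]
        constructor
        · refine (key2 p (abs_le.1 hp) z hz w hw L hL ?_ ?_ hD fun t ht => ?_).trans
            (by gcongr; linarith)
          · have : ∀ᶠ t : ℝ in nhds (c / 2), t < c := eventually_lt_nhds (by linarith)
            have h2 : ∀ᶠ t : ℝ in nhds (c / 2), 0 < t := eventually_gt_nhds (by linarith)
            filter_upwards [this, h2] with t ht ht2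
            exact hzero p t (Or.inl (by rwa [abs_of_pos ht2]))
          · have : ∀ᶠ t : ℝ in nhds (2 * R), R < t := eventually_gt_nhds (by linarith)
            filter_upwards [this] with t ht
            exact hzero p t (Or.inr (by rwa [abs_of_pos (by linarith)]))
          · have h0 : 0 < t := by linarith [ht.1]
            exact lower p (abs_le.1 hp) t (by rw [abs_of_pos h0]; exact ht.1)
              (by rw [abs_of_pos h0]; exact ht.2)
        · refine (key3 p (abs_le.1 hp) z hz w hw L hL ?_ ?_ hD fun t ht => ?_).trans
            (by gcongr; linarith)
          · have : ∀ᶠ t : ℝ in nhds (-(2 * R)), t < -R := eventually_lt_nhds (by linarith)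
            filter_upwards [this] with t ht
            exact hzero p t (Or.inr (by rw [abs_of_neg (by linarith)]; linarith))
          · have : ∀ᶠ t : ℝ in nhds (-(c / 2)), -c < t := eventually_gt_nhds (by linarith)
            have h2 : ∀ᶠ t : ℝ in nhds (-(c / 2)), t < 0 := eventually_lt_nhds (by linarith)
            filter_upwards [this, h2] with t ht ht2
            exact hzero p t (Or.inl (by rw [abs_of_neg ht2]; linarith))
          · have h0 : t < 0 := by linarith [ht.2]
            exact lower p (abs_le.1 hp) t (by rw [abs_of_neg h0]; linarith [ht.2])
              (by rw [abs_of_neg h0]; linarith [ht.1])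
      · rw [← mul_div_assoc]
        gcongr
        have : 0 ≤ K0 := by positivity
        have : 0 < 2 * R * K1 := by positivity
        linarith

end kernelBounds

/-! ### Schur's test. -/

theorem two_mul_enorm_mul_le (a b : ℂ) : 2 * (‖a‖ₑ * ‖b‖ₑ) ≤ ‖a‖ₑ ^ 2 + ‖b‖ₑ ^ 2 := by
  rw [← mul_assoc, enorm_eq_nnnorm, enorm_eq_nnnorm]
  exact_mod_cast two_mul_le_add_sq ‖a‖₊ ‖b‖₊

/-- Schur's test for the composition of an integral operator with its adjoint. -/
theorem lintegral_enorm_sq_integral_le {X Z : Type*} [MeasurableSpace X] [MeasurableSpace Z]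
    {μ : Measure X} {ν : Measure Z} [IsFiniteMeasure μ] [IsFiniteMeasure ν] {k : X → Z → ℂ}
    (hk : Measurable (Function.uncurry k)) {M : ℝ} (hM : ∀ x z, ‖k x z‖ ≤ M) {F : Z → ℂ}
    (hF : Measurable F) {N : ℝ} (hN : ∀ z, ‖F z‖ ≤ N) {A : ℝ≥0∞}
    (hA : ∀ᵐ z ∂ν, ∫⁻ w, ‖∫ x, k x z * starRingEnd ℂ (k x w) ∂μ‖ₑ ∂ν ≤ A) :
    ∫⁻ x, ‖∫ z, k x z * F z ∂ν‖ₑ ^ 2 ∂μ ≤ A * ∫⁻ z, ‖F z‖ₑ ^ 2 ∂ν := by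
  have hconj : Measurable (starRingEnd ℂ) := Complex.continuous_conj.measurable
  set g : X → ℂ := fun x => ∫ z, k x z * F z ∂ν with hg
  set Kz : Z → Z → ℂ := fun z w => ∫ x, k x z * starRingEnd ℂ (k x w) ∂μ with hKz
  have hkF : Measurable fun p : X × Z => k p.1 p.2 * F p.2 := by
    have : Measurable fun p : X × Z => k p.1 p.2 := hk
    fun_prop
  have hgm : StronglyMeasurable g := hkF.stronglyMeasurable.integral_prod_right
  have hM0 : ∀ x : X, ∀ z : Z, 0 ≤ M := fun x z => (norm_nonneg _).trans (hM x z)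
  have hKm : Measurable (Function.uncurry Kz) := by
    have : Measurable fun v : (Z × Z) × X => k v.2 v.1.1 * starRingEnd ℂ (k v.2 v.1.2) :=
      (hk.comp (by fun_prop : Measurable fun v : (Z × Z) × X => (v.2, v.1.1))).mul
        (hconj.comp (hk.comp (by fun_prop : Measurable fun v : (Z × Z) × X => (v.2, v.1.2))))
    exact (this.stronglyMeasurable.integral_prod_right).measurable
  have hsym : ∀ z w, ‖Kz z w‖ₑ = ‖Kz w z‖ₑ := by
    intro z w
    have : Kz z w = starRingEnd ℂ (Kz w z) := by
      simp only [hKz]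
      rw [← integral_conj]
      congr 1; ext x; simp [mul_comm]
    rw [this, ← ofReal_norm, ← ofReal_norm, RCLike.norm_conj]
  -- Expanding |g(x)|² as a double integral and integrating in x first leaves the quadratic form of
  -- `Kz`. Boundedness of k and F and finiteness of the measures justify Fubini.
  have h1 : ∀ x, g x * starRingEnd ℂ (g x) = ∫ v : Z × Z, (k x v.1 * F v.1) *
      starRingEnd ℂ (k x v.2 * F v.2) ∂(ν.prod ν) := by
    intro x
    rw [integral_prod_mul (fun z => k x z * F z) (fun w => starRingEnd ℂ (k x w * F w)),
      integral_conj]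
  have hswap : ∫ x, g x * starRingEnd ℂ (g x) ∂μ
      = ∫ v : Z × Z, (F v.1 * starRingEnd ℂ (F v.2)) * Kz v.1 v.2 ∂(ν.prod ν) := by
    simp_rw [h1]
    rw [integral_integral_swap]
    · congr 1; ext v
      rw [← integral_const_mul]
      congr 1; ext x; simp only [map_mul]; ring
    · refine Integrable.of_bound (C := M * N * (M * N)) ?_ ?_
      · have e1 : Measurable fun v : X × Z × Z => k v.1 v.2.1 :=
          hk.comp (by fun_prop : Measurable fun v : X × Z × Z => (v.1, v.2.1))
        have e2 : Measurable fun v : X × Z × Z => k v.1 v.2.2 :=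
          hk.comp (by fun_prop : Measurable fun v : X × Z × Z => (v.1, v.2.2))
        have : Measurable fun v : X × Z × Z => (k v.1 v.2.1 * F v.2.1) *
            starRingEnd ℂ (k v.1 v.2.2 * F v.2.2) :=
          (e1.mul (by fun_prop)).mul (hconj.comp (e2.mul (by fun_prop)))
        exact this.aestronglyMeasurable
      · refine Filter.Eventually.of_forall fun v => ?_
        have := hM0 v.1 v.2.1
        have a1 := hM v.1 v.2.1
        have a2 := hM v.1 v.2.2
        have b1 := hN v.2.1
        have b2 := hN v.2.2
        have : 0 ≤ N := (norm_nonneg _).trans b1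
        simp only [Function.uncurry, norm_mul, RCLike.norm_conj]
        gcongr
  have h2 : ∫⁻ x, ‖g x‖ₑ ^ 2 ∂μ = ‖∫ x, g x * starRingEnd ℂ (g x) ∂μ‖ₑ := by
    have e : ∀ x, g x * starRingEnd ℂ (g x) = ((‖g x‖ ^ 2 : ℝ) : ℂ) := fun x => by
      rw [Complex.mul_conj, Complex.normSq_eq_norm_sq]
    simp_rw [e]
    rw [integral_complex_ofReal, ← ofReal_norm, Complex.norm_real,
      Real.norm_of_nonneg (integral_nonneg fun x => by
      positivity), ofReal_integral_eq_lintegral_ofReal]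
    · congr 1; ext x
      rw [ENNReal.ofReal_pow (norm_nonneg _), ofReal_norm]
    · refine Integrable.of_bound (C := (M * N * ν.real Set.univ) ^ 2) ?_ ?_
      · exact (hgm.norm.pow 2).aestronglyMeasurable
      · refine Filter.Eventually.of_forall fun x => ?_
        rw [Real.norm_of_nonneg (by positivity)]
        gcongr
        refine norm_integral_le_of_norm_le_const (Filter.Eventually.of_forall fun z => ?_)
        have := hM0 x z
        rw [norm_mul]
        gcongr
        · exact hM x z
        · exact hN z
    · exact Filter.Eventually.of_forall fun x => by positivity
  rw [h2, hswap]
  have h3 : ∫⁻ v : Z × Z, ‖F v.1‖ₑ ^ 2 * ‖Kz v.1 v.2‖ₑ ∂(ν.prod ν)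
      ≤ A * ∫⁻ z, ‖F z‖ₑ ^ 2 ∂ν := by
    have hKm' : Measurable fun v : Z × Z => Kz v.1 v.2 := hKm
    rw [lintegral_prod _ (by fun_prop), ← lintegral_const_mul _ (by fun_prop)]
    refine lintegral_mono_ae ?_
    filter_upwards [hA] with z hz
    rw [lintegral_const_mul _ (by fun_prop), mul_comm]
    gcongr
  have h4 : ∫⁻ v : Z × Z, ‖F v.2‖ₑ ^ 2 * ‖Kz v.1 v.2‖ₑ ∂(ν.prod ν)
      = ∫⁻ v : Z × Z, ‖F v.1‖ₑ ^ 2 * ‖Kz v.1 v.2‖ₑ ∂(ν.prod ν) := by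
    rw [← lintegral_prod_swap]
    refine lintegral_congr fun v => ?_
    simp only [Prod.fst_swap, Prod.snd_swap]
    rw [hsym]
  -- From 2|F(z)F(w)| ≤ |F(z)|² + |F(w)|² and the symmetry of |Kz| both terms have the same
  -- integral, which the row bound `hA` controls.
  have h5 : 2 * ‖∫ v : Z × Z, (F v.1 * starRingEnd ℂ (F v.2)) * Kz v.1 v.2 ∂(ν.prod ν)‖ₑ
      ≤ 2 * (A * ∫⁻ z, ‖F z‖ₑ ^ 2 ∂ν) := by
    have hKm' : Measurable fun v : Z × Z => Kz v.1 v.2 := hKm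
    calc _ ≤ 2 * ∫⁻ v : Z × Z, ‖(F v.1 * starRingEnd ℂ (F v.2)) * Kz v.1 v.2‖ₑ ∂(ν.prod ν) := by
          gcongr; exact enorm_integral_le_lintegral_enorm _
      _ = ∫⁻ v : Z × Z, 2 * ‖(F v.1 * starRingEnd ℂ (F v.2)) * Kz v.1 v.2‖ₑ ∂(ν.prod ν) := by
          rw [lintegral_const_mul _ (by fun_prop)]
      _ ≤ ∫⁻ v : Z × Z, (‖F v.1‖ₑ ^ 2 * ‖Kz v.1 v.2‖ₑ + ‖F v.2‖ₑ ^ 2 * ‖Kz v.1 v.2‖ₑ)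
            ∂(ν.prod ν) := by
          refine lintegral_mono fun v => ?_
          rw [enorm_mul, ← mul_assoc, ← add_mul, enorm_mul]
          gcongr
          have e : ‖starRingEnd ℂ (F v.2)‖ₑ = ‖F v.2‖ₑ := by
            rw [← ofReal_norm, ← ofReal_norm, RCLike.norm_conj]
          rw [e]
          exact two_mul_enorm_mul_le _ _
      _ ≤ _ := by
          rw [lintegral_add_left (by fun_prop), h4, two_mul]
          gcongr
  exact (ENNReal.mul_le_mul_iff_right (by norm_num) (by norm_num)).1 h5

/-! ### An integrable majorant in the symmetric coordinates. -/

/-- The decay profile `(1 + |x|)^(-3/2)`. -/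
noncomputable def decayProfile (x : ℝ) : ℝ≥0∞ := ENNReal.ofReal ((1 + |x|) ^ (-(3 / 2) : ℝ))

theorem measurable_decayProfile : Measurable decayProfile := by
  unfold decayProfile; fun_prop

theorem lintegral_decayProfile_lt_top : ∫⁻ x, decayProfile x < ⊤ := by
  have h := (integrable_one_add_norm (E := ℝ) (μ := volume) (r := 3 / 2)
    (by simp; norm_num)).lintegral_lt_top
  simpa [decayProfile] using h

theorem lintegral_decayProfile_comp (a : ℝ) {b : ℝ} (hb : b ≠ 0) :
    ∫⁻ x, decayProfile (a - b * x) = ENNReal.ofReal |b⁻¹| * ∫⁻ x, decayProfile x := by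
  have h1 : ∫⁻ x, decayProfile (a - b * x) = ∫⁻ x, decayProfile (a - x)
      ∂(Measure.map (b * ·) volume) :=
    (lintegral_map (f := fun x => decayProfile (a - x)) (measurable_decayProfile.comp (by fun_prop))
      (by fun_prop)).symm
  rw [h1, Real.map_volume_mul_left hb, lintegral_smul_measure, smul_eq_mul,
    lintegral_sub_left_eq_self]

/-- Pass to the coordinates w₁ + w₂ and w₁ - w₂ and scale: the Jacobian contributes 1/2, the two
dilations 1/L and 1/(Lδ). -/
theorem lintegral_decayProfile_pair {L δ : ℝ} (hL : 0 < L) (hδ : 0 < δ) (v u : ℝ) :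
    ∫⁻ w : ℝ × ℝ, decayProfile (L * (v - w.1 - w.2)) * decayProfile (L * δ * (u - (w.1 - w.2)))
      = ENNReal.ofReal (1 / (2 * L ^ 2 * δ)) * (∫⁻ x, decayProfile x) ^ 2 := by
  have hm := measurable_decayProfile
  have hmc : ∀ {α : Type} [MeasurableSpace α] {f : α → ℝ}, Measurable f →
      Measurable fun a => decayProfile (f a) := fun hf => hm.comp hf
  have h1 : ∀ y : ℝ, ∫⁻ x, decayProfile (L * (v - x - y)) * decayProfile (L * δ * (u - (x - y)))
      = ∫⁻ x, decayProfile (L * (v - x - 2 * y)) * decayProfile (L * δ * (u - x)) := by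
    intro y
    rw [← lintegral_add_right_eq_self _ y]
    refine lintegral_congr fun x => ?_
    congr 2 <;> ring
  rw [Measure.volume_eq_prod, lintegral_prod_symm _ (Measurable.aemeasurable (f := fun w : ℝ × ℝ =>
    decayProfile (L * (v - w.1 - w.2)) * decayProfile (L * δ * (u - (w.1 - w.2))))
    ((hmc (by fun_prop)).mul (hmc (by fun_prop))))]
  simp_rw [h1]
  rw [lintegral_lintegral_swap (Measurable.aemeasurable (f := fun w : ℝ × ℝ =>
    decayProfile (L * (v - w.2 - 2 * w.1)) * decayProfile (L * δ * (u - w.2)))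
    ((hmc (by fun_prop)).mul (hmc (by fun_prop))))]
  have h2 : ∀ x : ℝ, ∫⁻ y, decayProfile (L * (v - x - 2 * y)) * decayProfile (L * δ * (u - x))
      = ENNReal.ofReal (1 / (2 * L)) * (∫⁻ x, decayProfile x) * decayProfile (L * δ * (u - x)) := by
    intro x
    rw [lintegral_mul_const _ (hmc (by fun_prop))]
    congr 1
    have := lintegral_decayProfile_comp (L * (v - x)) (b := 2 * L) (by positivity)
    rw [abs_of_pos (by positivity), inv_eq_one_div] at this
    rw [← this]
    refine lintegral_congr fun y => ?_
    congr 1; ring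
  simp_rw [h2]
  rw [lintegral_const_mul _ (hmc (by fun_prop))]
  have h3 := lintegral_decayProfile_comp (L * δ * u) (b := L * δ) (by positivity)
  rw [abs_of_pos (by positivity), inv_eq_one_div] at h3
  have h4 : ∫⁻ x, decayProfile (L * δ * (u - x)) = ∫⁻ x, decayProfile (L * δ * u - L * δ * x) :=
    lintegral_congr fun x => by congr 1; ring
  rw [h4, h3, show 1 / (2 * L ^ 2 * δ) = 1 / (2 * L) * (1 / (L * δ)) by field_simp,
    ENNReal.ofReal_mul (by positivity)]
  ring

/-- The two bounds combine to 8K(1 + |A| + |B|)^(-3), with 8 = 2³ from comparing 1 + s with 2 or 2s,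
and (1 + |A|)(1 + |B|) ≤ (1 + |A| + |B|)² distributes the power. The cubic decay leaves exponent 3/2
> 1 in each variable, which is integrable. -/
theorem ofReal_min_le_decayProfile {K A B x : ℝ} (hK : 0 < K) (h1 : x ≤ K)
    (h2 : 0 < |A| + |B| → x ≤ K / (|A| + |B|) ^ 3) :
    ENNReal.ofReal x ≤ ENNReal.ofReal (8 * K) * (decayProfile A * decayProfile B) := by
  unfold decayProfile
  rw [← ENNReal.ofReal_mul (by positivity), ← ENNReal.ofReal_mul (by positivity)]
  refine ENNReal.ofReal_le_ofReal ?_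
  have hA := abs_nonneg A
  have hB := abs_nonneg B
  set s := |A| + |B|
  have h3 : x ≤ 8 * K * (1 + s) ^ (-3 : ℝ) := by
    rw [Real.rpow_neg (by positivity), show ((3:ℝ)) = ((3:ℕ):ℝ) by norm_num, Real.rpow_natCast]
    rcases le_total s 1 with hs | hs
    · refine h1.trans ?_
      rw [← div_eq_mul_inv, le_div_iff₀ (by positivity)]
      have : (1 + s) ^ 3 ≤ 2 ^ 3 := by gcongr; linarith
      nlinarith
    · refine (h2 (by linarith)).trans ?_
      rw [← div_eq_mul_inv, div_le_div_iff₀ (by positivity) (by positivity)]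
      have : (1 + s) ^ 3 ≤ (2 * s) ^ 3 := by gcongr; linarith
      nlinarith
  refine h3.trans ?_
  rw [← Real.mul_rpow (by positivity) (by positivity)]
  gcongr ?_ * ?_
  rw [show (-3 : ℝ) = 2 * (-(3 / 2)) by norm_num, Real.rpow_mul (by positivity)]
  refine Real.rpow_le_rpow_of_nonpos (by positivity) ?_ (by norm_num)
  rw [show ((2:ℝ)) = ((2:ℕ):ℝ) by norm_num, Real.rpow_natCast]
  nlinarith

/-! ### Weighted sums and geometric summation. -/

/-- A weighted replacement of the triangle inequality in `L^Q`. -/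
theorem ENNReal.tsum_rpow_le {ι : Type*} {Q : ℝ} (hQ : 0 < Q) (x c : ι → ℝ≥0∞)
    (hc0 : ∀ k, c k ≠ 0) (hct : ∀ k, c k ≠ ⊤) :
    (∑' k, x k) ^ Q ≤ (∑' k, c k) ^ Q * ∑' k, (c k) ^ (-Q) * x k ^ Q := by
  set m := ∑' k, (c k) ^ (-Q) * x k ^ Q with hm
  -- Each term of the weighted sum is at most the whole sum m, so x_k ≤ c_k m^(1/Q); summing these
  -- bounds gives the claim.
  have h1 : ∀ k, x k ≤ c k * m ^ (1 / Q) := by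
    intro k
    have h2 : ((c k)⁻¹ * x k) ^ Q ≤ m := by
      rw [ENNReal.mul_rpow_of_nonneg _ _ hQ.le, ← ENNReal.rpow_neg_one, ← ENNReal.rpow_mul,
        neg_one_mul]
      exact ENNReal.le_tsum (f := fun k => (c k) ^ (-Q) * x k ^ Q) k
    have h3 : (c k)⁻¹ * x k ≤ m ^ (1 / Q) := by
      rw [one_div, ENNReal.le_rpow_inv_iff hQ]; exact h2
    calc x k = c k * ((c k)⁻¹ * x k) := by
          rw [← mul_assoc, ENNReal.mul_inv_cancel (hc0 k) (hct k), one_mul]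
      _ ≤ _ := by gcongr
  calc (∑' k, x k) ^ Q ≤ ((∑' k, c k) * m ^ (1 / Q)) ^ Q := by
        rw [← ENNReal.tsum_mul_right]
        exact ENNReal.rpow_le_rpow (ENNReal.tsum_le_tsum h1) hQ.le
    _ = _ := by
      rw [ENNReal.mul_rpow_of_nonneg _ _ hQ.le, ← ENNReal.rpow_mul, one_div,
        inv_mul_cancel₀ hQ.ne', ENNReal.rpow_one]

theorem ENNReal.two_rpow_ne_zero (x : ℝ) : (2 : ℝ≥0∞) ^ x ≠ 0 :=
  (ENNReal.rpow_pos (by norm_num) (by norm_num)).ne'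

theorem ENNReal.two_rpow_ne_top (x : ℝ) : (2 : ℝ≥0∞) ^ x ≠ ⊤ :=
  ENNReal.rpow_ne_top_of_ne_zero (by norm_num) (by norm_num)

theorem ENNReal.two_rpow_add (x y : ℝ) : (2 : ℝ≥0∞) ^ (x + y) = 2 ^ x * 2 ^ y :=
  ENNReal.rpow_add _ _ (by norm_num) (by norm_num)

theorem ENNReal.tsum_two_rpow_neg_lt_top {θ : ℝ} (hθ : 0 < θ) :
    ∑' k : ℕ, (2 : ℝ≥0∞) ^ (-θ * k) < ⊤ := by
  have h : ∀ k : ℕ, (2 : ℝ≥0∞) ^ (-θ * k) = ((2 : ℝ≥0∞) ^ (-θ)) ^ k := fun k => by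
    rw [ENNReal.rpow_mul, ENNReal.rpow_natCast]
  simp_rw [h]
  rw [ENNReal.tsum_geometric]
  refine ENNReal.inv_lt_top.2 (tsub_pos_of_lt ?_)
  exact ENNReal.rpow_lt_one_of_one_lt_of_neg (by norm_num) (by linarith)

/-- The two-sided geometric series with ratio `2^(-θ)`. -/
noncomputable def twoSidedSum (θ : ℝ) : ℝ≥0∞ := ∑' j : ℤ, (2 : ℝ≥0∞) ^ (-θ * |(j : ℝ)|)

theorem twoSidedSum_lt_top {θ : ℝ} (hθ : 0 < θ) : twoSidedSum θ < ⊤ := by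
  have hs : Function.Surjective (Sum.elim (fun n : ℕ => (n : ℤ)) fun n : ℕ => -(n : ℤ)) := by
    intro j
    rcases Int.eq_nat_or_neg j with ⟨n, rfl | rfl⟩
    · exact ⟨Sum.inl n, rfl⟩
    · exact ⟨Sum.inr n, rfl⟩
  refine (ENNReal.tsum_le_tsum_comp_of_surjective hs _).trans_lt ?_
  rw [ENNReal.summable.tsum_sum ENNReal.summable]
  have := ENNReal.tsum_two_rpow_neg_lt_top hθ
  simpa using this

theorem tsum_nat_le_twoSidedSum (θ : ℝ) (n : ℕ) :
    ∑' k : ℕ, (2 : ℝ≥0∞) ^ (-θ * |(k : ℝ) - n|) ≤ twoSidedSum θ := by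
  have hi : Function.Injective fun k : ℕ => (k : ℤ) - n := fun a b h => by
    simpa using h
  have := ENNReal.tsum_comp_le_tsum_of_injective hi
    (fun j : ℤ => (2 : ℝ≥0∞) ^ (-θ * |(j : ℝ)|))
  simpa [twoSidedSum] using this

/-- Summation of dyadic pieces. -/
theorem exists_tsum_rpow_le_dyadic {Q : ℝ} (hQ : 2 < Q) : ∃ C : ℝ≥0∞, C ≠ ⊤ ∧
    ∀ e : ℝ≥0∞, e ≠ 0 → e ≤ 1 → ∃ c : ℕ → ℝ≥0∞, ∀ x : ℕ → ℝ≥0∞,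
      (∑' k, x k) ^ Q ≤ C * ∑' k, c k * x k ^ Q ∧
      ∑' k, c k * (2 ^ k * (e * min e ((2 : ℝ≥0∞)⁻¹ ^ k)) ^ (Q - 1)) ≤ C * e ^ (2 * Q - 3) := by
  -- The summands peak where 2^(-k) ~ e. They decay like 2^(-(k-n)(Q-2)) beyond the peak and like
  -- 2^(-(n-k)) before it. Weights growing at a rate θ at most half of either rate still leave
  -- geometric decay at rate θ.
  set θ : ℝ := min 1 (Q - 2) / 2 with hθ
  have hθ0 : 0 < θ := by
    have : 0 < min 1 (Q - 2) := lt_min one_pos (by linarith)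
    positivity
  have hθ1 : θ ≤ 1 / 2 := by
    have := min_le_left 1 (Q - 2)
    linarith
  have hθ2 : 2 * θ ≤ Q - 2 := by
    have := min_le_right 1 (Q - 2)
    linarith
  have hQ0 : 0 < Q := by linarith
  set η : ℝ := θ / Q with hη
  have hη0 : 0 < η := by positivity
  have T1 := twoSidedSum_lt_top hη0
  have T2 := twoSidedSum_lt_top hθ0
  refine ⟨twoSidedSum η ^ Q + 2 ^ (2 * Q - 3) * twoSidedSum θ, ?_, ?_⟩
  · refine ENNReal.add_ne_top.2 ⟨(ENNReal.rpow_lt_top_of_nonneg hQ0.le T1.ne).ne, ?_⟩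
    exact ENNReal.mul_ne_top (ENNReal.two_rpow_ne_top _) T2.ne
  intro e he0 he1
  have het : e ≠ ⊤ := (he1.trans_lt ENNReal.one_lt_top).ne
  have hpow : ∀ k : ℕ, (2 : ℝ≥0∞)⁻¹ ^ k = 2 ^ (-(k : ℝ)) := fun k => by
    rw [ENNReal.rpow_neg, ENNReal.rpow_natCast, ENNReal.inv_pow]
  -- The peak index: 2^(-(n+1)) < e ≤ 2^(-n).
  obtain ⟨n, hn1, hn2⟩ := exists_nat_pow_near_of_lt_one (x := e.toReal) (y := 2⁻¹)
    (ENNReal.toReal_pos he0 het) (by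
      rw [← ENNReal.toReal_one]; exact ENNReal.toReal_mono ENNReal.one_ne_top he1)
      (by norm_num) (by norm_num)
  have conv : ∀ k : ℕ, ((2 : ℝ)⁻¹ ^ k) = ((2 : ℝ≥0∞) ^ (-(k : ℝ))).toReal := fun k => by
    rw [← hpow, ENNReal.toReal_pow, ENNReal.toReal_inv]; norm_num
  rw [conv, ENNReal.toReal_lt_toReal (ENNReal.two_rpow_ne_top _) het] at hn1
  rw [conv, ENNReal.toReal_le_toReal het (ENNReal.two_rpow_ne_top _)] at hn2
  refine ⟨fun k => 2 ^ (θ * |(k : ℝ) - n|), fun x => ⟨?_, ?_⟩⟩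
  · have h := ENNReal.tsum_rpow_le hQ0 x (fun k : ℕ => (2 : ℝ≥0∞) ^ (-η * |(k : ℝ) - n|))
      (fun k => ENNReal.two_rpow_ne_zero _) (fun k => ENNReal.two_rpow_ne_top _)
    have e1 : ∀ k : ℕ, ((2 : ℝ≥0∞) ^ (-η * |(k : ℝ) - n|)) ^ (-Q) = 2 ^ (θ * |(k : ℝ) - n|) :=
      fun k => by
      rw [← ENNReal.rpow_mul]
      congr 1
      rw [hη]; field_simp
    simp_rw [e1] at h
    refine h.trans ?_
    gcongr
    refine le_trans ?_ le_self_add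
    gcongr
    exact tsum_nat_le_twoSidedSum _ _
  · have hterm : ∀ k : ℕ, (2 : ℝ≥0∞) ^ (θ * |(k : ℝ) - n|) *
        (2 ^ k * (e * min e ((2 : ℝ≥0∞)⁻¹ ^ k)) ^ (Q - 1))
        ≤ 2 ^ (-(2 * Q - 3) * n) * 2 ^ (-θ * |(k : ℝ) - n|) := by
      intro k
      have h1 : e * min e ((2 : ℝ≥0∞)⁻¹ ^ k) ≤ 2 ^ (-(n : ℝ)) * 2 ^ (-(max (n : ℝ) k)) := by
        rw [hpow]
        gcongr
        rcases le_total (n : ℝ) k with h | h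
        · rw [max_eq_right h]; exact min_le_right _ _
        · rw [max_eq_left h]; exact (min_le_left _ _).trans hn2
      calc _ ≤ (2 : ℝ≥0∞) ^ (θ * |(k : ℝ) - n|) *
            (2 ^ (k : ℝ) * (2 ^ (-(n : ℝ)) * 2 ^ (-(max (n : ℝ) k))) ^ (Q - 1)) := by
            rw [ENNReal.rpow_natCast]
            gcongr
            linarith
        _ = 2 ^ (θ * |(k : ℝ) - n| + (k + (-n + -(max (n : ℝ) k)) * (Q - 1))) := by
            rw [← ENNReal.two_rpow_add, ← ENNReal.rpow_mul, ← ENNReal.two_rpow_add,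
              ← ENNReal.two_rpow_add]
        _ ≤ _ := by
            rw [← ENNReal.two_rpow_add]
            refine ENNReal.rpow_le_rpow_of_exponent_le (by norm_num) ?_
            rcases le_total (n : ℝ) k with h | h
            · rw [max_eq_right h, abs_of_nonneg (by linarith)]
              nlinarith
            · rw [max_eq_left h, abs_of_nonpos (by linarith)]
              nlinarith
    refine (ENNReal.tsum_le_tsum hterm).trans ?_
    rw [ENNReal.tsum_mul_left]
    have h2 : (2 : ℝ≥0∞) ^ (-(2 * Q - 3) * n) ≤ 2 ^ (2 * Q - 3) * e ^ (2 * Q - 3) := by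
      rw [← ENNReal.mul_rpow_of_nonneg _ _ (by linarith : 0 ≤ 2 * Q - 3),
        show -(2 * Q - 3) * (n : ℝ) = -n * (2 * Q - 3) by ring, ENNReal.rpow_mul]
      refine ENNReal.rpow_le_rpow ?_ (by linarith)
      have h3 : (2 : ℝ≥0∞) ^ (-(n : ℝ)) = 2 * 2 ^ (-((n + 1 : ℕ) : ℝ)) := by
        conv_rhs => enter [1]; rw [← ENNReal.rpow_one 2]
        rw [← ENNReal.two_rpow_add]
        congr 1; push_cast; ring
      rw [h3]
      gcongr
    calc _ ≤ 2 ^ (2 * Q - 3) * e ^ (2 * Q - 3) * twoSidedSum θ := by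
          gcongr
          exact tsum_nat_le_twoSidedSum _ _
      _ = 2 ^ (2 * Q - 3) * twoSidedSum θ * e ^ (2 * Q - 3) := by ring
      _ ≤ _ := by gcongr; exact le_add_self

/-! ### The operator on a horizontal segment: bilinear pieces and the restricted estimate. -/

/-- The oscillating kernel of the operator acting on functions on a horizontal line. -/
noncomputable def lineKernel (L : ℝ) (ψ : ℝ × ℝ → ℂ) (x : ℝ × ℝ) (s : ℝ) : ℂ :=
  Complex.exp (Complex.I * L * (hyp (x.1 - s) x.2 : ℝ)) * ψ (x.1 - s, x.2)

theorem continuous_lineKernel {L : ℝ} {ψ : ℝ × ℝ → ℂ} (hψ : Continuous ψ) :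
    Continuous fun v : (ℝ × ℝ) × ℝ => lineKernel L ψ v.1 v.2 := by
  have h : Continuous fun v : (ℝ × ℝ) × ℝ => hyp (v.1.1 - v.2) v.1.2 :=
    continuous_hyp.comp (f := fun v : (ℝ × ℝ) × ℝ => (v.1.1 - v.2, v.1.2)) (by fun_prop)
  unfold lineKernel
  fun_prop

theorem norm_lineKernel (L : ℝ) (ψ : ℝ × ℝ → ℂ) (x : ℝ × ℝ) (s : ℝ) :
    ‖lineKernel L ψ x s‖ = ‖ψ (x.1 - s, x.2)‖ := by
  rw [lineKernel, norm_mul, norm_exp_I_mul_mul, one_mul]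

theorem lineKernel_eq_zero {L c R ε : ℝ} {ψ : ℝ × ℝ → ℂ} (hs : SupportedOffAxis ψ c R) (hε : ε ≤ 1)
    {x : ℝ × ℝ} {s : ℝ} (h : s ∈ Set.Icc 0 ε)
    (hx : x ∉ Set.Icc (-(R + 1)) (R + 1) ×ˢ Set.Icc (-R) R) : lineKernel L ψ x s = 0 := by
  rw [lineKernel, mul_eq_zero]
  right
  by_contra h0
  obtain ⟨-, h1, h2⟩ := hs _ h0
  simp only at h1 h2
  refine hx ⟨?_, abs_le.1 h1⟩
  have := abs_le.1 h2
  exact ⟨by linarith [this.1, h.1], by linarith [this.2, h.2]⟩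

/-- Identifies the integrand of the composition with the adjoint as the four-term kernel already
estimated. -/
theorem lineKernel_mul_conj (L : ℝ) (ψ : ℝ × ℝ → ℂ) (x z w : ℝ × ℝ) :
    lineKernel L ψ x z.1 * lineKernel L ψ x z.2 *
      starRingEnd ℂ (lineKernel L ψ x w.1 * lineKernel L ψ x w.2) = quadKernel L ψ x z w := by
  have hc : ∀ s, starRingEnd ℂ (Complex.exp (Complex.I * L * (hyp (x.1 - s) x.2 : ℝ)))
      = Complex.exp (-(Complex.I * L * (hyp (x.1 - s) x.2 : ℝ))) := fun s => by
    rw [← Complex.exp_conj]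
    congr 1
    simp
  simp only [lineKernel, quadKernel, quadAmp, fourSum, map_mul, hc]
  have : Complex.exp (Complex.I * L * ((hyp (x.1 - z.1) x.2 + hyp (x.1 - z.2) x.2
      - hyp (x.1 - w.1) x.2 - hyp (x.1 - w.2) x.2 : ℝ) : ℂ))
      = Complex.exp (Complex.I * L * (hyp (x.1 - z.1) x.2 : ℝ))
        * Complex.exp (Complex.I * L * (hyp (x.1 - z.2) x.2 : ℝ))
        * (Complex.exp (-(Complex.I * L * (hyp (x.1 - w.1) x.2 : ℝ)))
        * Complex.exp (-(Complex.I * L * (hyp (x.1 - w.2) x.2 : ℝ)))) := by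
    rw [← Complex.exp_add, ← Complex.exp_add, ← Complex.exp_add]
    congr 1; push_cast; ring
  rw [this]
  ring

/-- Ordered pairs of points of `[0, ε]` at distance about `2^(-k)`. -/
def dyadicPairs (ε : ℝ) (k : ℕ) : Set (ℝ × ℝ) :=
  orderedPairs ε ∩ {z | 2⁻¹ ^ (k + 1) ≤ z.1 - z.2 ∧ z.1 - z.2 < 2⁻¹ ^ k}

theorem measurableSet_dyadicPairs (ε : ℝ) (k : ℕ) : MeasurableSet (dyadicPairs ε k) := by
  refine (isCompact_orderedPairs ε).measurableSet.inter (MeasurableSet.inter ?_ ?_)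
  · exact measurableSet_le measurable_const (measurable_fst.sub measurable_snd)
  · exact measurableSet_lt (measurable_fst.sub measurable_snd) measurable_const

theorem volume_dyadicPairs_lt_top (ε : ℝ) (k : ℕ) : volume (dyadicPairs ε k) < ⊤ :=
  (measure_mono Set.inter_subset_left).trans_lt (isCompact_orderedPairs ε).measure_lt_top

/-- The pointwise bound of the kernel of the composition of the bilinear operator with its
adjoint. -/
def QuadKernelBound (ψ : ℝ × ℝ → ℂ) (ε K : ℝ) : Prop :=
  ∀ z ∈ orderedPairs ε, ∀ w ∈ orderedPairs ε, ∀ L : ℝ, 0 < L →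
    ‖∫ x, quadKernel L ψ x z w‖ ≤ K ∧
    (0 < pairDist z w → ‖∫ x, quadKernel L ψ x z w‖ ≤ K / (L * pairDist z w) ^ 3)

/-- On one dyadic piece the map s₁ - s₂ ↦ (s₁ - s₂)² expands by at least δ = 2^(-k), so the kernel
is dominated by decay at scale 1/L in the sum and 1/(Lδ) in the difference. Its mass is therefore of
size L^(-2) 2^k. -/
theorem QuadKernelBound.lintegral_le {ψ : ℝ × ℝ → ℂ} {ε K L : ℝ} (h : QuadKernelBound ψ ε K)
    (hK : 0 < K) (hL : 0 < L) (k : ℕ) {z : ℝ × ℝ} (hz : z ∈ dyadicPairs ε k) :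
    ∫⁻ w in dyadicPairs ε k, ‖∫ x, quadKernel L ψ x z w‖ₑ
      ≤ ENNReal.ofReal (8 * K) * (∫⁻ x, decayProfile x) ^ 2 * ENNReal.ofReal ((L ^ 2)⁻¹) * 2 ^ k := by
  obtain ⟨δ, hδ⟩ : ∃ δ : ℝ, δ = 2⁻¹ ^ k := ⟨_, rfl⟩
  have hδ0 : 0 < δ := by rw [hδ]; positivity
  have s1 : ∫⁻ w in dyadicPairs ε k, ‖∫ x, quadKernel L ψ x z w‖ₑ
      ≤ ∫⁻ w in dyadicPairs ε k, ENNReal.ofReal (8 * K) *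
        (decayProfile (L * (z.1 + z.2 - w.1 - w.2)) *
          decayProfile (L * δ * ((z.1 - z.2) - (w.1 - w.2)))) := by
    refine setLIntegral_mono_ae' (measurableSet_dyadicPairs ε k)
      (Filter.Eventually.of_forall fun w hw => ?_)
    rw [← ofReal_norm]
    obtain ⟨h1, h2⟩ := h z hz.1 w hw.1 L hL
    have hD : |L * (z.1 + z.2 - w.1 - w.2)| + |L * δ * ((z.1 - z.2) - (w.1 - w.2))|
        ≤ L * pairDist z w := by
      rw [abs_mul, abs_mul, abs_of_pos hL, abs_of_pos (mul_pos hL hδ0), pairDist,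
        mul_add, mul_assoc]
      gcongr
      have e : (z.1 - z.2) ^ 2 - (w.1 - w.2) ^ 2
          = ((z.1 - z.2) + (w.1 - w.2)) * ((z.1 - z.2) - (w.1 - w.2)) := by ring
      rw [e, abs_mul]
      gcongr
      -- Both differences are at least δ/2 on the piece, so their sum is at least δ.
      refine le_trans ?_ (le_abs_self _)
      have h3 := hz.2.1
      have h4 := hw.2.1
      rw [pow_succ, ← hδ] at h3 h4
      linarith
    refine ofReal_min_le_decayProfile hK h1 fun hpos => ?_
    have hp : 0 < L * pairDist z w := hpos.trans_le hD
    refine (h2 (pos_of_mul_pos_right hp hL.le)).trans ?_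
    gcongr
  have s2 : ∫⁻ w : ℝ × ℝ, ENNReal.ofReal (8 * K) *
        (decayProfile (L * (z.1 + z.2 - w.1 - w.2)) *
          decayProfile (L * δ * ((z.1 - z.2) - (w.1 - w.2))))
      = ENNReal.ofReal (8 * K) * (ENNReal.ofReal (1 / (2 * L ^ 2 * δ))
        * (∫⁻ x, decayProfile x) ^ 2) := by
    rw [lintegral_const_mul' _ _ ENNReal.ofReal_ne_top, lintegral_decayProfile_pair hL hδ0]
  have s3 : ENNReal.ofReal (1 / (2 * L ^ 2 * δ)) ≤ ENNReal.ofReal ((L ^ 2)⁻¹) * 2 ^ k := by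
    have e : (2 : ℝ≥0∞) ^ k = ENNReal.ofReal (2 ^ k) := by
      rw [ENNReal.ofReal_pow (by norm_num)]; simp
    rw [e, ← ENNReal.ofReal_mul (by positivity)]
    refine ENNReal.ofReal_le_ofReal ?_
    rw [hδ, inv_pow]
    have : (0:ℝ) < 2 ^ k := by positivity
    have h2 : 1 / (2 * L ^ 2 * ((2:ℝ) ^ k)⁻¹) = (L ^ 2)⁻¹ * 2 ^ k / 2 := by field_simp
    rw [h2]
    have : 0 < (L ^ 2)⁻¹ * 2 ^ k := by positivity
    linarith
  refine s1.trans ((setLIntegral_le_lintegral _ _).trans (s2.le.trans ?_))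
  rw [mul_assoc (ENNReal.ofReal (8 * K) * _), mul_assoc (ENNReal.ofReal (8 * K)),
    mul_comm ((∫⁻ x, decayProfile x) ^ 2)]
  gcongr

/-- The bilinear operator restricted to pairs at distance about `2^(-k)`. -/
noncomputable def dyadicBilinear (L : ℝ) (ψ : ℝ × ℝ → ℂ) (ε : ℝ) (k : ℕ) (F : ℝ × ℝ → ℂ)
    (x : ℝ × ℝ) : ℂ :=
  ∫ z in dyadicPairs ε k, lineKernel L ψ x z.1 * lineKernel L ψ x z.2 * F z

theorem measurable_lineKernel_pair {L : ℝ} {ψ : ℝ × ℝ → ℂ} (hψ : Continuous ψ) :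
    Measurable fun v : (ℝ × ℝ) × (ℝ × ℝ) => lineKernel L ψ v.1 v.2.1 * lineKernel L ψ v.1 v.2.2 :=
  (((continuous_lineKernel hψ).comp (f := fun v : (ℝ × ℝ) × (ℝ × ℝ) => (v.1, v.2.1))
    (by fun_prop)).mul ((continuous_lineKernel hψ).comp
    (f := fun v : (ℝ × ℝ) × (ℝ × ℝ) => (v.1, v.2.2)) (by fun_prop))).measurable

/-- Schur's test with the row bound for the k-th piece. Restricting x to a box containing the
support makes the measure finite without changing either side. -/
theorem lintegral_dyadicBilinear_sq_le {ψ : ℝ × ℝ → ℂ} {c R ε K M L : ℝ} (hψ : Continuous ψ)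
    (hs : SupportedOffAxis ψ c R) (hM : ∀ z, ‖ψ z‖ ≤ M) (hε : ε ≤ 1)
    (h : QuadKernelBound ψ ε K) (hK : 0 < K) (hL : 0 < L) (k : ℕ) {F : ℝ × ℝ → ℂ}
    (hF : Measurable F) (hF1 : ∀ z, ‖F z‖ ≤ 1) :
    ∫⁻ x, ‖dyadicBilinear L ψ ε k F x‖ₑ ^ 2
      ≤ ENNReal.ofReal (8 * K) * (∫⁻ x, decayProfile x) ^ 2 * ENNReal.ofReal ((L ^ 2)⁻¹) * 2 ^ k
        * ∫⁻ z in dyadicPairs ε k, ‖F z‖ₑ ^ 2 := by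
  set box : Set (ℝ × ℝ) := Set.Icc (-(R + 1)) (R + 1) ×ˢ Set.Icc (-R) R with hbox
  have hboxc : IsCompact box := isCompact_Icc.prod isCompact_Icc
  have : IsFiniteMeasure (volume.restrict box) :=
    ⟨by rw [Measure.restrict_apply_univ]; exact hboxc.measure_lt_top⟩
  have : IsFiniteMeasure (volume.restrict (dyadicPairs ε k)) :=
    ⟨by rw [Measure.restrict_apply_univ]; exact volume_dyadicPairs_lt_top ε k⟩
  have hzero : ∀ x ∉ box, ∀ z ∈ dyadicPairs ε k,
      lineKernel L ψ x z.1 * lineKernel L ψ x z.2 = 0 := fun x hx z hz => by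
    rw [lineKernel_eq_zero hs hε (orderedPairs_mem hz.1).1 hx, zero_mul]
  have hG : ∀ x ∉ box, dyadicBilinear L ψ ε k F x = 0 := by
    intro x hx
    refine setIntegral_eq_zero_of_forall_eq_zero fun z hz => ?_
    rw [hzero x hx z hz, zero_mul]
  have h1 : ∫⁻ x, ‖dyadicBilinear L ψ ε k F x‖ₑ ^ 2
      = ∫⁻ x in box, ‖dyadicBilinear L ψ ε k F x‖ₑ ^ 2 := by
    rw [← lintegral_indicator hboxc.measurableSet]
    refine lintegral_congr fun x => ?_
    by_cases hx : x ∈ box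
    · rw [Set.indicator_of_mem hx]
    · rw [Set.indicator_of_notMem hx, hG x hx]; simp
  rw [h1]
  refine lintegral_enorm_sq_integral_le (μ := volume.restrict box)
    (ν := volume.restrict (dyadicPairs ε k))
    (k := fun x z => lineKernel L ψ x z.1 * lineKernel L ψ x z.2)
    (measurable_lineKernel_pair hψ) (M := M * M) (fun x z => ?_) hF hF1 ?_
  · have hM0 : 0 ≤ M := (norm_nonneg _).trans (hM 0)
    rw [norm_mul, norm_lineKernel, norm_lineKernel]
    gcongr <;> exact hM _
  · refine (ae_restrict_iff' (measurableSet_dyadicPairs ε k)).2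
      (Filter.Eventually.of_forall fun z hz => ?_)
    refine le_trans (le_of_eq ?_) (h.lintegral_le hK hL k hz)
    refine lintegral_congr fun w => ?_
    simp_rw [lineKernel_mul_conj]
    rw [setIntegral_eq_integral_of_forall_compl_eq_zero]
    intro x hx
    rw [← lineKernel_mul_conj, hzero x hx z hz, zero_mul]

theorem volume_diagonal : volume {z : ℝ × ℝ | z.1 = z.2} = 0 := by
  rw [Measure.volume_eq_prod, Measure.measure_prod_null
    (measurableSet_eq_fun measurable_fst measurable_snd)]
  refine Filter.Eventually.of_forall fun x => ?_
  have : Prod.mk x ⁻¹' {z : ℝ × ℝ | z.1 = z.2} = {x} := by ext y; simp [eq_comm]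
  change volume (Prod.mk x ⁻¹' {z : ℝ × ℝ | z.1 = z.2}) = 0
  rw [this]; simp

theorem iUnion_dyadicPairs {ε : ℝ} (hε : ε ≤ 1 / 2) :
    ⋃ k, dyadicPairs ε k = orderedPairs ε ∩ {z | z.2 < z.1} := by
  ext z
  simp only [Set.mem_iUnion, dyadicPairs, Set.mem_inter_iff, Set.mem_ofPred_eq, ← and_assoc]
  constructor
  · rintro ⟨k, ⟨h1, h2⟩, -⟩
    have : (0:ℝ) < 2⁻¹ ^ (k + 1) := by positivity
    exact ⟨h1, by linarith⟩
  · rintro ⟨h1, h2⟩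
    obtain ⟨m1, m2⟩ := orderedPairs_mem h1
    obtain ⟨n, hn1, hn2⟩ := exists_nat_pow_near_of_lt_one (x := z.1 - z.2) (y := 2⁻¹)
      (by linarith) (by linarith [m1.2, m2.1]) (by norm_num) (by norm_num)
    rcases hn2.lt_or_eq with h | h
    · exact ⟨n, ⟨h1, hn1.le⟩, h⟩
    -- The power search returns intervals closed on the right while the pieces are closed on the
    -- left, so an exact power of 1/2 belongs to the preceding index. The value 1 is excluded by ε ≤
    -- 1/2.
    · rcases n with _ | n
      · simp at h; linarith [m1.2, m2.1]
      · exact ⟨n, ⟨h1, h.ge⟩, by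
          rw [h, pow_succ]
          have : (0:ℝ) < 2⁻¹ ^ n := by positivity
          linarith⟩

theorem pairwise_disjoint_dyadicPairs (ε : ℝ) :
    Pairwise (Function.onFun Disjoint (dyadicPairs ε)) := by
  have key : ∀ i j, i < j → Disjoint (dyadicPairs ε i) (dyadicPairs ε j) := by
    intro i j hij
    rw [Set.disjoint_left]
    rintro z ⟨-, h1, -⟩ ⟨-, -, h2⟩
    have h3 : (2⁻¹ : ℝ) ^ j ≤ 2⁻¹ ^ (i + 1) :=
      pow_le_pow_of_le_one (by norm_num) (by norm_num) hij
    exact absurd (h1.trans_lt h2) (not_lt.2 h3)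
  intro i j hij
  rcases lt_or_gt_of_ne hij with h | h
  · exact key i j h
  · exact (key j i h).symm

/-- The square of an integral as a sum over dyadic distances. -/
theorem enorm_sq_integral_le_tsum {ε : ℝ} (hε : ε ≤ 1 / 2) {g : ℝ → ℂ} (hg : Measurable g) {M : ℝ}
    (hM : ∀ s, ‖g s‖ ≤ M) :
    ‖∫ s in Set.Icc 0 ε, g s‖ₑ ^ 2 ≤ 2 * ∑' k, ‖∫ z in dyadicPairs ε k, g z.1 * g z.2‖ₑ := by
  set φ : ℝ × ℝ → ℂ := fun z => g z.1 * g z.2 with hφ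
  set Sq : Set (ℝ × ℝ) := Set.Icc 0 ε ×ˢ Set.Icc 0 ε with hSq
  have hSqm : MeasurableSet Sq := measurableSet_Icc.prod measurableSet_Icc
  have hint : IntegrableOn φ Sq := by
    have : IsFiniteMeasure (volume.restrict Sq) :=
      ⟨by rw [Measure.restrict_apply_univ]; exact (isCompact_Icc.prod isCompact_Icc).measure_lt_top⟩
    refine Integrable.of_bound (C := M * M) (by
      exact (by fun_prop : Measurable φ).aestronglyMeasurable) (Filter.Eventually.of_forall fun z => ?_)
    have : 0 ≤ M := (norm_nonneg _).trans (hM 0)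
    rw [hφ]; simp only [norm_mul]
    gcongr <;> exact hM _
  have h1 : (∫ s in Set.Icc 0 ε, g s) * (∫ s in Set.Icc 0 ε, g s) = ∫ z in Sq, φ z := by
    rw [← integral_prod_mul, Measure.prod_restrict, Measure.volume_eq_prod]
  have hA : MeasurableSet {z : ℝ × ℝ | z.2 < z.1} := measurableSet_lt measurable_snd measurable_fst
  have h2 : (∫ z in Sq ∩ {z | z.2 < z.1}, φ z) + ∫ z in Sq \ {z | z.2 < z.1}, φ z
      = ∫ z in Sq, φ z := integral_inter_add_sdiff hA hint
  -- Reflection in the diagonal exchanges the two halves, and the diagonal itself is null; this is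
  -- the source of the factor 2.
  have h3 : ∫ z in Sq \ {z | z.2 < z.1}, φ z = ∫ z in Sq ∩ {z | z.2 < z.1}, φ z := by
    have hswap := (Measure.measurePreserving_swap (μ := (volume : Measure ℝ))
      (ν := (volume : Measure ℝ))).setIntegral_preimage_emb
      MeasurableEquiv.prodComm.measurableEmbedding φ (Sq ∩ {z | z.2 < z.1})
    rw [← Measure.volume_eq_prod] at hswap
    have e1 : ∀ z : ℝ × ℝ, φ z.swap = φ z := fun z => mul_comm _ _
    simp_rw [e1] at hswap
    rw [← hswap]
    refine setIntegral_congr_set ?_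
    have hd : ∀ᵐ z : ℝ × ℝ, z.1 ≠ z.2 := by
      rw [ae_iff]; simpa using volume_diagonal
    filter_upwards [hd] with z hz
    apply propext
    change (z ∈ Sq ∧ ¬ z.2 < z.1) ↔ ((z.2 ∈ Set.Icc 0 ε ∧ z.1 ∈ Set.Icc 0 ε) ∧ z.1 < z.2)
    rw [not_lt, lt_iff_le_and_ne]
    constructor
    · rintro ⟨⟨a, b⟩, h⟩; exact ⟨⟨b, a⟩, h, hz⟩
    · rintro ⟨⟨a, b⟩, h, -⟩; exact ⟨⟨b, a⟩, h⟩
  have h4 : Sq ∩ {z | z.2 < z.1} = ⋃ k, dyadicPairs ε k := by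
    rw [iUnion_dyadicPairs hε]
    ext z
    constructor
    · rintro ⟨⟨a, b⟩, h⟩; exact ⟨⟨b.1, le_of_lt h, a.2⟩, h⟩
    · rintro ⟨a, h⟩; exact ⟨⟨(orderedPairs_mem a).1, (orderedPairs_mem a).2⟩, h⟩
  have h5 : ∫ z in Sq ∩ {z | z.2 < z.1}, φ z = ∑' k, ∫ z in dyadicPairs ε k, φ z := by
    have hint' : IntegrableOn φ (⋃ k, dyadicPairs ε k) := by
      rw [← h4]; exact hint.mono_set Set.inter_subset_left
    rw [h4]
    exact integral_iUnion (fun k => measurableSet_dyadicPairs ε k)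
      (pairwise_disjoint_dyadicPairs ε) hint'
  rw [sq, ← enorm_mul, h1, ← h2, h3, ← two_mul, enorm_mul, h5]
  have e2 : ‖(2:ℂ)‖ₑ = 2 := by rw [← ofReal_norm]; simp
  rw [e2]
  gcongr
  exact enorm_tsum_le_tsum_enorm

/-- Two bounds: the full product E × E, and Fubini with slices in s₁ contained in an interval of
length 2^(-k) next to s₂. -/
theorem volume_dyadicPairs_inter_prod_le (ε : ℝ) (k : ℕ) {E : Set ℝ} (hE : MeasurableSet E) :
    volume (dyadicPairs ε k ∩ E ×ˢ E) ≤ volume.restrict (Set.Icc 0 ε) E *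
      min (volume.restrict (Set.Icc 0 ε) E) ((2 : ℝ≥0∞)⁻¹ ^ k) := by
  rw [Measure.restrict_apply hE]
  set E' := E ∩ Set.Icc 0 ε with hE'
  have hE'm : MeasurableSet E' := hE.inter measurableSet_Icc
  have hsub : ∀ z ∈ dyadicPairs ε k ∩ E ×ˢ E, z.1 ∈ E' ∧ z.2 ∈ E' := fun z hz =>
    ⟨⟨hz.2.1, (orderedPairs_mem hz.1.1).1⟩, ⟨hz.2.2, (orderedPairs_mem hz.1.1).2⟩⟩
  rw [mul_min]
  refine le_min ?_ ?_
  · refine (measure_mono (t := E' ×ˢ E') fun z hz => hsub z hz).trans (le_of_eq ?_)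
    rw [Measure.volume_eq_prod, Measure.prod_prod]
  · set S : Set (ℝ × ℝ) := {z | z.2 ∈ E'} ∩
      {z | 2⁻¹ ^ (k + 1) ≤ z.1 - z.2 ∧ z.1 - z.2 < 2⁻¹ ^ k} with hS
    have hSm : MeasurableSet S := by
      refine (measurable_snd hE'm).inter (MeasurableSet.inter ?_ ?_)
      · exact measurableSet_le measurable_const (measurable_fst.sub measurable_snd)
      · exact measurableSet_lt (measurable_fst.sub measurable_snd) measurable_const
    refine (measure_mono (t := S) fun z hz => ⟨(hsub z hz).2, hz.1.2⟩).trans ?_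
    rw [Measure.volume_eq_prod, Measure.prod_apply_symm hSm]
    have hle : ∀ y, volume ((fun x => (x, y)) ⁻¹' S) ≤ E'.indicator (fun _ => 2⁻¹ ^ k) y := by
      intro y
      by_cases hy : y ∈ E'
      · rw [Set.indicator_of_mem hy]
        have : (fun x => (x, y)) ⁻¹' S ⊆ Set.Ico y (y + 2⁻¹ ^ k) := by
          rintro x ⟨-, h1, h2⟩
          have : (0:ℝ) < 2⁻¹ ^ (k + 1) := by positivity
          simp only at h1 h2
          exact ⟨by linarith, by linarith⟩
        refine (measure_mono this).trans (le_of_eq ?_)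
        rw [Real.volume_Ico, add_sub_cancel_left, ENNReal.ofReal_pow (by norm_num),
          ENNReal.ofReal_inv_of_pos (by norm_num)]
        simp
      · rw [Set.indicator_of_notMem hy]
        have : (fun x => (x, y)) ⁻¹' S = ∅ := by
          ext x
          simp only [Set.mem_preimage, Set.mem_empty_iff_false, iff_false]
          exact fun h => hy h.1
        rw [this]; simp
    refine (lintegral_mono hle).trans (le_of_eq ?_)
    rw [lintegral_indicator hE'm, setLIntegral_const, mul_comm]

/-- Restricted strong type estimate on a line. -/
theorem exists_line_restricted {ψ : ℝ × ℝ → ℂ} {c R ε K M q : ℝ} (hψ : Continuous ψ)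
    (hs : SupportedOffAxis ψ c R) (hM : ∀ z, ‖ψ z‖ ≤ M) (hε : ε ≤ 1 / 2)
    (h : QuadKernelBound ψ ε K) (hK : 0 < K) (hq : 4 < q) : ∃ C : ℝ≥0∞, C ≠ ⊤ ∧
    ∀ L : ℝ, 0 < L → ∀ E : Set ℝ, MeasurableSet E → ∀ f : ℝ → ℂ, Measurable f →
      (∀ s, ‖f s‖ ≤ E.indicator (fun _ => (1 : ℝ)) s) →
      ∫⁻ x, ‖∫ s in Set.Icc 0 ε, lineKernel L ψ x s * f s‖ₑ ^ q
        ≤ C * ENNReal.ofReal ((L ^ 2)⁻¹) * (volume.restrict (Set.Icc 0 ε) E) ^ (q - 3) := by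
  set Q := q / 2 with hQ
  have hQ2 : 2 < Q := by rw [hQ]; linarith
  obtain ⟨C, hC, key⟩ := exists_tsum_rpow_le_dyadic hQ2
  set D : ℝ≥0∞ := ENNReal.ofReal (8 * K) * (∫⁻ x, decayProfile x) ^ 2 with hD
  have hDt : D ≠ ⊤ := ENNReal.mul_ne_top ENNReal.ofReal_ne_top
    (ENNReal.pow_ne_top lintegral_decayProfile_lt_top.ne)
  set B : ℝ≥0∞ := ENNReal.ofReal (M * M) with hB
  refine ⟨2 ^ Q * C * (B ^ (Q - 2) * D * C), ?_, ?_⟩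
  · have h1 : (2 : ℝ≥0∞) ^ Q ≠ ⊤ := ENNReal.two_rpow_ne_top _
    have h2 : B ^ (Q - 2) ≠ ⊤ :=
      (ENNReal.rpow_lt_top_of_nonneg (by linarith) ENNReal.ofReal_ne_top).ne
    exact ENNReal.mul_ne_top (ENNReal.mul_ne_top h1 hC)
      (ENNReal.mul_ne_top (ENNReal.mul_ne_top h2 hDt) hC)
  intro L hL E hE f hf hfE
  have hM0 : 0 ≤ M := (norm_nonneg _).trans (hM 0)
  have hf1 : ∀ s, ‖f s‖ ≤ 1 := fun s => (hfE s).trans (Set.indicator_le_self' (by simp) s)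
  set e := volume.restrict (Set.Icc 0 ε) E with he
  have he1 : e ≤ 1 := by
    refine (measure_mono (Set.subset_univ _)).trans ?_
    rw [Measure.restrict_apply_univ, Real.volume_Icc, ← ENNReal.ofReal_one]
    exact ENNReal.ofReal_le_ofReal (by linarith)
  rcases eq_or_ne e 0 with h0 | h0
  · have hz : ∀ x, ∫ s in Set.Icc 0 ε, lineKernel L ψ x s * f s = 0 := by
      intro x
      refine integral_eq_zero_of_ae ?_
      have : ∀ᵐ s ∂(volume.restrict (Set.Icc 0 ε)), s ∉ E := measure_eq_zero_iff_ae_notMem.1 h0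
      filter_upwards [this] with s hsE
      have := hfE s
      rw [Set.indicator_of_notMem hsE] at this
      simp [norm_le_zero_iff.1 this]
    simp [hz, show (0:ℝ) < q by linarith]
  obtain ⟨w, hw⟩ := key e h0 he1
  set F : ℝ × ℝ → ℂ := fun z => f z.1 * f z.2 with hF
  have hFm : Measurable F := by fun_prop
  have hF1 : ∀ z, ‖F z‖ ≤ 1 := fun z => by
    rw [hF, norm_mul]; exact mul_le_one₀ (hf1 _) (norm_nonneg _) (hf1 _)
  have hFE : ∀ z, ‖F z‖ₑ ≤ (E ×ˢ E).indicator 1 z := by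
    intro z
    by_cases hz : z ∈ E ×ˢ E
    · rw [Set.indicator_of_mem hz, ← ofReal_norm, Pi.one_apply, ← ENNReal.ofReal_one]
      exact ENNReal.ofReal_le_ofReal (hF1 z)
    · have : f z.1 = 0 ∨ f z.2 = 0 := by
        rw [Set.mem_prod, not_and_or] at hz
        rcases hz with hz | hz
        · left; have := hfE z.1; rw [Set.indicator_of_notMem hz] at this
          exact norm_le_zero_iff.1 this
        · right; have := hfE z.2; rw [Set.indicator_of_notMem hz] at this
          exact norm_le_zero_iff.1 this
      have h0 : F z = 0 := mul_eq_zero.2 this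
      rw [h0]; simp
  set a : ℕ → ℝ≥0∞ := fun k => volume (dyadicPairs ε k ∩ E ×ˢ E) with ha
  have haF : ∀ k, ∫⁻ z in dyadicPairs ε k, ‖F z‖ₑ ≤ a k := by
    intro k
    refine (lintegral_mono hFE).trans (le_of_eq ?_)
    rw [lintegral_indicator_one (hE.prod hE), Measure.restrict_apply (hE.prod hE), Set.inter_comm]
  have haF2 : ∀ k, ∫⁻ z in dyadicPairs ε k, ‖F z‖ₑ ^ 2 ≤ a k := by
    intro k
    refine (lintegral_mono fun z => ?_).trans (haF k)
    have : ‖F z‖ₑ ≤ 1 := by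
      rw [← ofReal_norm, ← ENNReal.ofReal_one]; exact ENNReal.ofReal_le_ofReal (hF1 z)
    calc ‖F z‖ₑ ^ 2 = ‖F z‖ₑ * ‖F z‖ₑ := sq _
      _ ≤ ‖F z‖ₑ * 1 := by gcongr
      _ = _ := mul_one _
  set G : ℕ → ℝ × ℝ → ℂ := fun k => dyadicBilinear L ψ ε k F with hG
  have hGm : ∀ k, Measurable (G k) := by
    intro k
    have : StronglyMeasurable fun v : (ℝ × ℝ) × (ℝ × ℝ) =>
        lineKernel L ψ v.1 v.2.1 * lineKernel L ψ v.1 v.2.2 * F v.2 :=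
      ((measurable_lineKernel_pair hψ).mul (hFm.comp measurable_snd)).stronglyMeasurable
    exact this.integral_prod_right.measurable
  have hGs : ∀ k x, ‖G k x‖ₑ ≤ B * a k := by
    intro k x
    refine (enorm_integral_le_lintegral_enorm _).trans ?_
    refine le_trans ?_ (mul_le_mul' le_rfl (haF k))
    rw [← lintegral_const_mul' _ _ ENNReal.ofReal_ne_top]
    refine lintegral_mono fun z => ?_
    rw [enorm_mul]
    gcongr
    rw [← ofReal_norm, norm_mul, norm_lineKernel, norm_lineKernel]
    refine ENNReal.ofReal_le_ofReal ?_
    gcongr <;> exact hM _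
  have hG2 : ∀ k, ∫⁻ x, ‖G k x‖ₑ ^ 2 ≤ D * ENNReal.ofReal ((L ^ 2)⁻¹) * 2 ^ k * a k := fun k =>
    (lintegral_dyadicBilinear_sq_le hψ hs hM (by linarith) h hK hL k hFm hF1).trans
      (mul_le_mul' le_rfl (haF2 k))
  -- Interpolation on one piece: Q - 2 powers of |G_k| are taken out in the sup norm, bounded by B
  -- a_k, and the remaining two are integrated by the L² estimate.
  have hGQ : ∀ k, ∫⁻ x, ‖G k x‖ₑ ^ Q ≤ B ^ (Q - 2) * D * ENNReal.ofReal ((L ^ 2)⁻¹) *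
      (2 ^ k * (e * min e ((2 : ℝ≥0∞)⁻¹ ^ k)) ^ (Q - 1)) := by
    intro k
    have hat : a k ≠ ⊤ :=
      ((measure_mono Set.inter_subset_left).trans_lt (volume_dyadicPairs_lt_top ε k)).ne
    calc ∫⁻ x, ‖G k x‖ₑ ^ Q ≤ ∫⁻ x, (B * a k) ^ (Q - 2) * ‖G k x‖ₑ ^ 2 := by
          refine lintegral_mono fun x => ?_
          have : ‖G k x‖ₑ ^ Q = ‖G k x‖ₑ ^ (Q - 2) * ‖G k x‖ₑ ^ 2 := by
            rw [← ENNReal.rpow_two, ← ENNReal.rpow_add_of_nonneg _ _ (by linarith) (by norm_num)]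
            congr 1; ring
          rw [this]
          gcongr
          exact hGs k x
      _ = (B * a k) ^ (Q - 2) * ∫⁻ x, ‖G k x‖ₑ ^ 2 := by
          rw [lintegral_const_mul _ ((hGm k).enorm.pow_const 2)]
      _ ≤ (B * a k) ^ (Q - 2) * (D * ENNReal.ofReal ((L ^ 2)⁻¹) * 2 ^ k * a k) := by
          gcongr; exact hG2 k
      _ = B ^ (Q - 2) * D * ENNReal.ofReal ((L ^ 2)⁻¹) * (2 ^ k * (a k) ^ (Q - 1)) := by
          have : (a k) ^ (Q - 1) = (a k) ^ (Q - 2) * a k := by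
            conv_rhs => enter [2]; rw [← ENNReal.rpow_one (a k)]
            rw [← ENNReal.rpow_add_of_nonneg _ _ (by linarith) (by norm_num)]
            congr 1; ring
          rw [ENNReal.mul_rpow_of_nonneg _ _ (by linarith), this]
          ring
      _ ≤ _ := by
          gcongr
          · linarith
          exact volume_dyadicPairs_inter_prod_le ε k hE
  have hpt : ∀ x, ‖∫ s in Set.Icc 0 ε, lineKernel L ψ x s * f s‖ₑ ^ q
      ≤ 2 ^ Q * C * ∑' k, w k * ‖G k x‖ₑ ^ Q := by
    intro x
    have hm : Measurable fun s => lineKernel L ψ x s * f s :=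
      ((continuous_lineKernel hψ).comp (f := fun s : ℝ => (x, s)) (by fun_prop)).measurable.mul hf
    have h1 := enorm_sq_integral_le_tsum hε hm (M := M * 1) fun s => by
      rw [norm_mul, norm_lineKernel]
      gcongr
      · exact hM _
      · exact hf1 _
    have h2 : ∀ k, ∫ z in dyadicPairs ε k, lineKernel L ψ x z.1 * f z.1 *
        (lineKernel L ψ x z.2 * f z.2) = G k x := fun k => by
      refine integral_congr_ae (Filter.Eventually.of_forall fun z => ?_)
      simp only [hF]; ring
    simp_rw [h2] at h1
    calc _ = (‖∫ s in Set.Icc 0 ε, lineKernel L ψ x s * f s‖ₑ ^ 2) ^ Q := by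
          rw [← ENNReal.rpow_two, ← ENNReal.rpow_mul]
          congr 1; rw [hQ]; ring
      _ ≤ (2 * ∑' k, ‖G k x‖ₑ) ^ Q := by gcongr
      _ = 2 ^ Q * (∑' k, ‖G k x‖ₑ) ^ Q := ENNReal.mul_rpow_of_nonneg _ _ (by linarith)
      _ ≤ 2 ^ Q * (C * ∑' k, w k * ‖G k x‖ₑ ^ Q) := by
          gcongr; exact (hw _).1
      _ = _ := by ring
  refine (lintegral_mono hpt).trans ?_
  have hmeas : ∀ k, Measurable fun x => w k * ‖G k x‖ₑ ^ Q := fun k =>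
    ((hGm k).enorm.pow_const Q).const_mul _
  rw [lintegral_const_mul _ (Measurable.tsum hmeas),
    lintegral_tsum fun k => (hmeas k).aemeasurable]
  calc 2 ^ Q * C * ∑' k, ∫⁻ x, w k * ‖G k x‖ₑ ^ Q
      ≤ 2 ^ Q * C * ∑' k, (B ^ (Q - 2) * D * ENNReal.ofReal ((L ^ 2)⁻¹)) *
        (w k * (2 ^ k * (e * min e ((2 : ℝ≥0∞)⁻¹ ^ k)) ^ (Q - 1))) := by
        gcongr with k
        rw [lintegral_const_mul _ ((hGm k).enorm.pow_const Q)]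
        refine (mul_le_mul' le_rfl (hGQ k)).trans (le_of_eq (by ring))
    _ ≤ 2 ^ Q * C * ((B ^ (Q - 2) * D * ENNReal.ofReal ((L ^ 2)⁻¹)) *
        (C * e ^ (2 * Q - 3))) := by
        rw [ENNReal.tsum_mul_left]
        gcongr
        -- This half of the statement does not involve the sequence, so any one may be supplied.
        exact (hw fun _ => 0).2
    _ = _ := by
        rw [show 2 * Q - 3 = q - 3 by rw [hQ]; ring]
        ring

/-! ### Real interpolation of the restricted estimate with L¹ → L^∞. -/

/-- The points where `f` has size about `2^l`. -/
def dyadicLevel {Y : Type*} (f : Y → ℂ) (l : ℤ) : Set Y :=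
  {y | (2 : ℝ≥0∞) ^ (l : ℝ) < ‖f y‖ₑ ∧ ‖f y‖ₑ ≤ (2 : ℝ≥0∞) ^ ((l : ℝ) + 1)}

section levels
variable {Y : Type*} {f : Y → ℂ}

theorem pairwise_disjoint_dyadicLevel (f : Y → ℂ) :
    Pairwise (Function.onFun Disjoint (dyadicLevel f)) := by
  have key : ∀ i j, i < j → Disjoint (dyadicLevel f i) (dyadicLevel f j) := by
    intro i j hij
    rw [Set.disjoint_left]
    rintro y ⟨-, h1⟩ ⟨h2, -⟩
    have h3 : (2 : ℝ≥0∞) ^ ((i : ℝ) + 1) ≤ 2 ^ (j : ℝ) :=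
      ENNReal.rpow_le_rpow_of_exponent_le (by norm_num) (by exact_mod_cast hij)
    exact absurd (h2.trans_le h1) (not_lt.2 h3)
  intro i j hij
  rcases lt_or_gt_of_ne hij with h | h
  · exact key i j h
  · exact (key j i h).symm

theorem exists_mem_dyadicLevel {y : Y} (hy : f y ≠ 0) : ∃ l, y ∈ dyadicLevel f l := by
  obtain ⟨l, hl⟩ := exists_mem_Ioc_zpow (norm_pos_iff.2 hy) (one_lt_two)
  have conv : ∀ l : ℤ, (2 : ℝ≥0∞) ^ (l : ℝ) = ENNReal.ofReal ((2 : ℝ) ^ l) := fun l => by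
    rw [← Real.rpow_intCast, ← ENNReal.ofReal_rpow_of_pos (by norm_num)]; simp
  refine ⟨l, ?_, ?_⟩
  · rw [conv, ← ofReal_norm]
    exact (ENNReal.ofReal_lt_ofReal_iff (norm_pos_iff.2 hy)).2 hl.1
  · rw [show (l : ℝ) + 1 = ((l + 1 : ℤ) : ℝ) by push_cast; rfl, conv, ← ofReal_norm]
    exact ENNReal.ofReal_le_ofReal hl.2

theorem measurableSet_dyadicLevel [MeasurableSpace Y] (hf : Measurable f) (l : ℤ) :
    MeasurableSet (dyadicLevel f l) :=
  (measurableSet_lt measurable_const hf.enorm).inter (measurableSet_le hf.enorm measurable_const)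

/-- Chebyshev's inequality on each level, added up over the disjoint levels. It gives both the bound
for a single level and the summability over all of them. -/
theorem tsum_dyadicLevel_le [MeasurableSpace Y] (hf : Measurable f) (ν : Measure Y) {r : ℝ} (hr : 0 ≤ r) :
    ∑' l : ℤ, (2 : ℝ≥0∞) ^ (l * r) * ν (dyadicLevel f l) ≤ ∫⁻ y, ‖f y‖ₑ ^ r ∂ν := by
  calc ∑' l : ℤ, (2 : ℝ≥0∞) ^ (l * r) * ν (dyadicLevel f l)
      ≤ ∑' l : ℤ, ∫⁻ y in dyadicLevel f l, ‖f y‖ₑ ^ r ∂ν := by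
        refine ENNReal.tsum_le_tsum fun l => ?_
        rw [← setLIntegral_const]
        refine setLIntegral_mono' (measurableSet_dyadicLevel hf l) fun y hy => ?_
        rw [ENNReal.rpow_mul]
        exact ENNReal.rpow_le_rpow hy.1.le hr
    _ = ∫⁻ y in ⋃ l, dyadicLevel f l, ‖f y‖ₑ ^ r ∂ν :=
        (lintegral_iUnion (measurableSet_dyadicLevel hf) (pairwise_disjoint_dyadicLevel f) _).symm
    _ ≤ _ := setLIntegral_le_lintegral _ _

end levels

section interpolation
variable {X Y : Type*} [MeasurableSpace X] [MeasurableSpace Y]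

/-- Pointwise decomposition used in the interpolation theorem. -/
theorem exists_enorm_integral_le_tsum {ν : Measure Y} {k : Y → ℂ} (hk : Measurable k) {M r : ℝ}
    (hM0 : 0 < M) (hM : ∀ y, ‖k y‖ ≤ M) (hr : 1 < r) {f : Y → ℂ} (hf : Measurable f)
    (hfi : Integrable f ν) (hN0 : ∫⁻ y, ‖f y‖ₑ ^ r ∂ν ≠ 0) (hNt : ∫⁻ y, ‖f y‖ₑ ^ r ∂ν ≠ ⊤)
    (hT : ∫ y, k y * f y ∂ν ≠ 0) : ∃ j : ℤ,
      ‖∫ y, k y * f y ∂ν‖ₑ ≤ ENNReal.ofReal (2 * M) * 2 ^ (r - 1) *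
        ((∫⁻ y, ‖f y‖ₑ ^ r ∂ν) * 2 ^ (j * (1 - r))) ∧
      ‖∫ y, k y * f y ∂ν‖ₑ ≤ 2 * ∑' n : ℕ, ‖∫ y in dyadicLevel f (j - 1 - n), k y * f y ∂ν‖ₑ := by
  set N := ∫⁻ y, ‖f y‖ₑ ^ r ∂ν with hN
  set T := ∫ y, k y * f y ∂ν with hTdef
  have hkf : Integrable (fun y => k y * f y) ν :=
    hfi.bdd_mul hk.aestronglyMeasurable (Filter.Eventually.of_forall hM)
  have hn : 0 < N.toReal := ENNReal.toReal_pos hN0 hNt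
  have hb : (1 : ℝ) < 2 ^ (r - 1) := Real.one_lt_rpow (by norm_num) (by linarith)
  have hq : 0 < ‖T‖ / (2 * M * N.toReal) := by
    have := norm_pos_iff.2 hT
    positivity
  -- With j = -m this locates |T| between 2MN 2^(j(1-r)) and 2^(r-1) times that quantity: the
  -- truncation height 2^j is adapted to the size of the integral itself.
  obtain ⟨m, hm1, hm2⟩ := exists_mem_Ico_zpow hq hb
  have hden : 0 < 2 * M * N.toReal := by positivity
  rw [le_div_iff₀ hden] at hm1
  rw [div_lt_iff₀ hden] at hm2
  have conv : ∀ m : ℤ, ENNReal.ofReal (((2 : ℝ) ^ (r - 1)) ^ m * (2 * M * N.toReal))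
      = ENNReal.ofReal (2 * M) * (N * 2 ^ (m * (r - 1))) := by
    intro m
    have hz : ((2 : ℝ) ^ (r - 1)) ^ m = (2 : ℝ) ^ ((m : ℝ) * (r - 1)) := by
      rw [← Real.rpow_intCast, ← Real.rpow_mul (by norm_num), mul_comm]
    rw [hz, ENNReal.ofReal_mul (by positivity), ENNReal.ofReal_mul (by positivity),
      ENNReal.ofReal_toReal hNt, ← ENNReal.ofReal_rpow_of_pos (by norm_num)]
    simp only [ENNReal.ofReal_ofNat]
    ring
  have hm1' := ENNReal.ofReal_le_ofReal hm1
  have hm2' := ENNReal.ofReal_le_ofReal hm2.le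
  rw [conv, ofReal_norm] at hm1' hm2'
  refine ⟨-m, ?_, ?_⟩
  · refine hm2'.trans (le_of_eq ?_)
    rw [show (((m + 1 : ℤ) : ℝ) * (r - 1)) = ((-m : ℤ) : ℝ) * (1 - r) + (r - 1) by push_cast; ring,
      ENNReal.two_rpow_add]
    ring
  · set j : ℤ := -m with hj
    have hjm : (m : ℝ) * (r - 1) = j * (1 - r) := by rw [hj]; push_cast; ring
    rw [hjm] at hm1'
    set S : Set Y := {y | ‖f y‖ₑ ≤ 2 ^ (j : ℝ)} with hS
    have hSm : MeasurableSet S := measurableSet_le hf.enorm measurable_const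
    have hsplit : (∫ y in S, k y * f y ∂ν) + ∫ y in Sᶜ, k y * f y ∂ν = T :=
      integral_add_compl hSm hkf
    -- Where |f| > 2^j one has |f| ≤ 2^(j(1-r))|f|^r, so the large part of f contributes at most M N
    -- 2^(j(1-r)), no more than half of |T|. The small part must carry the other half.
    have hlarge : 2 * ‖∫ y in Sᶜ, k y * f y ∂ν‖ₑ ≤ ‖T‖ₑ := by
      refine le_trans ?_ hm1'
      have h1 : ‖∫ y in Sᶜ, k y * f y ∂ν‖ₑ
          ≤ ENNReal.ofReal M * (2 ^ (j * (1 - r)) * N) := by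
        refine (enorm_integral_le_lintegral_enorm _).trans ?_
        calc ∫⁻ y in Sᶜ, ‖k y * f y‖ₑ ∂ν
            ≤ ∫⁻ y in Sᶜ, ENNReal.ofReal M * (2 ^ (j * (1 - r)) * ‖f y‖ₑ ^ r) ∂ν := by
              refine setLIntegral_mono' hSm.compl fun y hy => ?_
              rw [enorm_mul]
              gcongr
              · rw [← ofReal_norm]; exact ENNReal.ofReal_le_ofReal (hM y)
              · have hlt : (2 : ℝ≥0∞) ^ (j : ℝ) < ‖f y‖ₑ := not_le.1 hy
                have h0 : ‖f y‖ₑ ≠ 0 := (pos_of_gt hlt).ne'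
                have e1 : ‖f y‖ₑ = ‖f y‖ₑ ^ (1 - r) * ‖f y‖ₑ ^ r := by
                  rw [← ENNReal.rpow_add _ _ h0 enorm_ne_top, sub_add_cancel, ENNReal.rpow_one]
                conv_lhs => rw [e1]
                gcongr
                rw [ENNReal.rpow_mul, show 1 - r = -(r - 1) by ring, ENNReal.rpow_neg,
                  ENNReal.rpow_neg, ENNReal.inv_le_inv]
                exact ENNReal.rpow_le_rpow hlt.le (by linarith)
          _ ≤ ∫⁻ y, ENNReal.ofReal M * (2 ^ (j * (1 - r)) * ‖f y‖ₑ ^ r) ∂ν :=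
              setLIntegral_le_lintegral _ _
          _ = _ := by
              rw [lintegral_const_mul _ (by fun_prop), lintegral_const_mul _ (by fun_prop)]
      calc 2 * ‖∫ y in Sᶜ, k y * f y ∂ν‖ₑ
          ≤ 2 * (ENNReal.ofReal M * (2 ^ (j * (1 - r)) * N)) := by gcongr
        _ = _ := by
            rw [ENNReal.ofReal_mul (by norm_num)]
            simp only [ENNReal.ofReal_ofNat]; ring
    have hsmall : ‖∫ y in S, k y * f y ∂ν‖ₑ
        ≤ ∑' n : ℕ, ‖∫ y in dyadicLevel f (j - 1 - n), k y * f y ∂ν‖ₑ := by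
      have hsub : (⋃ n : ℕ, dyadicLevel f (j - 1 - n)) ⊆ S := by
        intro y hy
        obtain ⟨n, hn⟩ := Set.mem_iUnion.1 hy
        refine hn.2.trans (ENNReal.rpow_le_rpow_of_exponent_le (by norm_num) ?_)
        push_cast
        have : (0:ℝ) ≤ n := Nat.cast_nonneg n
        linarith
      have h1 : ∫ y in S, k y * f y ∂ν
          = ∫ y in ⋃ n : ℕ, dyadicLevel f (j - 1 - n), k y * f y ∂ν := by
        refine setIntegral_eq_of_subset_of_forall_sdiff_eq_zero hSm hsub fun y hy => ?_
        by_contra h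
        obtain ⟨l, hl⟩ := exists_mem_dyadicLevel (right_ne_zero_of_mul h)
        apply hy.2
        have hlj : l < j := by
          by_contra! hjl
          have h2 : (2 : ℝ≥0∞) ^ (j : ℝ) ≤ 2 ^ (l : ℝ) :=
            ENNReal.rpow_le_rpow_of_exponent_le (by norm_num) (by exact_mod_cast hjl)
          have h3 : ‖f y‖ₑ ≤ 2 ^ (j : ℝ) := hy.1
          exact absurd (hl.1.trans_le (h3.trans h2)) (lt_irrefl _)
        refine Set.mem_iUnion.2 ⟨(j - 1 - l).toNat, ?_⟩
        rw [Int.toNat_of_nonneg (by omega), show j - 1 - (j - 1 - l) = l by ring]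
        exact hl
      rw [h1, integral_iUnion (fun n => measurableSet_dyadicLevel hf _) ?_ hkf.integrableOn]
      · exact enorm_tsum_le_tsum_enorm
      · intro a b hab
        exact pairwise_disjoint_dyadicLevel f (by simpa using hab)
    have h3 : ‖T‖ₑ ≤ ‖∫ y in S, k y * f y ∂ν‖ₑ + ‖∫ y in Sᶜ, k y * f y ∂ν‖ₑ := by
      rw [← hsplit]; exact enorm_add_le _ _
    have h4 : ‖T‖ₑ + ‖T‖ₑ ≤ 2 * ‖∫ y in S, k y * f y ∂ν‖ₑ + ‖T‖ₑ := by
      calc ‖T‖ₑ + ‖T‖ₑ ≤ 2 * (‖∫ y in S, k y * f y ∂ν‖ₑ + ‖∫ y in Sᶜ, k y * f y ∂ν‖ₑ) := by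
            rw [← two_mul]; gcongr
        _ = 2 * ‖∫ y in S, k y * f y ∂ν‖ₑ + 2 * ‖∫ y in Sᶜ, k y * f y ∂ν‖ₑ := mul_add _ _ _
        _ ≤ _ := by gcongr
    refine ((ENNReal.add_le_add_iff_right enorm_ne_top).1 h4).trans ?_
    gcongr

/-- After division by 2^(l+1) the piece of f on its level is dominated by the indicator of the
level, so the restricted estimate applies. -/
theorem lintegral_dyadicLevel_le {μ : Measure X} {ν : Measure Y} {k : X → Y → ℂ} {A : ℝ≥0∞}
    {q₀ : ℝ} (hq₀ : 0 < q₀)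
    (hE : ∀ E : Set Y, MeasurableSet E → ∀ f : Y → ℂ, Measurable f →
        (∀ y, ‖f y‖ ≤ E.indicator (fun _ => (1 : ℝ)) y) →
        ∫⁻ x, ‖∫ y, k x y * f y ∂ν‖ₑ ^ q₀ ∂μ ≤ A * ν E ^ (q₀ - 3))
    {f : Y → ℂ} (hf : Measurable f) (l : ℤ) :
    ∫⁻ x, ‖∫ y in dyadicLevel f l, k x y * f y ∂ν‖ₑ ^ q₀ ∂μ
      ≤ 2 ^ ((l + 1) * q₀) * (A * ν (dyadicLevel f l) ^ (q₀ - 3)) := by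
  have hEl := measurableSet_dyadicLevel hf l
  set c : ℝ := (2 : ℝ) ^ ((l : ℝ) + 1) with hc
  have hc0 : 0 < c := by positivity
  have hce : ENNReal.ofReal c = (2 : ℝ≥0∞) ^ ((l : ℝ) + 1) := by
    rw [hc, ← ENNReal.ofReal_rpow_of_pos (by norm_num)]; simp
  have hcn : ((c : ℝ) : ℂ) ≠ 0 := by exact_mod_cast hc0.ne'
  have h := hE _ hEl (fun y => (dyadicLevel f l).indicator (fun y => (c : ℂ)⁻¹ * f y) y)
    ((measurable_const.mul hf).indicator hEl) (fun y => by
      by_cases hy : y ∈ dyadicLevel f l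
      · simp only [Set.indicator_of_mem hy, norm_mul, norm_inv, Complex.norm_real,
          Real.norm_eq_abs, abs_of_pos hc0]
        rw [inv_mul_le_iff₀ hc0, mul_one]
        have := hy.2
        rw [← hce, ← ofReal_norm] at this
        exact (ENNReal.ofReal_le_ofReal_iff hc0.le).1 this
      · simp [Set.indicator_of_notMem hy])
  refine le_trans (le_of_eq ?_) (mul_le_mul_right h _)
  rw [← lintegral_const_mul' _ _ (ENNReal.two_rpow_ne_top _)]
  refine lintegral_congr fun x => ?_
  have e1 : ∀ y, k x y * (dyadicLevel f l).indicator (fun y => (c : ℂ)⁻¹ * f y) y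
      = (dyadicLevel f l).indicator (fun y => (c : ℂ)⁻¹ * (k x y * f y)) y := fun y => by
    by_cases hy : y ∈ dyadicLevel f l
    · simp only [Set.indicator_of_mem hy]; ring
    · simp [Set.indicator_of_notMem hy]
  simp_rw [e1]
  rw [integral_indicator hEl, integral_const_mul, ENNReal.rpow_mul, ← hce,
    ← ENNReal.mul_rpow_of_nonneg _ _ hq₀.le, enorm_mul, ← mul_assoc]
  have e2 : ENNReal.ofReal c * ‖(c : ℂ)⁻¹‖ₑ = 1 := by
    rw [← ofReal_norm, ← ENNReal.ofReal_mul hc0.le, norm_inv, Complex.norm_real,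
      Real.norm_eq_abs, abs_of_pos hc0, mul_inv_cancel₀ hc0.ne', ENNReal.ofReal_one]
  rw [e2, one_mul]

/-- Interpolation between a restricted strong type estimate on the line `3/q + 1/r = 1` and the
trivial estimate from `L¹` to `L^∞`. -/
theorem exists_strong_type {M q₀ q : ℝ} (hM0 : 0 < M) (hq₀ : 4 < q₀) (hq : q₀ < q) :
    ∃ C : ℝ≥0∞, C ≠ ⊤ ∧ ∀ (μ : Measure X) (ν : Measure Y) [SFinite ν] (k : X → Y → ℂ) (A : ℝ≥0∞),
      Measurable (Function.uncurry k) → (∀ x y, ‖k x y‖ ≤ M) →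
      (∀ E : Set Y, MeasurableSet E → ∀ f : Y → ℂ, Measurable f →
        (∀ y, ‖f y‖ ≤ E.indicator (fun _ => (1 : ℝ)) y) →
        ∫⁻ x, ‖∫ y, k x y * f y ∂ν‖ₑ ^ q₀ ∂μ ≤ A * ν E ^ (q₀ - 3)) →
      ∀ f : Y → ℂ, Measurable f → Integrable f ν →
        ∫⁻ y, ‖f y‖ₑ ^ (q / (q - 3)) ∂ν ≠ ⊤ →
        ∫⁻ x, ‖∫ y, k x y * f y ∂ν‖ₑ ^ q ∂μ
          ≤ C * A * (∫⁻ y, ‖f y‖ₑ ^ (q / (q - 3)) ∂ν) ^ (q - 3) := by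
  set r := q / (q - 3) with hr
  have hq3 : 0 < q - 3 := by linarith
  have hr1 : 1 < r := by rw [hr, lt_div_iff₀ hq3]; linarith
  have hrq : r * (q - 3) = q := by rw [hr]; field_simp
  -- The level n steps below the truncation height gains 2^(-2κn). Half of this gain pays for the
  -- weighted summation in n and half remains for convergence.
  set κ : ℝ := (r - 1) * (q - q₀) / 2 with hκ
  have hκ0 : 0 < κ := by
    have : 0 < r - 1 := by linarith
    have : 0 < q - q₀ := by linarith
    positivity
  set η : ℝ := κ / q₀ with hη
  have hη0 : 0 < η := by positivity
  set S1 : ℝ≥0∞ := ∑' n : ℕ, (2 : ℝ≥0∞) ^ (-η * n) with hS1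
  set S2 : ℝ≥0∞ := ∑' n : ℕ, (2 : ℝ≥0∞) ^ (-κ * n) with hS2
  have hS1t : S1 ≠ ⊤ := (ENNReal.tsum_two_rpow_neg_lt_top hη0).ne
  have hS2t : S2 ≠ ⊤ := (ENNReal.tsum_two_rpow_neg_lt_top hκ0).ne
  set B : ℝ≥0∞ := ENNReal.ofReal (2 * M) * 2 ^ (r - 1) with hB
  have hBt : B ≠ ⊤ := ENNReal.mul_ne_top ENNReal.ofReal_ne_top (ENNReal.two_rpow_ne_top _)
  refine ⟨B ^ (q - q₀) * 2 ^ q₀ * S1 ^ q₀ * 2 ^ ((1 - r) * (q - q₀) + q₀) * S2, ?_, ?_⟩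
  · refine ENNReal.mul_ne_top (ENNReal.mul_ne_top (ENNReal.mul_ne_top (ENNReal.mul_ne_top ?_ ?_)
      ?_) ?_) hS2t
    · exact (ENNReal.rpow_lt_top_of_nonneg (by linarith) hBt).ne
    · exact ENNReal.two_rpow_ne_top _
    · exact (ENNReal.rpow_lt_top_of_nonneg (by linarith) hS1t).ne
    · exact ENNReal.two_rpow_ne_top _
  intro μ ν _ k A hk hM hE f hf hfi hNt
  set N := ∫⁻ y, ‖f y‖ₑ ^ r ∂ν with hN
  rcases eq_or_ne N 0 with hN0 | hN0
  · have h0 : ∀ᵐ y ∂ν, f y = 0 := by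
      rw [hN, lintegral_eq_zero_iff (by fun_prop)] at hN0
      filter_upwards [hN0] with y hy
      have : ‖f y‖ₑ = 0 := by
        by_contra h
        have h2 : ‖f y‖ₑ ^ r ≠ 0 := (ENNReal.rpow_pos (pos_iff_ne_zero.2 h) enorm_ne_top).ne'
        exact h2 hy
      simpa using this
    have hz : ∀ x, ∫ y, k x y * f y ∂ν = 0 := fun x => by
      refine integral_eq_zero_of_ae ?_
      filter_upwards [h0] with y hy
      simp [hy]
    simp [hz, show (0:ℝ) < q by linarith]
  set u : ℤ → X → ℝ≥0∞ := fun l x => ‖∫ y in dyadicLevel f l, k x y * f y ∂ν‖ₑ with hu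
  have hum : ∀ l, Measurable (u l) := fun l => by
    have : StronglyMeasurable (Function.uncurry fun x y => k x y * f y) :=
      (hk.mul (hf.comp measurable_snd)).stronglyMeasurable
    exact this.integral_prod_right.measurable.enorm
  have hq0 : 0 < q₀ := by linarith
  have hqq : 0 ≤ q - q₀ := by linarith
  have hexp : ∀ n : ℕ, ((2 : ℝ≥0∞) ^ (-η * n)) ^ (-q₀) = 2 ^ (κ * n) := fun n => by
    rw [← ENNReal.rpow_mul]
    congr 1
    rw [hη]; field_simp
  set D : ℝ≥0∞ := B ^ (q - q₀) * 2 ^ q₀ * S1 ^ q₀ with hD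
  -- |T|^q is split as |T|^(q-q₀)|T|^q₀, with the size bound for the first factor and the level
  -- decomposition for the second. The index j depends on x; summing over all j removes that
  -- dependence.
  have hpt : ∀ x, ‖∫ y, k x y * f y ∂ν‖ₑ ^ q ≤ D * ∑' j : ℤ, ∑' n : ℕ,
      (N * 2 ^ (j * (1 - r))) ^ (q - q₀) * (2 ^ (κ * n) * u (j - 1 - n) x ^ q₀) := by
    intro x
    rcases eq_or_ne (∫ y, k x y * f y ∂ν) 0 with h0 | h0
    · simp [h0, show (0:ℝ) < q by linarith]
    obtain ⟨j, h1, h2⟩ := exists_enorm_integral_le_tsum (hk.of_uncurry_left (x := x)) hM0 (hM x)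
      hr1 hf hfi hN0 hNt h0
    have h3 := ENNReal.tsum_rpow_le hq0 (fun n : ℕ => u (j - 1 - n) x)
      (fun n : ℕ => (2 : ℝ≥0∞) ^ (-η * n)) (fun _ => ENNReal.two_rpow_ne_zero _)
      (fun _ => ENNReal.two_rpow_ne_top _)
    simp_rw [hexp] at h3
    have h4 : ‖∫ y, k x y * f y ∂ν‖ₑ ^ q
        ≤ (B * (N * 2 ^ (j * (1 - r)))) ^ (q - q₀) *
          (2 * ∑' n : ℕ, u (j - 1 - n) x) ^ q₀ := by
      conv_lhs => rw [show q = (q - q₀) + q₀ by ring,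
        ENNReal.rpow_add_of_nonneg _ _ hqq hq0.le]
      exact mul_le_mul' (ENNReal.rpow_le_rpow h1 hqq) (ENNReal.rpow_le_rpow h2 hq0.le)
    refine h4.trans ?_
    rw [ENNReal.mul_rpow_of_nonneg _ _ hqq, ENNReal.mul_rpow_of_nonneg _ _ hq0.le]
    calc _ ≤ B ^ (q - q₀) * (N * 2 ^ (j * (1 - r))) ^ (q - q₀) * (2 ^ q₀ *
          (S1 ^ q₀ * ∑' n : ℕ, 2 ^ (κ * n) * u (j - 1 - n) x ^ q₀)) := by gcongr
      _ = D * ∑' n : ℕ, (N * 2 ^ (j * (1 - r))) ^ (q - q₀) *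
          (2 ^ (κ * n) * u (j - 1 - n) x ^ q₀) := by
          rw [ENNReal.tsum_mul_left, hD]; ring
      _ ≤ _ := by
          gcongr
          exact ENNReal.le_tsum (f := fun j : ℤ => ∑' n : ℕ, (N * 2 ^ (j * (1 - r))) ^ (q - q₀) *
            (2 ^ (κ * n) * u (j - 1 - n) x ^ q₀)) j
  have hint : ∫⁻ x, ‖∫ y, k x y * f y ∂ν‖ₑ ^ q ∂μ ≤ D * ∑' j : ℤ, ∑' n : ℕ,
      (N * 2 ^ (j * (1 - r))) ^ (q - q₀) * (2 ^ (κ * n) * ∫⁻ x, u (j - 1 - n) x ^ q₀ ∂μ) := by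
    have hm : ∀ (j : ℤ) (n : ℕ), Measurable fun x =>
        (N * 2 ^ (j * (1 - r))) ^ (q - q₀) * (2 ^ (κ * n) * u (j - 1 - n) x ^ q₀) :=
      fun j n => (((hum _).pow_const _).const_mul _).const_mul _
    refine (lintegral_mono hpt).trans (le_of_eq ?_)
    rw [lintegral_const_mul _ (Measurable.tsum fun j => Measurable.tsum fun n => hm j n),
      lintegral_tsum fun j => (Measurable.tsum fun n => hm j n).aemeasurable]
    congr 1
    refine tsum_congr fun j => ?_
    rw [lintegral_tsum fun n => (hm j n).aemeasurable]
    refine tsum_congr fun n => ?_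
    rw [lintegral_const_mul _ (((hum _).pow_const _).const_mul _),
      lintegral_const_mul _ ((hum _).pow_const _)]
  -- Chebyshev is used for q₀ - 4 of the q₀ - 3 powers; the last one is kept so that the levels can
  -- be summed against N.
  have hν : ∀ l : ℤ, ν (dyadicLevel f l) ^ (q₀ - 3)
      ≤ N ^ (q₀ - 4) * 2 ^ (-l * r * (q₀ - 4)) * ν (dyadicLevel f l) := by
    intro l
    have h1 : ν (dyadicLevel f l) ≤ N * 2 ^ (-l * r) := by
      have := (ENNReal.le_tsum l).trans (tsum_dyadicLevel_le hf ν (by linarith : 0 ≤ r))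
      rw [neg_mul, ENNReal.rpow_neg, ← div_eq_mul_inv, ENNReal.le_div_iff_mul_le
        (Or.inl (ENNReal.two_rpow_ne_zero _)) (Or.inl (ENNReal.two_rpow_ne_top _)), mul_comm]
      exact this
    have h2 : ν (dyadicLevel f l) ^ (q₀ - 3)
        = ν (dyadicLevel f l) ^ (q₀ - 4) * ν (dyadicLevel f l) := by
      conv_rhs => rw [← ENNReal.rpow_one (ν (dyadicLevel f l)), ← ENNReal.rpow_mul,
        ← ENNReal.rpow_add_of_nonneg _ _ (by linarith) zero_le_one]
      congr 1; ring
    rw [h2, ENNReal.rpow_mul, ← ENNReal.mul_rpow_of_nonneg _ _ (by linarith : 0 ≤ q₀ - 4)]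
    gcongr
  have hterm : ∀ (l : ℤ) (n : ℕ),
      (N * 2 ^ (((l + 1 + n : ℤ) : ℝ) * (1 - r))) ^ (q - q₀) *
        (2 ^ (κ * n) * ∫⁻ x, u (l + 1 + n - 1 - n) x ^ q₀ ∂μ)
      ≤ A * N ^ (q - 4) * 2 ^ ((1 - r) * (q - q₀) + q₀) * (2 ^ (-κ * n) *
        (2 ^ (l * r) * ν (dyadicLevel f l))) := by
    intro l n
    have h1 : ∫⁻ x, u (l + 1 + n - 1 - n) x ^ q₀ ∂μ
        ≤ 2 ^ ((l + 1) * q₀) * (A * (N ^ (q₀ - 4) * 2 ^ (-l * r * (q₀ - 4)) *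
          ν (dyadicLevel f l))) := by
      rw [show l + 1 + (n : ℤ) - 1 - n = l by ring]
      refine (lintegral_dyadicLevel_le hq0 hE hf l).trans ?_
      gcongr
      exact hν l
    refine (mul_le_mul' le_rfl (mul_le_mul' le_rfl h1)).trans (le_of_eq ?_)
    rw [ENNReal.mul_rpow_of_nonneg _ _ hqq, ← ENNReal.rpow_mul]
    have e1 : N ^ (q - 4) = N ^ (q - q₀) * N ^ (q₀ - 4) := by
      rw [← ENNReal.rpow_add_of_nonneg _ _ hqq (by linarith)]; congr 1; ring
    have e2 : (2 : ℝ≥0∞) ^ (((l + 1 + n : ℤ) : ℝ) * (1 - r) * (q - q₀)) * 2 ^ (κ * n) *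
        2 ^ ((l + 1) * q₀) * 2 ^ (-l * r * (q₀ - 4))
        = 2 ^ ((1 - r) * (q - q₀) + q₀) * 2 ^ (-κ * n) * 2 ^ (l * r) := by
      simp only [← ENNReal.two_rpow_add]
      congr 1
      push_cast
      -- The relation 3/q + 1/r = 1 cleared of denominators; it leaves exactly 2^(l r), the weight
      -- in the level sum.
      have e3 : r * q = q + 3 * r := by linarith
      have e4 : (l : ℝ) * (r * q) = l * (q + 3 * r) := by rw [e3]
      rw [hκ]
      linear_combination (-1 : ℝ) * e4
    rw [e1]
    calc _ = ((2 : ℝ≥0∞) ^ (((l + 1 + n : ℤ) : ℝ) * (1 - r) * (q - q₀)) * 2 ^ (κ * n) *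
        2 ^ ((l + 1) * q₀) * 2 ^ (-l * r * (q₀ - 4))) * (A * N ^ (q - q₀) * N ^ (q₀ - 4) *
          ν (dyadicLevel f l)) := by ring
      _ = _ := by rw [e2]; ring
  have hsum : ∑' j : ℤ, ∑' n : ℕ,
      (N * 2 ^ (j * (1 - r))) ^ (q - q₀) * (2 ^ (κ * n) * ∫⁻ x, u (j - 1 - n) x ^ q₀ ∂μ)
      ≤ A * N ^ (q - 4) * 2 ^ ((1 - r) * (q - q₀) + q₀) * (S2 * N) := by
    rw [ENNReal.tsum_comm]
    have hn : ∀ n : ℕ, ∑' j : ℤ, (N * 2 ^ (j * (1 - r))) ^ (q - q₀) *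
        (2 ^ (κ * n) * ∫⁻ x, u (j - 1 - n) x ^ q₀ ∂μ)
        ≤ A * N ^ (q - 4) * 2 ^ ((1 - r) * (q - q₀) + q₀) * (2 ^ (-κ * n) * N) := by
      intro n
      rw [← (Equiv.addRight (1 + (n : ℤ))).tsum_eq]
      simp only [Equiv.coe_addRight, ← add_assoc]
      refine (ENNReal.tsum_le_tsum fun l => hterm l n).trans ?_
      rw [ENNReal.tsum_mul_left, ENNReal.tsum_mul_left]
      gcongr
      exact tsum_dyadicLevel_le hf ν (by linarith)
    refine (ENNReal.tsum_le_tsum hn).trans (le_of_eq ?_)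
    rw [ENNReal.tsum_mul_left, ENNReal.tsum_mul_right]
  refine hint.trans ((mul_le_mul' le_rfl hsum).trans (le_of_eq ?_))
  have e1 : N ^ (q - 3) = N ^ (q - 4) * N := by
    conv_rhs => rw [← ENNReal.rpow_one N, ← ENNReal.rpow_mul,
      ← ENNReal.rpow_add_of_nonneg _ _ (by linarith) zero_le_one]
    congr 1; ring
  rw [e1]; ring

end interpolation

/-! ### Jensen, Hölder and integration over slices. -/

section holder
variable {X T : Type*} [MeasurableSpace X] [MeasurableSpace T]

theorem integrable_of_lintegral_rpow_ne_top {ν : Measure T} [IsFiniteMeasure ν] {r : ℝ}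
    (hr : 1 ≤ r) {f : T → ℂ} (hf : AEStronglyMeasurable f ν) (hN : ∫⁻ y, ‖f y‖ₑ ^ r ∂ν ≠ ⊤) :
    Integrable f ν := by
  have h0 : 0 < r := by linarith
  have : MemLp f (ENNReal.ofReal r) ν := by
    refine ⟨hf, (eLpNorm_lt_top_iff_lintegral_rpow_enorm_lt_top ?_ ENNReal.ofReal_ne_top).2 ?_⟩
    · simpa using h0
    · rw [ENNReal.toReal_ofReal h0.le]; exact hN.lt_top
  exact this.integrable (by simpa using ENNReal.ofReal_le_ofReal hr)

/-- Jensen's inequality for powers. -/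
theorem lintegral_rpow_le_measure_univ_mul (ν : Measure T) {Q : ℝ} (hQ : 1 ≤ Q) {F : T → ℝ≥0∞}
    (hF : AEMeasurable F ν) :
    (∫⁻ t, F t ∂ν) ^ Q ≤ ν Set.univ ^ (Q - 1) * ∫⁻ t, F t ^ Q ∂ν := by
  have hQ0 : 0 < Q := by linarith
  have h := ENNReal.lintegral_mul_norm_pow_le (μ := ν) (hF.pow_const Q)
    (aemeasurable_const (b := (1 : ℝ≥0∞))) (p := 1 / Q) (q := 1 - 1 / Q) (by positivity)
    (by rw [sub_nonneg, div_le_one hQ0]; exact hQ) (by ring)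
  simp only [ENNReal.one_rpow, mul_one, ← ENNReal.rpow_mul, mul_one_div_cancel hQ0.ne',
    ENNReal.rpow_one, lintegral_const, one_mul] at h
  refine (ENNReal.rpow_le_rpow h hQ0.le).trans (le_of_eq ?_)
  rw [ENNReal.mul_rpow_of_nonneg _ _ hQ0.le, ← ENNReal.rpow_mul, ← ENNReal.rpow_mul,
    one_div_mul_cancel hQ0.ne', ENNReal.rpow_one, mul_comm]
  congr 2
  field_simp

/-- Summation of slices with weights given by the slices of the right-hand side. -/
theorem lintegral_slices_le {μ : Measure X} {ν : Measure T} [SFinite μ] [SFinite ν]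
    {p q : ℝ} (hp : 1 < p) (hpq : p ≤ q) {h : X → T → ℝ≥0∞} (hh : Measurable (Function.uncurry h))
    {w : T → ℝ≥0∞} (hw : Measurable w) (hwt : ∀ᵐ t ∂ν, w t ≠ ⊤) {A : ℝ≥0∞}
    (h0 : ∀ t x, w t = 0 → h x t = 0)
    (hA : ∀ᵐ t ∂ν, ∫⁻ x, h x t ^ q ∂μ ≤ A * w t ^ p) :
    ∫⁻ x, (∫⁻ t, h x t ∂ν) ^ q ∂μ ≤ A * ν Set.univ ^ (q - p) * (∫⁻ t, w t ∂ν) ^ p := by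
  have hq0 : 0 < q := by linarith
  have hq1 : 0 < q - 1 := by linarith
  have hp1 : 0 < p - 1 := by linarith
  -- Hölder applied to h = (h^q w^(1-p))^(1/q) · (w^θ)^(1-1/q); this θ makes the powers of w cancel.
  -- It plays the role of Minkowski's integral inequality, and θ ≤ 1 lets Jensen bound the integral
  -- of w^θ.
  set θ := (p - 1) / (q - 1) with hθ
  have hθ0 : 0 < θ := by positivity
  have hhx : ∀ x, Measurable (h x) := fun x => hh.of_uncurry_left
  have hwθ : (∫⁻ t, w t ^ θ ∂ν) ^ (q - 1) ≤ ν Set.univ ^ (q - p) * (∫⁻ t, w t ∂ν) ^ (p - 1) := by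
    have hQ : 1 ≤ 1 / θ := by
      rw [hθ, one_div_div, one_le_div hp1]; linarith
    have := ENNReal.rpow_le_rpow (lintegral_rpow_le_measure_univ_mul ν hQ
      (hw.pow_const θ).aemeasurable) hp1.le
    simp only [← ENNReal.rpow_mul, mul_one_div_cancel hθ0.ne', ENNReal.rpow_one] at this
    rw [ENNReal.mul_rpow_of_nonneg _ _ hp1.le, ← ENNReal.rpow_mul] at this
    have e1 : 1 / θ * (p - 1) = q - 1 := by rw [hθ]; field_simp
    have e2 : (1 / θ - 1) * (p - 1) = q - p := by rw [sub_mul, e1]; ring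
    rwa [e1, e2] at this
  have hpt : ∀ x, (∫⁻ t, h x t ∂ν) ^ q
      ≤ (∫⁻ t, h x t ^ q * w t ^ (1 - p) ∂ν) * (∫⁻ t, w t ^ θ ∂ν) ^ (q - 1) := by
    intro x
    have hH := ENNReal.lintegral_mul_norm_pow_le (μ := ν)
      (f := fun t => h x t ^ q * w t ^ (1 - p)) (g := fun t => w t ^ θ)
      (((hhx x).pow_const q).mul (hw.pow_const _)).aemeasurable (hw.pow_const θ).aemeasurable
      (p := 1 / q) (q := 1 - 1 / q) (by positivity)
      (by rw [sub_nonneg, div_le_one hq0]; linarith) (by ring)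
    have h1 : ∫⁻ t, h x t ∂ν
        ≤ ∫⁻ t, (h x t ^ q * w t ^ (1 - p)) ^ (1 / q) * (w t ^ θ) ^ (1 - 1 / q) ∂ν := by
      refine lintegral_mono_ae ?_
      filter_upwards [hwt] with t ht
      rcases eq_or_ne (w t) 0 with hz | hz
      · rw [h0 t x hz]; exact zero_le
      · refine le_of_eq ?_
        rw [ENNReal.mul_rpow_of_nonneg _ _ (by positivity : (0:ℝ) ≤ 1 / q), ← ENNReal.rpow_mul,
          ← ENNReal.rpow_mul, ← ENNReal.rpow_mul, mul_one_div_cancel hq0.ne', ENNReal.rpow_one,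
          mul_assoc, ← ENNReal.rpow_add _ _ hz ht]
        have : (1 - p) * (1 / q) + θ * (1 - 1 / q) = 0 := by
          rw [hθ]; field_simp; ring
        rw [this, ENNReal.rpow_zero, mul_one]
    refine (ENNReal.rpow_le_rpow (h1.trans hH) hq0.le).trans (le_of_eq ?_)
    rw [ENNReal.mul_rpow_of_nonneg _ _ hq0.le, ← ENNReal.rpow_mul, ← ENNReal.rpow_mul,
      one_div_mul_cancel hq0.ne', ENNReal.rpow_one]
    congr 2
    field_simp
  have hm : Measurable (Function.uncurry fun x t => h x t ^ q * w t ^ (1 - p)) :=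
    (hh.pow_const q).mul ((hw.comp measurable_snd).pow_const _)
  have hswap : ∫⁻ x, ∫⁻ t, h x t ^ q * w t ^ (1 - p) ∂ν ∂μ ≤ A * ∫⁻ t, w t ∂ν := by
    rw [lintegral_lintegral_swap hm.aemeasurable]
    rw [← lintegral_const_mul _ hw]
    refine lintegral_mono_ae ?_
    filter_upwards [hwt, hA] with t ht hAt
    rw [lintegral_mul_const _ (hh.of_uncurry_right.pow_const q)]
    rcases eq_or_ne (w t) 0 with hz | hz
    · simp [h0 t _ hz, hq0]
    · calc _ ≤ A * w t ^ p * w t ^ (1 - p) := by gcongr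
        _ = A * w t := by
          rw [mul_assoc, ← ENNReal.rpow_add _ _ hz ht, add_sub_cancel, ENNReal.rpow_one]
  calc ∫⁻ x, (∫⁻ t, h x t ∂ν) ^ q ∂μ
      ≤ ∫⁻ x, (∫⁻ t, h x t ^ q * w t ^ (1 - p) ∂ν) * (∫⁻ t, w t ^ θ ∂ν) ^ (q - 1) ∂μ :=
        lintegral_mono hpt
    _ = (∫⁻ x, ∫⁻ t, h x t ^ q * w t ^ (1 - p) ∂ν ∂μ) * (∫⁻ t, w t ^ θ ∂ν) ^ (q - 1) :=
        lintegral_mul_const _ hm.lintegral_prod_right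
    _ ≤ (A * ∫⁻ t, w t ∂ν) * (ν Set.univ ^ (q - p) * (∫⁻ t, w t ∂ν) ^ (p - 1)) :=
        mul_le_mul' hswap hwθ
    _ = A * ν Set.univ ^ (q - p) * (∫⁻ t, w t ∂ν) ^ p := by
        have : (∫⁻ t, w t ∂ν) ^ p = (∫⁻ t, w t ∂ν) * (∫⁻ t, w t ∂ν) ^ (p - 1) := by
          conv_rhs => enter [1]; rw [← ENNReal.rpow_one (∫⁻ t, w t ∂ν)]
          rw [← ENNReal.rpow_add_of_nonneg _ _ zero_le_one hp1.le]; congr 1; ring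
        rw [this]; ring

end holder

/-! ### From lines to small squares and to the whole plane. -/

/-- The kernel `e^{iL|x-y|} ψ(x-y)` on `ℝ × ℝ`. -/
noncomputable def planeKernel (L : ℝ) (ψ : ℝ × ℝ → ℂ) (x y : ℝ × ℝ) : ℂ :=
  Complex.exp (Complex.I * L * (hyp (x.1 - y.1) (x.2 - y.2) : ℝ)) * ψ (x - y)

theorem norm_planeKernel (L : ℝ) (ψ : ℝ × ℝ → ℂ) (x y : ℝ × ℝ) :
    ‖planeKernel L ψ x y‖ = ‖ψ (x - y)‖ := by
  rw [planeKernel, norm_mul, norm_exp_I_mul_mul, one_mul]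

theorem continuous_planeKernel {L : ℝ} {ψ : ℝ × ℝ → ℂ} (hψ : Continuous ψ) :
    Continuous fun v : (ℝ × ℝ) × (ℝ × ℝ) => planeKernel L ψ v.1 v.2 :=
  (continuous_lineKernel hψ).comp
    (f := fun v : (ℝ × ℝ) × (ℝ × ℝ) => ((v.1.1, v.1.2 - v.2.2), v.2.1)) (by fun_prop)

theorem planeKernel_sub_sub (L : ℝ) (ψ : ℝ × ℝ → ℂ) (x y a : ℝ × ℝ) :
    planeKernel L ψ (x - a) (y - a) = planeKernel L ψ x y := by
  simp [planeKernel]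

/-- Strong type estimate on a line. -/
theorem exists_line_strong {ψ : ℝ × ℝ → ℂ} {c R ε K M q : ℝ} (hψ : Continuous ψ)
    (hs : SupportedOffAxis ψ c R) (hM : ∀ z, ‖ψ z‖ ≤ M) (hε : ε ≤ 1 / 2)
    (h : QuadKernelBound ψ ε K) (hK : 0 < K) (hq : 4 < q) : ∃ C : ℝ≥0∞, C ≠ ⊤ ∧
    ∀ L : ℝ, 0 < L → ∀ f : ℝ → ℂ, Measurable f →
      ∫⁻ s in Set.Icc 0 ε, ‖f s‖ₑ ^ (q / (q - 3)) ≠ ⊤ →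
      ∫⁻ x, ‖∫ s in Set.Icc 0 ε, lineKernel L ψ x s * f s‖ₑ ^ q
        ≤ C * ENNReal.ofReal ((L ^ 2)⁻¹) *
          (∫⁻ s in Set.Icc 0 ε, ‖f s‖ₑ ^ (q / (q - 3))) ^ (q - 3) := by
  -- The restricted estimate is taken at the midpoint of 4 and q, leaving room on both sides for
  -- interpolation.
  obtain ⟨C₀, hC₀, H₀⟩ := exists_line_restricted (q := (4 + q) / 2) hψ hs hM hε h hK (by linarith)
  obtain ⟨C, hC, H⟩ := exists_strong_type (X := ℝ × ℝ) (Y := ℝ) (M := max M 1) (q₀ := (4 + q) / 2)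
    (q := q) (by positivity) (by linarith) (by linarith)
  refine ⟨C * C₀, ENNReal.mul_ne_top hC hC₀, fun L hL f hf hN => ?_⟩
  have hq3 : 0 < q - 3 := by linarith
  have hr : 1 ≤ q / (q - 3) := by rw [le_div_iff₀ hq3]; linarith
  refine (H volume (volume.restrict (Set.Icc 0 ε)) (lineKernel L ψ) _
    (continuous_lineKernel hψ).measurable
    (fun x s => by rw [norm_lineKernel]; exact (hM _).trans (le_max_left _ _)) (H₀ L hL) f hf
    (integrable_of_lintegral_rpow_ne_top hr hf.aestronglyMeasurable hN) hN).trans (le_of_eq ?_)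
  ring

/-- Strong type estimate on a small square. -/
theorem exists_square_strong {ψ : ℝ × ℝ → ℂ} {c R ε K M q : ℝ} (hψ : Continuous ψ)
    (hs : SupportedOffAxis ψ c R) (hM : ∀ z, ‖ψ z‖ ≤ M) (hε : ε ≤ 1 / 2)
    (h : QuadKernelBound ψ ε K) (hK : 0 < K) (hq : 4 < q) : ∃ C : ℝ≥0∞, C ≠ ⊤ ∧
    ∀ L : ℝ, 0 < L → ∀ f : ℝ × ℝ → ℂ, Measurable f →
      ∫⁻ y in Set.Icc 0 ε ×ˢ Set.Icc 0 ε, ‖f y‖ₑ ^ (q / (q - 3)) ≠ ⊤ →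
      ∫⁻ x, ‖∫ y in Set.Icc 0 ε ×ˢ Set.Icc 0 ε, planeKernel L ψ x y * f y‖ₑ ^ q
        ≤ C * ENNReal.ofReal ((L ^ 2)⁻¹) *
          (∫⁻ y in Set.Icc 0 ε ×ˢ Set.Icc 0 ε, ‖f y‖ₑ ^ (q / (q - 3))) ^ (q - 3) := by
  obtain ⟨C, hC, H⟩ := exists_line_strong hψ hs hM hε h hK hq
  set ν : Measure ℝ := volume.restrict (Set.Icc 0 ε) with hν
  refine ⟨C * ν Set.univ ^ (q - (q - 3)), ENNReal.mul_ne_top hC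
    (ENNReal.rpow_lt_top_of_nonneg (by linarith) (measure_ne_top _ _)).ne, fun L hL f hf hN => ?_⟩
  have hq3 : 0 < q - 3 := by linarith
  set r := q / (q - 3) with hr
  have hr1 : 1 ≤ r := by rw [hr, le_div_iff₀ hq3]; linarith
  have hprod : (volume : Measure (ℝ × ℝ)).restrict (Set.Icc 0 ε ×ˢ Set.Icc 0 ε) = ν.prod ν := by
    rw [hν, Measure.prod_restrict]; rfl
  rw [hprod] at hN ⊢
  set w : ℝ → ℝ≥0∞ := fun t => ∫⁻ s, ‖f (s, t)‖ₑ ^ r ∂ν with hw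
  have hfr : Measurable fun z => ‖f z‖ₑ ^ r := hf.enorm.pow_const r
  have hNw : ∫⁻ y, ‖f y‖ₑ ^ r ∂ν.prod ν = ∫⁻ t, w t ∂ν :=
    lintegral_prod_symm _ hfr.aemeasurable
  have hwm : Measurable w := hfr.lintegral_prod_left'
  set g : (ℝ × ℝ) → ℝ → ℝ≥0∞ := fun x t =>
    ‖∫ s, lineKernel L ψ (x.1, x.2 - t) s * f (s, t) ∂ν‖ₑ with hg
  have hgm : Measurable (Function.uncurry g) := by
    have h1 : Measurable fun v : ((ℝ × ℝ) × ℝ) × ℝ =>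
        lineKernel L ψ (v.1.1.1, v.1.1.2 - v.1.2) v.2 * f (v.2, v.1.2) := by
      refine Measurable.mul ?_ (hf.comp (by fun_prop))
      exact ((continuous_lineKernel hψ).comp
        (f := fun v : ((ℝ × ℝ) × ℝ) × ℝ => ((v.1.1.1, v.1.1.2 - v.1.2), v.2))
        (by fun_prop)).measurable
    have h2 := (h1.stronglyMeasurable.integral_prod_right' (ν := ν)).measurable.enorm
    exact h2
  have hfi : Integrable f (ν.prod ν) :=
    integrable_of_lintegral_rpow_ne_top hr1 hf.aestronglyMeasurable hN
  have hle : ∀ x, ‖∫ y, planeKernel L ψ x y * f y ∂ν.prod ν‖ₑ ≤ ∫⁻ t, g x t ∂ν := by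
    intro x
    have hi : Integrable (fun y => planeKernel L ψ x y * f y) (ν.prod ν) := by
      refine hfi.bdd_mul (c := M) ?_ (Filter.Eventually.of_forall fun y => ?_)
      · exact ((continuous_planeKernel hψ).comp (f := fun y => (x, y))
          (by fun_prop)).aestronglyMeasurable
      · rw [norm_planeKernel]; exact hM _
    rw [integral_prod_symm _ hi]
    exact enorm_integral_le_lintegral_enorm _
  -- The slice at height t is the line operator with x translated by (0, t), so all slices share one
  -- constant.
  have hslice : ∀ t, w t ≠ ⊤ → ∫⁻ x, g x t ^ q
      ≤ C * ENNReal.ofReal ((L ^ 2)⁻¹) * w t ^ (q - 3) := by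
    intro t ht
    have h1 := H L hL (fun s => f (s, t)) (hf.comp (by fun_prop)) ht
    have h2 := lintegral_sub_right_eq_self (μ := (volume : Measure (ℝ × ℝ)))
      (fun x => ‖∫ s in Set.Icc 0 ε, lineKernel L ψ x s * f (s, t)‖ₑ ^ q) (0, t)
    rw [← h2] at h1
    refine le_trans (le_of_eq ?_) h1
    refine lintegral_congr fun x => ?_
    simp only [hg]
    rw [show x - (0, t) = (x.1, x.2 - t) by ext <;> simp]
  have hwt : ∀ᵐ t ∂ν, w t ≠ ⊤ := by
    rw [hNw] at hN
    filter_upwards [ae_lt_top hwm hN] with t ht using ht.ne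
  have hw0 : ∀ t x, w t = 0 → g x t = 0 := by
    intro t x ht
    have hfs : Measurable fun s => ‖f (s, t)‖ₑ ^ r := hfr.comp (by fun_prop)
    replace ht := (lintegral_eq_zero_iff hfs).1 ht
    simp only [hg]
    rw [enorm_eq_zero]
    refine integral_eq_zero_of_ae ?_
    filter_upwards [ht] with s hs
    have : ‖f (s, t)‖ₑ = 0 := by
      by_contra h
      exact (ENNReal.rpow_pos (pos_iff_ne_zero.2 h) enorm_ne_top).ne' hs
    simp only [enorm_eq_zero] at this
    simp [this]
  rw [hNw]
  calc _ ≤ ∫⁻ x, (∫⁻ t, g x t ∂ν) ^ q :=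
        lintegral_mono fun x => ENNReal.rpow_le_rpow (hle x) (by linarith)
    _ ≤ C * ENNReal.ofReal ((L ^ 2)⁻¹) * ν Set.univ ^ (q - (q - 3)) *
        (∫⁻ t, w t ∂ν) ^ (q - 3) :=
        lintegral_slices_le (by linarith) (by linarith) hgm hwm hwt hw0
          (hwt.mono fun t ht => hslice t ht)
    _ = _ := by ring

theorem integrable_mul_of_bounded_support {X : Type*} [MeasurableSpace X] {μ : Measure X}
    {k f : X → ℂ} {M r : ℝ} (hr : 1 ≤ r) {S : Set X} (hSt : μ S ≠ ⊤)
    (hk : AEStronglyMeasurable k μ) (hM : ∀ y, ‖k y‖ ≤ M) (hk0 : ∀ y ∉ S, k y = 0)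
    (hf : AEStronglyMeasurable f μ) (hN : ∫⁻ y, ‖f y‖ₑ ^ r ∂μ ≠ ⊤) :
    Integrable (fun y => k y * f y) μ := by
  have : IsFiniteMeasure (μ.restrict S) := ⟨by simpa using hSt.lt_top⟩
  have h1 : IntegrableOn f S μ := integrable_of_lintegral_rpow_ne_top hr hf.restrict
    (ne_top_of_le_ne_top hN (setLIntegral_le_lintegral _ _))
  have h2 : IntegrableOn (fun y => k y * f y) S μ :=
    Integrable.bdd_mul h1 hk.restrict (Filter.Eventually.of_forall hM)
  refine (integrableOn_iff_integrable_of_support_subset fun y hy => ?_).1 h2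
  by_contra h
  exact hy (by simp [hk0 y h])

section localisation

variable {ψ : ℝ × ℝ → ℂ} {M R L : ℝ}

theorem planeKernel_eq_zero (hR : ∀ z, ψ z ≠ 0 → ‖z‖ ≤ R) {x y : ℝ × ℝ}
    (h : y ∉ Metric.closedBall x R) : planeKernel L ψ x y = 0 := by
  rw [planeKernel, mul_eq_zero]
  right
  by_contra h0
  exact h (by rw [mem_closedBall_iff_norm']; exact hR _ h0)

theorem integrable_planeKernel_mul (hψ : Continuous ψ) (hM : ∀ z, ‖ψ z‖ ≤ M)
    (hR : ∀ z, ψ z ≠ 0 → ‖z‖ ≤ R) {r : ℝ} (hr : 1 ≤ r) {f : ℝ × ℝ → ℂ} (hf : Measurable f)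
    (hN : ∫⁻ y, ‖f y‖ₑ ^ r ≠ ⊤) (x : ℝ × ℝ) : Integrable fun y => planeKernel L ψ x y * f y :=
  integrable_mul_of_bounded_support hr (S := Metric.closedBall x R)
    (measure_closedBall_lt_top).ne
    ((continuous_planeKernel hψ).comp (f := fun y => (x, y)) (by fun_prop)).aestronglyMeasurable
    (fun y => by rw [norm_planeKernel]; exact hM _) (fun _ h => planeKernel_eq_zero hR h)
    hf.aestronglyMeasurable hN

/-- Fubini and translation invariance: averaging over all translates of Q recovers the full
integral, each point being counted with weight μ(Q). -/
theorem integral_integral_translate {G : Type*} [AddCommGroup G] [MeasurableSpace G]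
    [MeasurableAdd₂ G] [MeasurableNeg G] {μ : Measure G} [SFinite μ] [μ.IsAddLeftInvariant]
    {Q : Set G} (hQ : μ Q ≠ ⊤) {g : G → ℂ} (hg : Integrable g μ) (hgm : Measurable g) :
    ∫ a, ∫ y in Q, g (y + a) ∂μ ∂μ = (μ Q).toReal • ∫ y, g y ∂μ := by
  have : IsFiniteMeasure (μ.restrict Q) := ⟨by simpa using hQ.lt_top⟩
  have hi : Integrable (Function.uncurry fun a y => g (y + a)) (μ.prod (μ.restrict Q)) := by
    rw [integrable_prod_iff']
    · refine ⟨Filter.Eventually.of_forall fun y => hg.comp_add_left y, ?_⟩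
      simp only [Function.uncurry]
      simp_rw [integral_add_left_eq_self (fun a => ‖g a‖)]
      exact integrable_const _
    · exact (hgm.comp (by fun_prop)).aestronglyMeasurable
  rw [integral_integral_swap hi]
  simp_rw [integral_add_left_eq_self g]
  simp [Measure.real]

/-- Passing from functions supported in a small square to arbitrary ones. -/
theorem lintegral_planeKernel_le_of_square (hψ : Continuous ψ) (hM : ∀ z, ‖ψ z‖ ≤ M)
    (hR : ∀ z, ψ z ≠ 0 → ‖z‖ ≤ R) {ε : ℝ} (hε0 : 0 < ε) (hε : ε ≤ 1) {q r p : ℝ} (hr : 1 ≤ r)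
    (hq : 1 ≤ q) (hp : 1 ≤ p) {A : ℝ≥0∞}
    (H : ∀ f : ℝ × ℝ → ℂ, Measurable f →
      ∫⁻ y in Set.Icc 0 ε ×ˢ Set.Icc 0 ε, ‖f y‖ₑ ^ r ≠ ⊤ →
      ∫⁻ x, ‖∫ y in Set.Icc 0 ε ×ˢ Set.Icc 0 ε, planeKernel L ψ x y * f y‖ₑ ^ q
        ≤ A * (∫⁻ y in Set.Icc 0 ε ×ˢ Set.Icc 0 ε, ‖f y‖ₑ ^ r) ^ p)
    {f : ℝ × ℝ → ℂ} (hf : Measurable f) (hN : ∫⁻ y, ‖f y‖ₑ ^ r ≠ ⊤) :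
    ∫⁻ x, ‖∫ y, planeKernel L ψ x y * f y‖ₑ ^ q
      ≤ (volume (Set.Icc (0 : ℝ) ε ×ˢ Set.Icc (0 : ℝ) ε)) ^ (-q) *
        volume (Metric.closedBall (0 : ℝ × ℝ) (R + 1)) ^ (q - 1) *
        (volume (Set.Icc (0 : ℝ) ε ×ˢ Set.Icc (0 : ℝ) ε)) * A * (∫⁻ y, ‖f y‖ₑ ^ r) ^ p := by
  set Q : Set (ℝ × ℝ) := Set.Icc 0 ε ×ˢ Set.Icc 0 ε with hQ
  have hQm : volume Q = ENNReal.ofReal ε * ENNReal.ofReal ε := by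
    rw [hQ, Measure.volume_eq_prod, Measure.prod_prod]; simp
  have hQ0 : volume Q ≠ 0 := by rw [hQm]; simp [hε0]
  have hQt : volume Q ≠ ⊤ := by rw [hQm]; exact ENNReal.mul_ne_top (by simp) (by simp)
  have hq0 : 0 < q := by linarith
  set V := volume (Metric.closedBall (0 : ℝ × ℝ) (R + 1)) with hV
  set N := ∫⁻ y, ‖f y‖ₑ ^ r with hNdef
  set F : ℝ × ℝ → ℝ × ℝ → ℝ≥0∞ := fun x a =>
    ‖∫ y in Q, planeKernel L ψ x (y + a) * f (y + a)‖ₑ with hF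
  have hFm : Measurable (Function.uncurry F) := by
    have h1 : Measurable fun v : ((ℝ × ℝ) × (ℝ × ℝ)) × (ℝ × ℝ) =>
        planeKernel L ψ v.1.1 (v.2 + v.1.2) * f (v.2 + v.1.2) := by
      refine Measurable.mul ?_ (hf.comp (by fun_prop))
      exact ((continuous_planeKernel hψ).comp
        (f := fun v : ((ℝ × ℝ) × (ℝ × ℝ)) × (ℝ × ℝ) => (v.1.1, v.2 + v.1.2))
        (by fun_prop)).measurable
    exact (h1.stronglyMeasurable.integral_prod_right' (ν := volume.restrict Q)).measurable.enorm
  -- For fixed x only boundedly many translates matter, in the sense of measure; this makes Jensen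
  -- in a cost only a constant.
  have hF0 : ∀ x a, a ∉ Metric.closedBall x (R + 1) → F x a = 0 := by
    intro x a ha
    simp only [hF]
    rw [enorm_eq_zero]
    refine setIntegral_eq_zero_of_forall_eq_zero fun y hy => ?_
    rw [planeKernel_eq_zero hR, zero_mul]
    intro h
    apply ha
    rw [Metric.mem_closedBall] at h ⊢
    have h2 : dist a (y + a) ≤ 1 := by
      rw [dist_eq_norm, show a - (y + a) = -y by abel, norm_neg, Prod.norm_def]
      refine max_le ?_ ?_ <;> rw [Real.norm_eq_abs, abs_le]
      · exact ⟨by linarith [hy.1.1], by linarith [hy.1.2]⟩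
      · exact ⟨by linarith [hy.2.1], by linarith [hy.2.2]⟩
    linarith [dist_triangle a (y + a) x]
  have hpt : ∀ x, ‖∫ y, planeKernel L ψ x y * f y‖ₑ ^ q
      ≤ volume Q ^ (-q) * (V ^ (q - 1) * ∫⁻ a, F x a ^ q) := by
    intro x
    have hgm : Measurable fun y => planeKernel L ψ x y * f y :=
      ((continuous_planeKernel hψ).comp (f := fun y => (x, y)) (by fun_prop)).measurable.mul hf
    have h1 := integral_integral_translate hQt
      (integrable_planeKernel_mul (L := L) hψ hM hR hr hf hN x) hgm
    have h2 : volume Q * ‖∫ y, planeKernel L ψ x y * f y‖ₑ ≤ ∫⁻ a, F x a := by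
      have h3 := enorm_integral_le_lintegral_enorm (μ := volume)
        (fun a => ∫ y in Q, planeKernel L ψ x (y + a) * f (y + a))
      rw [h1, enorm_smul] at h3
      refine le_trans (le_of_eq ?_) h3
      congr 1
      rw [Real.enorm_eq_ofReal ENNReal.toReal_nonneg, ENNReal.ofReal_toReal hQt]
    have h4 : ∫⁻ a, F x a = ∫⁻ a in Metric.closedBall x (R + 1), F x a := by
      rw [← lintegral_indicator measurableSet_closedBall]
      refine lintegral_congr fun a => ?_
      by_cases ha : a ∈ Metric.closedBall x (R + 1)
      · rw [Set.indicator_of_mem ha]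
      · rw [Set.indicator_of_notMem ha, hF0 x a ha]
    have h5 : (volume Q * ‖∫ y, planeKernel L ψ x y * f y‖ₑ) ^ q ≤ V ^ (q - 1) * ∫⁻ a, F x a ^ q := by
      refine (ENNReal.rpow_le_rpow h2 hq0.le).trans ?_
      rw [h4]
      refine (lintegral_rpow_le_measure_univ_mul _ hq
        hFm.of_uncurry_left.aemeasurable).trans ?_
      rw [Measure.restrict_apply_univ, Measure.addHaar_closedBall_center]
      gcongr
      exact Measure.restrict_le_self
    rw [ENNReal.mul_rpow_of_nonneg _ _ hq0.le] at h5
    have hQq0 : volume Q ^ q ≠ 0 := (ENNReal.rpow_pos (pos_iff_ne_zero.2 hQ0) hQt).ne'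
    have hQqt : volume Q ^ q ≠ ⊤ := ENNReal.rpow_ne_top_of_ne_zero hQ0 hQt
    rw [ENNReal.rpow_neg]
    calc _ = (volume Q ^ q)⁻¹ * (volume Q ^ q * ‖∫ y, planeKernel L ψ x y * f y‖ₑ ^ q) := by
          rw [← mul_assoc, ENNReal.inv_mul_cancel hQq0 hQqt, one_mul]
      _ ≤ _ := by gcongr
  -- Of the p powers of the local mass, p - 1 are bounded by the global mass and one stays local, so
  -- that integration in a returns the global mass once more.
  have ha : ∀ a, ∫⁻ x, F x a ^ q ≤ A * N ^ (p - 1) * ∫⁻ y in Q, ‖f (y + a)‖ₑ ^ r := by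
    intro a
    have hle : ∫⁻ y in Q, ‖f (y + a)‖ₑ ^ r ≤ N := by
      refine (setLIntegral_le_lintegral _ _).trans (le_of_eq ?_)
      exact lintegral_add_right_eq_self (fun y => ‖f y‖ₑ ^ r) a
    have h1 := H (fun y => f (y + a)) (hf.comp (by fun_prop)) (ne_top_of_le_ne_top hN hle)
    have h2 := lintegral_sub_right_eq_self (μ := (volume : Measure (ℝ × ℝ)))
      (fun x => ‖∫ y in Q, planeKernel L ψ x y * f (y + a)‖ₑ ^ q) a
    rw [← h2] at h1
    have h3 : ∀ x, F x a = ‖∫ y in Q, planeKernel L ψ (x - a) y * f (y + a)‖ₑ := fun x => by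
      simp only [hF]
      congr 2
      ext y
      congr 1
      rw [← planeKernel_sub_sub L ψ x (y + a) a, add_sub_cancel_right]
    simp_rw [h3]
    refine h1.trans ?_
    rw [mul_assoc]
    gcongr
    calc (∫⁻ y in Q, ‖f (y + a)‖ₑ ^ r) ^ p
        = (∫⁻ y in Q, ‖f (y + a)‖ₑ ^ r) ^ (p - 1) * ∫⁻ y in Q, ‖f (y + a)‖ₑ ^ r := by
          conv_rhs => enter [2]; rw [← ENNReal.rpow_one (∫⁻ y in Q, ‖f (y + a)‖ₑ ^ r)]
          rw [← ENNReal.rpow_add_of_nonneg _ _ (by linarith) zero_le_one]; congr 1; ring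
      _ ≤ _ := by
          gcongr
  have hfr : Measurable fun z => ‖f z‖ₑ ^ r := hf.enorm.pow_const r
  have hshift : Measurable (Function.uncurry fun a y : ℝ × ℝ => ‖f (y + a)‖ₑ ^ r) :=
    hfr.comp (by fun_prop)
  have htot : ∫⁻ a, ∫⁻ y in Q, ‖f (y + a)‖ₑ ^ r = volume Q * N := by
    rw [lintegral_lintegral_swap hshift.aemeasurable]
    simp_rw [lintegral_add_left_eq_self (fun y => ‖f y‖ₑ ^ r)]
    rw [lintegral_const, Measure.restrict_apply_univ, mul_comm]
  have hFq : Measurable (Function.uncurry fun x a => F x a ^ q) := hFm.pow_const q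
  have hNp : N ^ p = N ^ (p - 1) * N := by
    conv_rhs => enter [2]; rw [← ENNReal.rpow_one N]
    rw [← ENNReal.rpow_add_of_nonneg _ _ (by linarith) zero_le_one]; congr 1; ring
  refine (lintegral_mono hpt).trans ?_
  rw [lintegral_const_mul _ (hFq.lintegral_prod_right.const_mul _),
    lintegral_const_mul _ hFq.lintegral_prod_right, lintegral_lintegral_swap hFq.aemeasurable]
  calc _ ≤ volume Q ^ (-q) * (V ^ (q - 1) *
        ∫⁻ a, A * N ^ (p - 1) * ∫⁻ y in Q, ‖f (y + a)‖ₑ ^ r) := by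
        gcongr with a
        exact ha a
    _ = volume Q ^ (-q) * (V ^ (q - 1) * (A * N ^ (p - 1) * (volume Q * N))) := by
        rw [lintegral_const_mul _ hshift.lintegral_prod_right, htot]
    _ = _ := by rw [hNp]; ring

end localisation

/-- Strong type estimate for amplitudes supported away from the first axis. -/
theorem exists_strong_of_supportedOffAxis {ψ : ℝ × ℝ → ℂ} (hψ : ContDiff ℝ ∞ ψ) {c R : ℝ}
    (hc : 0 < c) (hcR : c ≤ R) (hs : SupportedOffAxis ψ c R) {M : ℝ} (hM : ∀ z, ‖ψ z‖ ≤ M) {q : ℝ}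
    (hq : 4 < q) : ∃ C : ℝ≥0∞, C ≠ ⊤ ∧ ∀ L : ℝ, 0 < L → ∀ f : ℝ × ℝ → ℂ, Measurable f →
      ∫⁻ y, ‖f y‖ₑ ^ (q / (q - 3)) ≠ ⊤ →
      ∫⁻ x, ‖∫ y, planeKernel L ψ x y * f y‖ₑ ^ q
        ≤ C * ENNReal.ofReal ((L ^ 2)⁻¹) * (∫⁻ y, ‖f y‖ₑ ^ (q / (q - 3))) ^ (q - 3) := by
  obtain ⟨ε, K, hε0, hε, hK, h⟩ := exists_norm_integral_quadKernel_le hψ hc hcR hs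
  obtain ⟨C, hC, H⟩ := exists_square_strong hψ.continuous hs hM hε h hK hq
  have hq3 : 0 < q - 3 := by linarith
  have hr : 1 ≤ q / (q - 3) := by rw [le_div_iff₀ hq3]; linarith
  refine ⟨(volume (Set.Icc (0 : ℝ) ε ×ˢ Set.Icc (0 : ℝ) ε)) ^ (-q) *
        volume (Metric.closedBall (0 : ℝ × ℝ) (R + 1)) ^ (q - 1) *
        (volume (Set.Icc (0 : ℝ) ε ×ˢ Set.Icc (0 : ℝ) ε)) * C, ?_, fun L hL f hf hN => ?_⟩
  · have hQm : volume (Set.Icc (0 : ℝ) ε ×ˢ Set.Icc (0 : ℝ) ε)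
        = ENNReal.ofReal ε * ENNReal.ofReal ε := by
      rw [Measure.volume_eq_prod, Measure.prod_prod]; simp
    have hQt : volume (Set.Icc (0 : ℝ) ε ×ˢ Set.Icc (0 : ℝ) ε) ≠ ⊤ := by
      rw [hQm]; exact ENNReal.mul_ne_top (by simp) (by simp)
    have hQ0 : volume (Set.Icc (0 : ℝ) ε ×ˢ Set.Icc (0 : ℝ) ε) ≠ 0 := by
      rw [hQm]; simp [hε0]
    refine ENNReal.mul_ne_top (ENNReal.mul_ne_top (ENNReal.mul_ne_top ?_ ?_) hQt) hC
    · exact ENNReal.rpow_ne_top_of_ne_zero hQ0 hQt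
    · exact (ENNReal.rpow_lt_top_of_nonneg (by linarith) measure_closedBall_lt_top.ne).ne
  have hR : ∀ z, ψ z ≠ 0 → ‖z‖ ≤ R := fun z hz => by
    obtain ⟨-, h1, h2⟩ := hs z hz
    exact max_le h2 h1
  refine (lintegral_planeKernel_le_of_square hψ.continuous hM hR hε0 (by linarith) hr
    (by linarith) (by linarith : 1 ≤ q - 3) (H L hL) hf hN).trans (le_of_eq ?_)
  ring

/-- The phase is symmetric under exchange of coordinates; this converts support away from the
vertical axis into support away from the horizontal one. -/
theorem integral_planeKernel_swap (L : ℝ) (ψ f : ℝ × ℝ → ℂ) (x : ℝ × ℝ) :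
    ∫ y, planeKernel L ψ x y * f y
      = ∫ y, planeKernel L (fun z => ψ z.swap) x.swap y * f y.swap := by
  have h := (Measure.measurePreserving_swap (μ := (volume : Measure ℝ))
    (ν := (volume : Measure ℝ))).integral_comp MeasurableEquiv.prodComm.measurableEmbedding
    (fun y => planeKernel L ψ x y * f y)
  rw [Measure.volume_eq_prod, ← h]
  refine integral_congr_ae (Filter.Eventually.of_forall fun y => ?_)
  simp only [planeKernel, Prod.fst_swap, Prod.snd_swap]
  congr 3
  unfold hyp
  rw [add_comm]

/-- Strong type estimate for the convolution operator. -/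
theorem exists_plane_strong {ψ : ℝ × ℝ → ℂ} (hψ : ContDiff ℝ ∞ ψ) {a R : ℝ}
    (ha : 0 < a) (haR : a ≤ R) (hs : ∀ z, ψ z ≠ 0 → a ≤ ‖z‖ ∧ ‖z‖ ≤ R) {M : ℝ}
    (hM : ∀ z, ‖ψ z‖ ≤ M) {q : ℝ}
    (hq : 4 < q) : ∃ C : ℝ≥0∞, C ≠ ⊤ ∧ ∀ L : ℝ, 0 < L → ∀ f : ℝ × ℝ → ℂ, Measurable f →
      ∫⁻ y, ‖f y‖ₑ ^ (q / (q - 3)) ≠ ⊤ →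
      ∫⁻ x, ‖∫ y, planeKernel L ψ x y * f y‖ₑ ^ q
        ≤ C * ENNReal.ofReal ((L ^ 2)⁻¹) * (∫⁻ y, ‖f y‖ₑ ^ (q / (q - 3))) ^ (q - 3) := by
  -- The cutoff is in the second coordinate. Where it is not 1 that coordinate is at least a/4;
  -- where it is nonzero that coordinate is below a/2, so in the sup norm the first coordinate is at
  -- least a.
  let η : ContDiffBump (0 : ℝ) := ⟨a / 4, a / 2, by positivity, by linarith⟩
  have hηc : ContDiff ℝ ∞ fun z : ℝ × ℝ => ((η z.2 : ℝ) : ℂ) :=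
    Complex.ofRealCLM.contDiff.comp (η.contDiff.comp contDiff_snd)
  have hη1 : ∀ t, |t| < a / 4 → η t = 1 := fun t ht =>
    η.one_of_mem_closedBall (by simpa using ht.le)
  have hη0 : ∀ t, a / 2 ≤ |t| → η t = 0 := fun t ht => η.zero_of_le_dist (by simpa using ht)
  have hηn : ∀ t, ‖((η t : ℝ) : ℂ)‖ ≤ 1 := fun t => by
    rw [Complex.norm_real, Real.norm_eq_abs, abs_of_nonneg η.nonneg]; exact η.le_one
  have hηn' : ∀ t, ‖1 - ((η t : ℝ) : ℂ)‖ ≤ 1 := fun t => by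
    rw [← Complex.ofReal_one, ← Complex.ofReal_sub, Complex.norm_real, Real.norm_eq_abs,
      abs_of_nonneg (by linarith [η.le_one (x := t)])]
    linarith [η.nonneg (x := t)]
  set ψ₁ : ℝ × ℝ → ℂ := fun z => (1 - (η z.2 : ℝ)) * ψ z with hψ₁
  set ψ₂ : ℝ × ℝ → ℂ := fun z => (η z.2 : ℝ) * ψ z with hψ₂
  set ψ₃ : ℝ × ℝ → ℂ := fun z => ψ₂ z.swap with hψ₃
  have c1 : ContDiff ℝ ∞ ψ₁ := (contDiff_const.sub hηc).mul hψ
  have c2 : ContDiff ℝ ∞ ψ₂ := hηc.mul hψ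
  have c3 : ContDiff ℝ ∞ ψ₃ := c2.comp (contDiff_snd.prodMk contDiff_fst)
  have M1 : ∀ z, ‖ψ₁ z‖ ≤ M := fun z => by
    rw [hψ₁, norm_mul]
    exact (mul_le_of_le_one_left (norm_nonneg _) (hηn' _)).trans (hM z)
  have M2 : ∀ z, ‖ψ₂ z‖ ≤ M := fun z => by
    rw [hψ₂, norm_mul]
    exact (mul_le_of_le_one_left (norm_nonneg _) (hηn _)).trans (hM z)
  have s1 : SupportedOffAxis ψ₁ (a / 4) R := by
    intro z hz
    obtain ⟨-, h2⟩ := hs z (right_ne_zero_of_mul hz)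
    refine ⟨?_, (le_max_right _ _).trans h2, (le_max_left _ _).trans h2⟩
    by_contra! h
    exact left_ne_zero_of_mul hz (by simp [hη1 _ h])
  have s3 : SupportedOffAxis ψ₃ (a / 4) R := by
    intro z hz
    have hz' : ψ₂ z.swap ≠ 0 := hz
    obtain ⟨h1, h2⟩ := hs z.swap (right_ne_zero_of_mul hz')
    refine ⟨?_, (le_max_left _ _).trans h2, (le_max_right _ _).trans h2⟩
    have h3 : |z.1| < a / 2 := by
      by_contra! h
      exact left_ne_zero_of_mul hz' (by simp [hη0 _ h])
    have h4 : a ≤ max |z.2| |z.1| := h1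
    rcases le_max_iff.1 h4 with h | h <;> linarith
  obtain ⟨C₁, hC₁, H₁⟩ := exists_strong_of_supportedOffAxis c1 (by positivity) (by linarith) s1 M1 hq
  obtain ⟨C₃, hC₃, H₃⟩ := exists_strong_of_supportedOffAxis c3 (by positivity) (by linarith) s3
    (fun z => M2 _) hq
  have hq3 : 0 < q - 3 := by linarith
  have hr : 1 ≤ q / (q - 3) := by rw [le_div_iff₀ hq3]; linarith
  refine ⟨2 ^ (q - 1) * (C₁ + C₃), ENNReal.mul_ne_top (ENNReal.two_rpow_ne_top _)
    (ENNReal.add_ne_top.2 ⟨hC₁, hC₃⟩), fun L hL f hf hN => ?_⟩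
  have hR1 : ∀ z, ψ₁ z ≠ 0 → ‖z‖ ≤ R := fun z hz => (hs z (right_ne_zero_of_mul hz)).2
  have hR2 : ∀ z, ψ₂ z ≠ 0 → ‖z‖ ≤ R := fun z hz => (hs z (right_ne_zero_of_mul hz)).2
  have hswap := Measure.measurePreserving_swap (μ := (volume : Measure ℝ))
    (ν := (volume : Measure ℝ))
  have hsf : ∫⁻ y : ℝ × ℝ, ‖f y.swap‖ₑ ^ (q / (q - 3)) = ∫⁻ y, ‖f y‖ₑ ^ (q / (q - 3)) :=
    hswap.lintegral_comp_emb MeasurableEquiv.prodComm.measurableEmbedding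
      (fun y => ‖f y‖ₑ ^ (q / (q - 3)))
  have h3 := H₃ L hL (fun y => f y.swap) (hf.comp measurable_swap) (by rw [hsf]; exact hN)
  have hsx : ∫⁻ x : ℝ × ℝ, ‖∫ y, planeKernel L ψ₂ x y * f y‖ₑ ^ q
      = ∫⁻ x, ‖∫ y, planeKernel L ψ₃ x y * f y.swap‖ₑ ^ q := by
    have := hswap.lintegral_comp_emb MeasurableEquiv.prodComm.measurableEmbedding
      (fun x => ‖∫ y, planeKernel L ψ₃ x y * f y.swap‖ₑ ^ q)
    refine Eq.trans ?_ this
    refine lintegral_congr fun x => ?_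
    rw [integral_planeKernel_swap]
  rw [hsf, ← hsx] at h3
  have h1 := H₁ L hL f hf hN
  have hadd : ∀ x, ∫ y, planeKernel L ψ x y * f y
      = (∫ y, planeKernel L ψ₁ x y * f y) + ∫ y, planeKernel L ψ₂ x y * f y := by
    intro x
    rw [← integral_add (integrable_planeKernel_mul c1.continuous M1 hR1 hr hf hN x)
      (integrable_planeKernel_mul c2.continuous M2 hR2 hr hf hN x)]
    refine integral_congr_ae (Filter.Eventually.of_forall fun y => ?_)
    simp only [planeKernel, hψ₁, hψ₂]
    ring
  have hm : ∀ φ : ℝ × ℝ → ℂ, ContDiff ℝ ∞ φ →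
      Measurable fun x => ‖∫ y, planeKernel L φ x y * f y‖ₑ ^ q := by
    intro φ hφ
    have h : Measurable fun v : (ℝ × ℝ) × (ℝ × ℝ) => planeKernel L φ v.1 v.2 * f v.2 :=
      (continuous_planeKernel hφ.continuous).measurable.mul (hf.comp measurable_snd)
    exact (h.stronglyMeasurable.integral_prod_right').measurable.enorm.pow_const q
  calc ∫⁻ x, ‖∫ y, planeKernel L ψ x y * f y‖ₑ ^ q
      ≤ ∫⁻ x, 2 ^ (q - 1) * (‖∫ y, planeKernel L ψ₁ x y * f y‖ₑ ^ q +
          ‖∫ y, planeKernel L ψ₂ x y * f y‖ₑ ^ q) := by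
        refine lintegral_mono fun x => ?_
        rw [hadd x]
        exact (ENNReal.rpow_le_rpow (enorm_add_le _ _) (by linarith)).trans
          (ENNReal.rpow_add_le_mul_rpow_add_rpow _ _ (by linarith))
    _ = 2 ^ (q - 1) * ((∫⁻ x, ‖∫ y, planeKernel L ψ₁ x y * f y‖ₑ ^ q) +
          ∫⁻ x, ‖∫ y, planeKernel L ψ₂ x y * f y‖ₑ ^ q) := by
        rw [lintegral_const_mul' _ _ (ENNReal.two_rpow_ne_top _), lintegral_add_left (hm _ c1)]
    _ ≤ 2 ^ (q - 1) * (C₁ * ENNReal.ofReal ((L ^ 2)⁻¹) *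
          (∫⁻ y, ‖f y‖ₑ ^ (q / (q - 3))) ^ (q - 3) + C₃ * ENNReal.ofReal ((L ^ 2)⁻¹) *
          (∫⁻ y, ‖f y‖ₑ ^ (q / (q - 3))) ^ (q - 3)) := by
        gcongr
    _ = _ := by ring

/-! ### The Christ–Kiselev lemma. -/

/-- A finite measure without atoms on an interval can be halved. -/
theorem exists_measure_Iio_le_half (m : Measure ℝ) [IsFiniteMeasure m] (hm : ∀ c, m {c} = 0)
    {β : ℝ} (hβ : m (Set.Ico 0 β)ᶜ = 0) (h0 : m Set.univ ≠ 0) :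
    ∃ c, m (Set.Iio c) ≤ m Set.univ / 2 ∧ m (Set.Ici c) ≤ m Set.univ / 2 := by
  set N := m Set.univ with hN
  have hNt : N ≠ ⊤ := measure_ne_top _ _
  -- The median is the supremum of this set. Continuity from below gives the bound for `Iio c`,
  -- approximation from the right the bound for `Ioi c`, and absence of atoms upgrades `Ioi` to
  -- `Ici`.
  set A : Set ℝ := {c | m (Set.Iio c) ≤ N / 2} with hA
  have hne : A.Nonempty := ⟨0, by
    have : m (Set.Iio 0) = 0 := measure_mono_null (t := (Set.Ico 0 β)ᶜ) (fun x hx hx' => not_lt.2 hx'.1 hx) hβ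
    simp [hA, this]⟩
  have hbdd : BddAbove A := by
    refine ⟨β, fun c hc => ?_⟩
    by_contra! h
    have h1 : m (Set.Iio c)ᶜ = 0 :=
      measure_mono_null (t := (Set.Ico 0 β)ᶜ) (fun x hx hx' => hx (hx'.2.trans h)) hβ
    have h2 : m (Set.Iio c) = N := by
      rw [measure_compl measurableSet_Iio (measure_ne_top _ _), tsub_eq_zero_iff_le] at h1
      exact le_antisymm (measure_mono (Set.subset_univ _)) h1
    have hc' : m (Set.Iio c) ≤ N / 2 := hc
    have h3 : N ≤ N / 2 := h2.symm.le.trans hc'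
    exact absurd (ENNReal.half_lt_self h0 hNt) (not_lt.2 h3)
  set c := sSup A with hc
  refine ⟨c, ?_, ?_⟩
  · obtain ⟨u, hu1, hu2, hu3⟩ := exists_seq_strictMono_tendsto c
    rw [← iUnion_Iic_eq_Iio_of_lt_of_tendsto hu2 hu3, Monotone.measure_iUnion
      (fun i j hij => Set.Iic_subset_Iic.2 (hu1.monotone hij))]
    refine iSup_le fun n => ?_
    obtain ⟨c', hc', h⟩ := exists_lt_of_lt_csSup hne (hu2 n)
    exact (measure_mono (Set.Iic_subset_Iio.2 h)).trans hc'
  · obtain ⟨u, hu1, hu2, hu3⟩ := exists_seq_strictAnti_tendsto c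
    have h1 : m (Set.Ioi c) ≤ N / 2 := by
      rw [← iUnion_Ici_eq_Ioi_of_lt_of_tendsto hu2 hu3, Monotone.measure_iUnion
        (fun i j hij => Set.Ici_subset_Ici.2 (hu1.antitone hij))]
      refine iSup_le fun n => ?_
      have h2 : u n ∉ A := fun h => not_lt.2 (le_csSup hbdd h) (hu2 n)
      have h3 : N / 2 < m (Set.Iio (u n)) := not_le.1 h2
      rw [← Set.compl_Iio, measure_compl measurableSet_Iio (measure_ne_top _ _), ← hN]
      calc N - m (Set.Iio (u n)) ≤ N - N / 2 := tsub_le_tsub_left h3.le _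
        _ = N / 2 := ENNReal.sub_half hNt
    rw [← Set.Ioi_union_left]
    refine (measure_union_le _ _).trans ?_
    rw [hm, add_zero]
    exact h1

/-- The family `S` of sets consists of initial and final segments with respect to `θ`. -/
def IsSegmentFamily {X Y : Type*} (θ : Y → ℝ) (S : X → Set Y) : Prop :=
  ∀ x, (∀ y y', θ y ≤ θ y' → y' ∈ S x → y ∈ S x) ∨ (∀ y y', θ y ≤ θ y' → y ∈ S x → y' ∈ S x)

/-- The single boundary point of the segment lies on one side of c, so the cutoff acts nontrivially
on at most one half, while the other half is either included whole or omitted. This gives a maximum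
instead of a sum for the cut-off halves, which is the source of the gain. -/
theorem enorm_cutoff_le {X Y : Type*} [MeasurableSpace Y] {ν : Measure Y} {θ : Y → ℝ} (hθ : Measurable θ) {S : X → Set Y}
    (hS : IsSegmentFamily θ S) (x : X) {g : Y → ℂ} (hg : Integrable g ν) (c : ℝ) :
    ‖∫ y in S x, g y ∂ν‖ₑ ≤ ‖∫ y in {y | θ y < c}, g y ∂ν‖ₑ + ‖∫ y in {y | θ y < c}ᶜ, g y ∂ν‖ₑ +
      max ‖∫ y in S x ∩ {y | θ y < c}, g y ∂ν‖ₑ ‖∫ y in S x ∩ {y | θ y < c}ᶜ, g y ∂ν‖ₑ := by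
  have hU : MeasurableSet {y | θ y < c} := measurableSet_lt hθ measurable_const
  set U := {y | θ y < c} with hUdef
  have hsplit : ∫ y in S x, g y ∂ν = (∫ y in S x ∩ U, g y ∂ν) + ∫ y in S x ∩ Uᶜ, g y ∂ν := by
    rw [← Set.sdiff_eq, integral_inter_add_sdiff hU hg.integrableOn]
  by_cases h1 : U ⊆ S x
  · rw [hsplit, Set.inter_eq_right.2 h1]
    refine (enorm_add_le _ _).trans ?_
    exact add_le_add le_self_add (le_max_right _ _)
  by_cases h2 : Uᶜ ⊆ S x
  · rw [hsplit, Set.inter_eq_right.2 h2, add_comm]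
    refine (enorm_add_le _ _).trans ?_
    exact add_le_add le_add_self (le_max_left _ _)
  · obtain ⟨a, ha, ha'⟩ := Set.not_subset.1 h1
    obtain ⟨b, hb, hb'⟩ := Set.not_subset.1 h2
    have hUc : ∀ y ∈ Uᶜ, c ≤ θ y := fun y hy => not_lt.1 hy
    have hab : θ a ≤ θ b := (lt_of_lt_of_le ha (hUc b hb)).le
    refine le_trans ?_ le_add_self
    rcases hS x with h | h
    · have : S x ∩ Uᶜ = ∅ := by
        rw [Set.eq_empty_iff_forall_notMem]
        rintro y ⟨hy, hy'⟩
        exact ha' (h a y (lt_of_lt_of_le ha (hUc y hy')).le hy)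
      rw [hsplit, this]
      simp
    · have : S x ∩ U = ∅ := by
        rw [Set.eq_empty_iff_forall_notMem]
        rintro y ⟨hy, hy'⟩
        exact hb' (h y b (lt_of_lt_of_le hy' (hUc b hb)).le hy)
      rw [hsplit, this]
      simp

section christKiselev
variable {X Y : Type*} [MeasurableSpace X] [MeasurableSpace Y]

/-- The median of the distribution of θ under the density g. -/
theorem exists_half_split {ν : Measure Y} {θ : Y → ℝ} (hθ : Measurable θ) {β : ℝ}
    (hβ : ∀ y, θ y ∈ Set.Ico 0 β) (hθ0 : ∀ c, ν {y | θ y = c} = 0) {g : Y → ℝ≥0∞}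
    (hg : ∫⁻ y, g y ∂ν ≠ ⊤) (hg0 : ∫⁻ y, g y ∂ν ≠ 0) :
    ∃ c, ∫⁻ y in {y | θ y < c}, g y ∂ν ≤ (∫⁻ y, g y ∂ν) / 2 ∧
      ∫⁻ y in {y | θ y < c}ᶜ, g y ∂ν ≤ (∫⁻ y, g y ∂ν) / 2 := by
  set m := (ν.withDensity g).map θ with hm
  have hfin : IsFiniteMeasure (ν.withDensity g) := isFiniteMeasure_withDensity hg
  have hms : ∀ s, MeasurableSet s → m s = ∫⁻ y in θ ⁻¹' s, g y ∂ν := fun s hs => by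
    rw [hm, Measure.map_apply hθ hs, withDensity_apply _ (hθ hs)]
  have hmu : m Set.univ = ∫⁻ y, g y ∂ν := by rw [hms _ MeasurableSet.univ]; simp
  obtain ⟨c, h1, h2⟩ := exists_measure_Iio_le_half m (fun c => by
    rw [hms _ (measurableSet_singleton c)]
    exact setLIntegral_measure_zero _ _ (hθ0 c)) (β := β) (by
    rw [hms _ measurableSet_Ico.compl]
    have : θ ⁻¹' (Set.Ico 0 β)ᶜ = ∅ := by
      ext y; simp only [Set.mem_preimage, Set.mem_compl_iff, Set.mem_empty_iff_false, iff_false]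
      exact not_not.2 (hβ y)
    simp [this]) (by rw [hmu]; exact hg0)
  rw [hmu, hms _ measurableSet_Iio] at h1
  rw [hmu, ← Set.compl_Iio, hms _ measurableSet_Iio.compl] at h2
  exact ⟨c, h1, h2⟩

/-- The Christ–Kiselev lemma. -/
theorem lintegral_cutoff_le {μ : Measure X} {ν : Measure Y} [SFinite ν] {k : X → Y → ℂ}
    (hk : Measurable (Function.uncurry k)) {q p r : ℝ} (hq : 1 ≤ q) (hp : 1 < p) (hr : 0 < r)
    (hi : ∀ f : Y → ℂ, Measurable f → ∫⁻ y, ‖f y‖ₑ ^ r ∂ν ≠ ⊤ →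
      ∀ x, Integrable (fun y => k x y * f y) ν)
    {θ : Y → ℝ} (hθ : Measurable θ) {β : ℝ}
    (hβ : ∀ y, θ y ∈ Set.Ico 0 β) (hθ0 : ∀ c, ν {y | θ y = c} = 0)
    {S : X → Set Y} (hS : IsSegmentFamily θ S) (hSm : MeasurableSet {v : X × Y | v.2 ∈ S v.1})
    {A C₀ : ℝ≥0∞} (hC₀ : C₀ ≠ ⊤)
    (H : ∀ f : Y → ℂ, Measurable f → ∫⁻ y, ‖f y‖ₑ ^ r ∂ν ≠ ⊤ →
      ∫⁻ x, ‖∫ y, k x y * f y ∂ν‖ₑ ^ q ∂μ ≤ A * (∫⁻ y, ‖f y‖ₑ ^ r ∂ν) ^ p)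
    (H₀ : ∀ f : Y → ℂ, Measurable f → ∫⁻ y, ‖f y‖ₑ ^ r ∂ν ≠ ⊤ →
      ∫⁻ x, ‖∫ y in S x, k x y * f y ∂ν‖ₑ ^ q ∂μ ≤ C₀ * (∫⁻ y, ‖f y‖ₑ ^ r ∂ν) ^ p)
    {f : Y → ℂ} (hf : Measurable f) (hN : ∫⁻ y, ‖f y‖ₑ ^ r ∂ν ≠ ⊤) :
    ∫⁻ x, ‖∫ y in S x, k x y * f y ∂ν‖ₑ ^ q ∂μ
      ≤ (2 / (1 - 2 ^ ((1 - p) / q))) ^ q * A * (∫⁻ y, ‖f y‖ₑ ^ r ∂ν) ^ p := by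
  have hq0 : 0 < q := by linarith
  set ρ : ℝ≥0∞ := 2 ^ ((1 - p) / q) with hρ
  have hρ1 : ρ < 1 := ENNReal.rpow_lt_one_of_one_lt_of_neg (by norm_num)
    (div_neg_of_neg_of_pos (by linarith) hq0)
  have hSx : ∀ x, MeasurableSet (S x) := fun x => hSm.preimage (measurable_prodMk_left)
  set N : (Y → ℂ) → ℝ≥0∞ := fun f => ∫⁻ y, ‖f y‖ₑ ^ r ∂ν with hNdef
  set W : (Y → ℂ) → ℝ≥0∞ := fun f => ∫⁻ x, ‖∫ y in S x, k x y * f y ∂ν‖ₑ ^ q ∂μ with hW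
  set G : Set (Y → ℂ) := {f | Measurable f ∧ N f ≠ 0 ∧ N f ≠ ⊤} with hG
  -- The best constant for the cut-off operator. The crude bound `C₀` serves only to make it finite,
  -- so that it can be absorbed; it does not enter the final constant.
  set s : ℝ≥0∞ := ⨆ f ∈ G, W f / N f ^ p with hs
  have hNp0 : ∀ f ∈ G, N f ^ p ≠ 0 := fun f hf =>
    (ENNReal.rpow_pos (pos_iff_ne_zero.2 hf.2.1) hf.2.2).ne'
  have hNpt : ∀ f ∈ G, N f ^ p ≠ ⊤ := fun f hf => ENNReal.rpow_ne_top_of_ne_zero hf.2.1 hf.2.2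
  have hs_le : s ≤ C₀ := by
    refine iSup₂_le fun f hf => ?_
    rw [ENNReal.div_le_iff (hNp0 f hf) (hNpt f hf)]
    exact H₀ f hf.1 hf.2.2
  have hst : s ≠ ⊤ := ne_top_of_le_ne_top hC₀ hs_le
  have hW0 : ∀ f, Measurable f → N f = 0 → W f = 0 := by
    intro f hf h0
    have hfr : Measurable fun y => ‖f y‖ₑ ^ r := hf.enorm.pow_const r
    have hz : ∀ᵐ y ∂ν, f y = 0 := by
      filter_upwards [(lintegral_eq_zero_iff hfr).1 h0] with y hy
      have : ‖f y‖ₑ = 0 := by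
        by_contra h
        exact (ENNReal.rpow_pos (pos_iff_ne_zero.2 h) enorm_ne_top).ne' hy
      simpa using this
    have : ∀ x, ∫ y in S x, k x y * f y ∂ν = 0 := fun x => by
      refine integral_eq_zero_of_ae (ae_restrict_of_ae ?_)
      filter_upwards [hz] with y hy
      simp [hy]
    simp [hW, this, hq0]
  have hWs : ∀ f, Measurable f → N f ≠ ⊤ → W f ≤ s * N f ^ p := by
    intro f hf hNf
    rcases eq_or_ne (N f) 0 with h0 | h0
    · rw [hW0 f hf h0]; exact zero_le
    · have hfG : f ∈ G := ⟨hf, h0, hNf⟩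
      rw [← ENNReal.div_le_iff (hNp0 f hfG) (hNpt f hfG)]
      exact le_iSup₂ (f := fun f (_ : f ∈ G) => W f / N f ^ p) f hfG
  have hmT : ∀ f, Measurable f → Measurable fun x => ‖∫ y, k x y * f y ∂ν‖ₑ := fun f hf => by
    have h : Measurable fun v : X × Y => k v.1 v.2 * f v.2 := hk.mul (hf.comp measurable_snd)
    exact (h.stronglyMeasurable.integral_prod_right').measurable.enorm
  have hmS : ∀ f, Measurable f → Measurable fun x => ‖∫ y in S x, k x y * f y ∂ν‖ₑ := by
    intro f hf
    have h : Measurable fun v : X × Y =>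
        {v : X × Y | v.2 ∈ S v.1}.indicator (fun v => k v.1 v.2 * f v.2) v :=
      (hk.mul (hf.comp measurable_snd)).indicator hSm
    have h2 := (h.stronglyMeasurable.integral_prod_right' (ν := ν)).measurable.enorm
    have h3 : ∀ x, ∫ y in S x, k x y * f y ∂ν = ∫ y, {v : X × Y | v.2 ∈ S v.1}.indicator
        (fun v => k v.1 v.2 * f v.2) (x, y) ∂ν := fun x => by
      rw [← integral_indicator (hSx x)]
      rfl
    simp_rw [h3]
    exact h2
  have hstep : ∀ f ∈ G, W f / N f ^ p ≤ (2 * A ^ (1 / q) + ρ * s ^ (1 / q)) ^ q := by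
    intro f hfG
    obtain ⟨hf, hf0, hft⟩ := hfG
    obtain ⟨c, hc1, hc2⟩ := exists_half_split hθ hβ hθ0 hft hf0
    set U := {y | θ y < c} with hU
    have hUm : MeasurableSet U := measurableSet_lt hθ measurable_const
    have half_le : N f / 2 ≤ N f := ENNReal.half_le_self
    have hind : ∀ V : Set Y, MeasurableSet V → ∫⁻ y in V, ‖f y‖ₑ ^ r ∂ν ≤ N f / 2 →
        Measurable (V.indicator f) ∧ N (V.indicator f) ≤ N f / 2 ∧
        (∀ x, ∫ y, k x y * V.indicator f y ∂ν = ∫ y in V, k x y * f y ∂ν) ∧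
        ∀ x, ∫ y in S x, k x y * V.indicator f y ∂ν = ∫ y in S x ∩ V, k x y * f y ∂ν := by
      intro V hV hVN
      have e1 : ∀ x y, k x y * V.indicator f y = V.indicator (fun y => k x y * f y) y :=
        fun x y => by
        by_cases hy : y ∈ V <;> simp [hy]
      refine ⟨hf.indicator hV, ?_, fun x => ?_, fun x => ?_⟩
      · refine le_trans (le_of_eq ?_) hVN
        rw [← lintegral_indicator hV]
        refine lintegral_congr fun y => ?_
        by_cases hy : y ∈ V <;> simp [hy, hr]
      · simp_rw [e1]; rw [integral_indicator hV]
      · simp_rw [e1]; rw [setIntegral_indicator hV]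
    obtain ⟨m1, n1, t1, s1⟩ := hind U hUm hc1
    obtain ⟨m2, n2, t2, s2⟩ := hind Uᶜ hUm.compl hc2
    set f₁ := U.indicator f
    set f₂ := Uᶜ.indicator f
    set a : X → ℝ≥0∞ := fun x => ‖∫ y, k x y * f₁ y ∂ν‖ₑ with ha
    set b : X → ℝ≥0∞ := fun x => ‖∫ y, k x y * f₂ y ∂ν‖ₑ with hb
    set a' : X → ℝ≥0∞ := fun x => ‖∫ y in S x, k x y * f₁ y ∂ν‖ₑ with ha'
    set b' : X → ℝ≥0∞ := fun x => ‖∫ y in S x, k x y * f₂ y ∂ν‖ₑ with hb'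
    have hpt : ∀ x, ‖∫ y in S x, k x y * f y ∂ν‖ₑ ≤ (a + b + fun x => max (a' x) (b' x)) x := by
      intro x
      have := enorm_cutoff_le hθ hS x (hi f hf hft x) c
      simp only [Pi.add_apply, ha, hb, ha', hb', t1, t2, s1, s2]
      exact this
    have am : Measurable a := hmT _ m1
    have bm : Measurable b := hmT _ m2
    have a'm : Measurable a' := hmS _ m1
    have b'm : Measurable b' := hmS _ m2
    have hp0 : 0 ≤ p := by linarith
    have htot : ∀ g : Y → ℂ, Measurable g → N g ≤ N f / 2 →
        (∫⁻ x, ‖∫ y, k x y * g y ∂ν‖ₑ ^ q ∂μ) ^ (1 / q) ≤ A ^ (1 / q) * (N f ^ p) ^ (1 / q) := by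
      intro g hg hgN
      rw [← ENNReal.mul_rpow_of_nonneg _ _ (by positivity)]
      refine ENNReal.rpow_le_rpow ?_ (by positivity)
      refine (H g hg (ne_top_of_le_ne_top hft (hgN.trans half_le))).trans ?_
      gcongr
      exact hgN.trans half_le
    -- Each half carries at most N/2 and contributes at most s (N/2)^p to the q-th power. There are
    -- two halves, hence the factor 2^(1-p) = ρ^q, and ρ < 1 because p > 1.
    have hmax : (∫⁻ x, max (a' x) (b' x) ^ q ∂μ) ^ (1 / q)
        ≤ ρ * s ^ (1 / q) * (N f ^ p) ^ (1 / q) := by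
      have h1 : ∫⁻ x, max (a' x) (b' x) ^ q ∂μ ≤ W f₁ + W f₂ := by
        rw [hW, ← lintegral_add_left (a'm.pow_const q)]
        refine lintegral_mono fun x => ?_
        rcases max_choice (a' x) (b' x) with h | h <;> simp only [h]
        · exact le_self_add
        · exact le_add_self
      have h2 : ∀ g : Y → ℂ, Measurable g → N g ≤ N f / 2 → W g ≤ s * (2 ^ (-p) * N f ^ p) := by
        intro g hg hgN
        refine (hWs g hg (ne_top_of_le_ne_top hft (hgN.trans half_le))).trans ?_
        gcongr
        refine (ENNReal.rpow_le_rpow hgN hp0).trans (le_of_eq ?_)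
        rw [ENNReal.div_rpow_of_nonneg _ _ hp0, ENNReal.rpow_neg, div_eq_mul_inv, mul_comm]
      have h3 : ∫⁻ x, max (a' x) (b' x) ^ q ∂μ ≤ 2 ^ (1 - p) * s * N f ^ p := by
        refine h1.trans ((add_le_add (h2 _ m1 n1) (h2 _ m2 n2)).trans (le_of_eq ?_))
        rw [show (1 - p) = 1 + -p by ring, ENNReal.two_rpow_add, ENNReal.rpow_one]
        ring
      refine (ENNReal.rpow_le_rpow h3 (by positivity : (0 : ℝ) ≤ 1 / q)).trans (le_of_eq ?_)
      rw [ENNReal.mul_rpow_of_nonneg _ _ (by positivity),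
        ENNReal.mul_rpow_of_nonneg _ _ (by positivity), ← ENNReal.rpow_mul, hρ,
        mul_one_div (1 - p) q]
    have hsum : W f ^ (1 / q) ≤ (2 * A ^ (1 / q) + ρ * s ^ (1 / q)) * (N f ^ p) ^ (1 / q) := by
      calc W f ^ (1 / q) ≤ (∫⁻ x, (a + b + fun x => max (a' x) (b' x)) x ^ q ∂μ) ^ (1 / q) := by
            refine ENNReal.rpow_le_rpow (lintegral_mono fun x => ?_) (by positivity)
            exact ENNReal.rpow_le_rpow (hpt x) hq0.le
        _ ≤ (∫⁻ x, (a + b) x ^ q ∂μ) ^ (1 / q) + (∫⁻ x, max (a' x) (b' x) ^ q ∂μ) ^ (1 / q) :=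
            ENNReal.lintegral_Lp_add_le (am.add bm).aemeasurable (a'm.max b'm).aemeasurable hq
        _ ≤ ((∫⁻ x, a x ^ q ∂μ) ^ (1 / q) + (∫⁻ x, b x ^ q ∂μ) ^ (1 / q)) +
            (∫⁻ x, max (a' x) (b' x) ^ q ∂μ) ^ (1 / q) := by
            gcongr
            exact ENNReal.lintegral_Lp_add_le am.aemeasurable bm.aemeasurable hq
        _ ≤ (A ^ (1 / q) * (N f ^ p) ^ (1 / q) + A ^ (1 / q) * (N f ^ p) ^ (1 / q)) +
            ρ * s ^ (1 / q) * (N f ^ p) ^ (1 / q) :=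
            add_le_add (add_le_add (htot _ m1 n1) (htot _ m2 n2)) hmax
        _ = _ := by ring
    rw [ENNReal.div_le_iff (hNp0 f ⟨hf, hf0, hft⟩) (hNpt f ⟨hf, hf0, hft⟩)]
    have h := ENNReal.rpow_le_rpow hsum hq0.le
    rwa [ENNReal.mul_rpow_of_nonneg _ _ hq0.le, ← ENNReal.rpow_mul, ← ENNReal.rpow_mul,
      one_div_mul_cancel hq0.ne', ENNReal.rpow_one, ENNReal.rpow_one] at h
  -- The inequality σ ≤ 2A^(1/q) + ρσ for σ = s^(1/q); finiteness of σ and ρ < 1 let it be solved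
  -- for σ.
  have hσ : s ^ (1 / q) ≤ 2 * A ^ (1 / q) + ρ * s ^ (1 / q) := by
    rw [one_div, ENNReal.rpow_inv_le_iff hq0, ← one_div]
    exact iSup₂_le hstep
  have hσt : s ^ (1 / q) ≠ ⊤ := (ENNReal.rpow_lt_top_of_nonneg (by positivity) hst).ne
  have hσ' : s ^ (1 / q) ≤ 2 / (1 - ρ) * A ^ (1 / q) := by
    have h1 : s ^ (1 / q) * (1 - ρ) ≤ 2 * A ^ (1 / q) := by
      rw [mul_comm, ENNReal.sub_mul fun _ _ => hσt, one_mul]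
      exact tsub_le_iff_right.2 hσ
    have h2 : 1 - ρ ≠ 0 := (tsub_pos_of_lt hρ1).ne'
    have h3 : 1 - ρ ≠ ⊤ := (tsub_le_self.trans_lt ENNReal.one_lt_top).ne
    rw [← ENNReal.le_div_iff_mul_le (Or.inl h2) (Or.inl h3)] at h1
    refine h1.trans (le_of_eq ?_)
    simp only [div_eq_mul_inv]; ring
  have hs_fin : s ≤ (2 / (1 - ρ)) ^ q * A := by
    have h := ENNReal.rpow_le_rpow hσ' hq0.le
    rwa [ENNReal.mul_rpow_of_nonneg _ _ hq0.le, ← ENNReal.rpow_mul, ← ENNReal.rpow_mul,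
      one_div_mul_cancel hq0.ne', ENNReal.rpow_one, ENNReal.rpow_one] at h
  exact (hWs f hf hN).trans (mul_le_mul' hs_fin le_rfl)

end christKiselev

/-! ### A crude bound without oscillation. -/

/-- Young type estimate for cut off kernels of bounded support. -/
theorem lintegral_cutoff_le_of_bounded_support {E : Type*} [NormedAddCommGroup E]
    [MeasurableSpace E] [BorelSpace E] [SecondCountableTopology E] (μ : Measure E) [SFinite μ]
    [μ.IsAddLeftInvariant] {k : E → E → ℂ} {M R : ℝ} (hM : ∀ x y, ‖k x y‖ ≤ M)
    (hk0 : ∀ x, ∀ y ∉ Metric.closedBall x R, k x y = 0) (S : E → Set E) {p r : ℝ}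
    (hp : 1 ≤ p) (hr : 1 ≤ r) {f : E → ℂ} (hf : Measurable f) :
    ∫⁻ x, ‖∫ y in S x, k x y * f y ∂μ‖ₑ ^ (r * p) ∂μ
      ≤ ENNReal.ofReal M ^ (r * p) * μ (Metric.closedBall 0 R) ^ ((r - 1) * p) *
        μ (Metric.closedBall 0 R) * (∫⁻ y, ‖f y‖ₑ ^ r ∂μ) ^ p := by
  have hr0 : 0 < r := by linarith
  have hp0 : 0 < p := by linarith
  set B : Set E := Metric.closedBall 0 R with hB
  have hBm : MeasurableSet B := measurableSet_closedBall
  set V := μ B with hVdef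
  set N := ∫⁻ y, ‖f y‖ₑ ^ r ∂μ with hNdef
  set n : E → ℝ≥0∞ := fun x => ∫⁻ y in B, ‖f (y + x)‖ₑ ^ r ∂μ with hn
  have hfr : Measurable fun z => ‖f z‖ₑ ^ r := hf.enorm.pow_const r
  have hnN : ∀ x, n x ≤ N := fun x =>
    (setLIntegral_le_lintegral _ _).trans (le_of_eq
      (lintegral_add_right_eq_self (fun y => ‖f y‖ₑ ^ r) x))
  have h1 : ∀ x, ‖∫ y in S x, k x y * f y ∂μ‖ₑ ≤ ENNReal.ofReal M * ∫⁻ y in B, ‖f (y + x)‖ₑ ∂μ := by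
    intro x
    refine (enorm_integral_le_lintegral_enorm _).trans
      ((setLIntegral_le_lintegral _ _).trans ?_)
    rw [← lintegral_add_right_eq_self _ x, ← lintegral_const_mul' _ _ ENNReal.ofReal_ne_top,
      ← lintegral_indicator hBm]
    refine lintegral_mono fun y => ?_
    by_cases hy : y ∈ B
    · rw [Set.indicator_of_mem hy, enorm_mul]
      gcongr
      rw [← ofReal_norm]
      exact ENNReal.ofReal_le_ofReal (hM _ _)
    · have : y + x ∉ Metric.closedBall x R := by
        intro h
        apply hy
        simpa [hB] using h
      simp [hk0 x _ this]
  have h2 : ∀ x, ‖∫ y in S x, k x y * f y ∂μ‖ₑ ^ (r * p)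
      ≤ ENNReal.ofReal M ^ (r * p) * V ^ ((r - 1) * p) * N ^ (p - 1) * n x := by
    intro x
    have h3 := lintegral_rpow_le_measure_univ_mul (μ.restrict B) hr
      (hf.comp (measurable_add_const x)).enorm.aemeasurable
    rw [Measure.restrict_apply_univ] at h3
    -- One factor of the local mass is kept, and its integral over x is the volume of the ball times
    -- the total mass.
    have h4 : n x ^ p ≤ N ^ (p - 1) * n x := by
      calc n x ^ p = n x ^ (p - 1) * n x := by
            conv_rhs => enter [2]; rw [← ENNReal.rpow_one (n x)]
            rw [← ENNReal.rpow_add_of_nonneg _ _ (by linarith) zero_le_one]; congr 1; ring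
        _ ≤ _ := by
            gcongr
            exact hnN x
    calc _ ≤ (ENNReal.ofReal M * ∫⁻ y in B, ‖f (y + x)‖ₑ ∂μ) ^ (r * p) :=
          ENNReal.rpow_le_rpow (h1 x) (by positivity)
      _ = ENNReal.ofReal M ^ (r * p) * ((∫⁻ y in B, ‖f (y + x)‖ₑ ∂μ) ^ r) ^ p := by
          rw [ENNReal.mul_rpow_of_nonneg _ _ (by positivity), ← ENNReal.rpow_mul]
      _ ≤ ENNReal.ofReal M ^ (r * p) * (V ^ (r - 1) * n x) ^ p := by
          gcongr
          exact h3
      _ = ENNReal.ofReal M ^ (r * p) * (V ^ ((r - 1) * p) * n x ^ p) := by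
          rw [ENNReal.mul_rpow_of_nonneg _ _ hp0.le, ← ENNReal.rpow_mul]
      _ ≤ ENNReal.ofReal M ^ (r * p) * (V ^ ((r - 1) * p) * (N ^ (p - 1) * n x)) := by
          gcongr
      _ = _ := by ring
  have hshift : Measurable (Function.uncurry fun x y : E => ‖f (y + x)‖ₑ ^ r) :=
    hfr.comp (by fun_prop)
  have htot : ∫⁻ x, n x ∂μ = V * N := by
    rw [hn, lintegral_lintegral_swap hshift.aemeasurable]
    simp_rw [lintegral_add_left_eq_self (fun y => ‖f y‖ₑ ^ r)]
    rw [lintegral_const, Measure.restrict_apply_univ, mul_comm]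
  refine (lintegral_mono h2).trans (le_of_eq ?_)
  have hNp : N ^ p = N ^ (p - 1) * N := by
    conv_rhs => enter [2]; rw [← ENNReal.rpow_one N]
    rw [← ENNReal.rpow_add_of_nonneg _ _ (by linarith) zero_le_one]; congr 1; ring
  rw [lintegral_const_mul _ hshift.lintegral_prod_right, htot, hNp]
  ring

/-! ### Transfer to the Euclidean plane. -/

/-- The kernel of the operator without angular cutoff. -/
noncomputable def convKernel (ψ : Plane → ℂ) (lam : ℝ) (x y : Plane) : ℂ :=
  Complex.exp (2 * Real.pi * Complex.I * lam * ‖x - y‖) * ψ (x - y)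

theorem norm_convKernel (ψ : Plane → ℂ) (lam : ℝ) (x y : Plane) :
    ‖convKernel ψ lam x y‖ = ‖ψ (x - y)‖ := by
  rw [convKernel, norm_mul]
  have : (2 * Real.pi * Complex.I * lam * ‖x - y‖ : ℂ)
      = ((2 * Real.pi * lam * ‖x - y‖ : ℝ) : ℂ) * Complex.I := by
    push_cast; ring
  rw [this, Complex.norm_exp_ofReal_mul_I, one_mul]

theorem continuous_convKernel {ψ : Plane → ℂ} (hψ : Continuous ψ) (lam : ℝ) :
    Continuous fun v : Plane × Plane => convKernel ψ lam v.1 v.2 := by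
  unfold convKernel
  fun_prop

/-- Cartesian coordinates. -/
noncomputable def planeEquiv : Plane ≃ᵐ ℝ × ℝ :=
  (MeasurableEquiv.toLp 2 (Fin 2 → ℝ)).symm.trans MeasurableEquiv.finTwoArrow

theorem planeEquiv_apply (x : Plane) : planeEquiv x = (x 0, x 1) := rfl

theorem planeEquiv_symm_apply (z : ℝ × ℝ) : planeEquiv.symm z = !₂[z.1, z.2] := by
  rw [MeasurableEquiv.symm_apply_eq, planeEquiv_apply]
  simp

theorem measurePreserving_planeEquiv : MeasurePreserving planeEquiv volume volume :=
  (volume_preserving_finTwoArrow ℝ).comp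
    (EuclideanSpace.volume_preserving_symm_measurableEquiv_toLp (Fin 2))

theorem contDiff_planeEquiv_symm : ContDiff ℝ ∞ fun z => planeEquiv.symm z := by
  simp_rw [planeEquiv_symm_apply]
  rw [contDiff_euclidean]
  intro i
  fin_cases i
  · exact contDiff_fst
  · exact contDiff_snd

theorem planeKernel_planeEquiv (ψ : Plane → ℂ) (lam : ℝ) (x y : Plane) :
    planeKernel (2 * Real.pi * lam) (fun z => ψ (planeEquiv.symm z)) (planeEquiv x) (planeEquiv y)
      = convKernel ψ lam x y := by
  have h1 : planeEquiv.symm (planeEquiv x - planeEquiv y) = x - y := by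
    rw [MeasurableEquiv.symm_apply_eq]
    simp [planeEquiv_apply]
  have h2 : hyp ((planeEquiv x).1 - (planeEquiv y).1) ((planeEquiv x).2 - (planeEquiv y).2)
      = ‖x - y‖ := by
    rw [EuclideanSpace.norm_eq, hyp]
    simp [planeEquiv_apply, Fin.sum_univ_two]
  rw [planeKernel, h1, h2, convKernel]
  congr 2
  push_cast
  ring

/-- Strong type estimate for the operator without cutoff. -/
theorem exists_conv_strong {ψ : Plane → ℂ} (hψ : ContDiff ℝ ∞ ψ) (hψc : HasCompactSupport ψ)
    (hψ0 : (0 : Plane) ∉ tsupport ψ) {q : ℝ} (hq : 4 < q) : ∃ C : ℝ≥0∞, C ≠ ⊤ ∧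
    ∀ lam : ℝ, 0 < lam → ∀ f : Plane → ℂ, Measurable f →
      ∫⁻ y, ‖f y‖ₑ ^ (q / (q - 3)) ≠ ⊤ →
      ∫⁻ x, ‖∫ y, convKernel ψ lam x y * f y‖ₑ ^ q
        ≤ C * ENNReal.ofReal (((2 * Real.pi * lam) ^ 2)⁻¹) *
          (∫⁻ y, ‖f y‖ₑ ^ (q / (q - 3))) ^ (q - 3) := by
  set φ : ℝ × ℝ → ℂ := fun z => ψ (planeEquiv.symm z) with hφ
  have hφc : ContDiff ℝ ∞ φ := hψ.comp contDiff_planeEquiv_symm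
  obtain ⟨M, hM⟩ := hψ.continuous.bounded_above_of_compact_support hψc
  -- The transferred amplitude must vanish near 0 in the sup norm of the product, which follows from
  -- openness of the complement of the support.
  obtain ⟨a, ha, hball⟩ : ∃ a > 0, Metric.ball (0 : ℝ × ℝ) a
      ⊆ (fun z => planeEquiv.symm z) ⁻¹' (tsupport ψ)ᶜ := by
    refine Metric.isOpen_iff.1 ((isClosed_tsupport ψ).isOpen_compl.preimage
      contDiff_planeEquiv_symm.continuous) 0 ?_
    have : planeEquiv.symm 0 = 0 := by
      rw [planeEquiv_symm_apply]; ext i; fin_cases i <;> rfl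
    simpa [this] using hψ0
  obtain ⟨R, hR⟩ := hψc.isCompact.isBounded.exists_norm_le
  have hs : ∀ z, φ z ≠ 0 → a ≤ ‖z‖ ∧ ‖z‖ ≤ max R a := by
    intro z hz
    have hz' : planeEquiv.symm z ∈ tsupport ψ := subset_tsupport _ hz
    constructor
    · by_contra! h
      exact hball (by simpa using h) hz'
    · refine le_trans ?_ ((hR _ hz').trans (le_max_left _ _))
      have h0 := EuclideanSpace.norm_eq (planeEquiv.symm z)
      rw [Fin.sum_univ_two, planeEquiv_symm_apply] at h0
      rw [planeEquiv_symm_apply, h0]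
      refine max_le ?_ ?_
      · exact Real.le_sqrt_of_sq_le (by simpa using sq_nonneg z.2)
      · exact Real.le_sqrt_of_sq_le (by simpa using sq_nonneg z.1)
  obtain ⟨C, hC, H⟩ := exists_plane_strong hφc ha (le_max_right R a) hs (fun z => hM _) hq
  refine ⟨C, hC, fun lam hlam f hf hN => ?_⟩
  have mp := measurePreserving_planeEquiv
  set g : ℝ × ℝ → ℂ := fun z => f (planeEquiv.symm z) with hg
  have hgN : ∫⁻ z, ‖g z‖ₑ ^ (q / (q - 3)) = ∫⁻ y, ‖f y‖ₑ ^ (q / (q - 3)) := by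
    rw [← mp.lintegral_comp_emb planeEquiv.measurableEmbedding]
    simp [hg]
  have h := H (2 * Real.pi * lam) (by positivity) g (hf.comp planeEquiv.symm.measurable)
    (by rw [hgN]; exact hN)
  rw [hgN, ← mp.lintegral_comp_emb planeEquiv.measurableEmbedding] at h
  refine le_trans (le_of_eq (lintegral_congr fun x => ?_)) h
  rw [← mp.integral_comp planeEquiv.measurableEmbedding]
  simp only [hg, hφ, planeKernel_planeEquiv, MeasurableEquiv.symm_apply_apply]

/-! ### The polar angle and the angular cutoff. -/

theorem measurable_polarAngle : Measurable polarAngle := by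
  have h : ∀ x : Plane, polarAngle x = 0 +
      Int.fract ((Complex.arg ((x 0 : ℂ) + (x 1 : ℂ) * Complex.I) - 0) / (2 * Real.pi)) *
        (2 * Real.pi) := fun x => by
    rw [polarAngle, toIcoMod_eq_add_fract_mul, Complex.mk_eq_add_mul_I]
  rw [funext h]
  refine Measurable.const_add (Measurable.mul_const (measurable_fract.comp
    (Measurable.div_const (Measurable.sub_const (Complex.measurable_arg.comp ?_) _) _)) _) _
  fun_prop

/-- Points with a given angle lie on a line through the origin, the kernel of a nonzero functional.
This is the absence of atoms required for bisection. -/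
theorem volume_polarAngle_eq (c : ℝ) : volume {x : Plane | polarAngle x = c} = 0 := by
  set l : Plane →L[ℝ] ℝ := Real.sin c • (EuclideanSpace.proj 0 : Plane →L[ℝ] ℝ)
    - Real.cos c • (EuclideanSpace.proj 1 : Plane →L[ℝ] ℝ) with hl
  have hl' : ∀ x, l x = Real.sin c * x 0 - Real.cos c * x 1 := fun x => by simp [hl]
  refine measure_mono_null (t := (LinearMap.ker l.toLinearMap : Set Plane)) ?_
    (Measure.addHaar_submodule _ _ ?_)
  · intro x hx
    obtain ⟨h1, h2⟩ := polarAngle_spec x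
    have hx' : polarAngle x = c := hx
    rw [hx'] at h1 h2
    simp only [SetLike.mem_coe, LinearMap.mem_ker, ContinuousLinearMap.coe_coe, hl', h1, h2]
    ring
  · intro h
    have : l !₂[Real.sin c, -Real.cos c] = 0 := by
      have hm : !₂[Real.sin c, -Real.cos c] ∈ LinearMap.ker l.toLinearMap := by
        rw [h]; exact Submodule.mem_top
      exact hm
    rw [hl'] at this
    simp only [Matrix.cons_val_zero, Matrix.cons_val_one] at this
    nlinarith [Real.sin_sq_add_cos_sq c]

/-- The points whose polar angle differs from that of `x` by an element of `I`. -/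
def angularCutoff (I : Set ℝ) (x : Plane) : Set Plane :=
  {y | |polarAngle x - polarAngle y| ∈ I}

theorem measurableSet_angularCutoff {I : Set ℝ} (hI : MeasurableSet I) :
    MeasurableSet {v : Plane × Plane | v.2 ∈ angularCutoff I v.1} :=
  (((measurable_polarAngle.comp measurable_fst).sub
    (measurable_polarAngle.comp measurable_snd)).abs) hI

/-- If θ₁ < π, then θ₁ - θ₂ < π always, so the condition |θ₁ - θ₂| ≤ π only says θ₂ ≤ θ₁ + π; if θ₁
≥ π, it only says θ₂ ≥ θ₁ - π. For the second interval the conditions are θ₂ ≥ θ₁ + π and θ₂ ≤ θ₁ -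
π respectively. -/
theorem isSegmentFamily_angularCutoff {I : Set ℝ}
    (hI : I = Set.Icc 0 Real.pi ∨ I = Set.Ico Real.pi (2 * Real.pi)) :
    IsSegmentFamily polarAngle (angularCutoff I) := by
  intro x
  have hx := polarAngle_mem x
  rcases hI with rfl | rfl
  · rcases lt_or_ge (polarAngle x) Real.pi with h | h
    · left
      intro y y' hyy hy'
      have hy := polarAngle_mem y
      refine ⟨abs_nonneg _, abs_le.2 ⟨?_, ?_⟩⟩
      · linarith [(abs_le.1 hy'.2).1]
      · linarith [hy.1]
    · right
      intro y y' hyy hy'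
      have hy := polarAngle_mem y'
      refine ⟨abs_nonneg _, abs_le.2 ⟨?_, ?_⟩⟩
      · linarith [hy.2]
      · linarith [(abs_le.1 hy'.2).2]
  · have hlt : ∀ y, |polarAngle x - polarAngle y| < 2 * Real.pi := fun y => by
      have hy := polarAngle_mem y
      exact abs_lt.2 ⟨by linarith [hy.2, hx.1], by linarith [hy.1, hx.2]⟩
    rcases lt_or_ge (polarAngle x) Real.pi with h | h
    · right
      intro y y' hyy hy'
      refine ⟨?_, hlt _⟩
      have hy := polarAngle_mem y
      rcases le_abs.1 hy'.1 with h1 | h1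
      · linarith [hy.1]
      · exact le_abs.2 (Or.inr (by linarith))
    · left
      intro y y' hyy hy'
      refine ⟨?_, hlt _⟩
      have hy := polarAngle_mem y'
      rcases le_abs.1 hy'.1 with h1 | h1
      · exact le_abs.2 (Or.inl (by linarith))
      · linarith [hy.2]

/-! ### The operator with angular cutoff. -/

section operator
variable {I : Set ℝ} {ψ : Plane → ℂ} {M R lam : ℝ}

theorem kernelTG_mul_eq_indicator (I : Set ℝ) (ψ : Plane → ℂ) (lam : ℝ) (f : Plane → ℂ)
    (x y : Plane) : kernelTG I ψ lam x y * f y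
      = (angularCutoff I x).indicator (fun y => convKernel ψ lam x y * f y) y := by
  rw [kernelTG, ← convKernel]
  by_cases h : y ∈ angularCutoff I x
  · have h' : |polarAngle x - polarAngle y| ∈ I := h
    rw [Set.indicator_of_mem h, Set.indicator_of_mem h', mul_one]
  · have h' : |polarAngle x - polarAngle y| ∉ I := h
    rw [Set.indicator_of_notMem h, Set.indicator_of_notMem h', mul_zero, zero_mul]

theorem measurableSet_angularCutoff_apply (hI : MeasurableSet I) (x : Plane) :
    MeasurableSet (angularCutoff I x) :=
  (measurableSet_angularCutoff hI).preimage measurable_prodMk_left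

theorem opTG_eq_setIntegral (hI : MeasurableSet I) (ψ : Plane → ℂ) (lam : ℝ) (f : Plane → ℂ)
    (x : Plane) : opTG I ψ lam f x = ∫ y in angularCutoff I x, convKernel ψ lam x y * f y := by
  rw [opTG, ← integral_indicator (measurableSet_angularCutoff_apply hI x)]
  exact integral_congr_ae (Filter.Eventually.of_forall fun y => kernelTG_mul_eq_indicator I ψ lam f x y)

theorem opTG_congr_ae {f g : Plane → ℂ} (h : f =ᵐ[volume] g) : opTG I ψ lam f = opTG I ψ lam g := by
  funext x
  refine integral_congr_ae ?_
  filter_upwards [h] with y hy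
  rw [hy]

theorem convKernel_eq_zero (hR : ∀ z, ψ z ≠ 0 → ‖z‖ ≤ R) {x y : Plane}
    (h : y ∉ Metric.closedBall x R) : convKernel ψ lam x y = 0 := by
  rw [convKernel, mul_eq_zero]
  right
  by_contra h0
  exact h (by rw [mem_closedBall_iff_norm']; exact hR _ h0)

theorem integrable_convKernel_mul (hψ : Continuous ψ) (hM : ∀ z, ‖ψ z‖ ≤ M)
    (hR : ∀ z, ψ z ≠ 0 → ‖z‖ ≤ R) {r : ℝ} (hr : 1 ≤ r) {f : Plane → ℂ}
    (hf : AEStronglyMeasurable f volume)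
    (hN : ∫⁻ y, ‖f y‖ₑ ^ r ≠ ⊤) (x : Plane) : Integrable fun y => convKernel ψ lam x y * f y :=
  integrable_mul_of_bounded_support hr (S := Metric.closedBall x R)
    (measure_closedBall_lt_top).ne
    ((continuous_convKernel hψ lam).comp (f := fun y => (x, y)) (by fun_prop)).aestronglyMeasurable
    (fun y => by rw [norm_convKernel]; exact hM _) (fun _ h => convKernel_eq_zero hR h) hf hN

theorem integrable_kernelTG_mul (hI : MeasurableSet I) (hψ : Continuous ψ) (hM : ∀ z, ‖ψ z‖ ≤ M)
    (hR : ∀ z, ψ z ≠ 0 → ‖z‖ ≤ R) {r : ℝ} (hr : 1 ≤ r) {f : Plane → ℂ}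
    (hf : AEStronglyMeasurable f volume) (hN : ∫⁻ y, ‖f y‖ₑ ^ r ≠ ⊤) (x : Plane) :
    Integrable fun y => kernelTG I ψ lam x y * f y := by
  simp_rw [kernelTG_mul_eq_indicator]
  exact (integrable_convKernel_mul hψ hM hR hr hf hN x).indicator
    (measurableSet_angularCutoff_apply hI x)

theorem measurable_opTG (hI : MeasurableSet I) (hψ : Continuous ψ) {f : Plane → ℂ}
    (hf : Measurable f) : Measurable (opTG I ψ lam f) := by
  have h : Measurable fun v : Plane × Plane =>
      {v : Plane × Plane | v.2 ∈ angularCutoff I v.1}.indicator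
        (fun v => convKernel ψ lam v.1 v.2 * f v.2) v :=
    ((continuous_convKernel hψ lam).measurable.mul (hf.comp measurable_snd)).indicator
      (measurableSet_angularCutoff hI)
  have h2 := (h.stronglyMeasurable.integral_prod_right' (ν := volume)).measurable
  refine (funext fun x => ?_ : opTG I ψ lam f = _) ▸ h2
  exact integral_congr_ae (Filter.Eventually.of_forall fun y => kernelTG_mul_eq_indicator I ψ lam f x y)

theorem enorm_opTG_le (hM : ∀ z, ‖ψ z‖ ≤ M) (f : Plane → ℂ) (x : Plane) :
    ‖opTG I ψ lam f x‖ₑ ≤ ENNReal.ofReal M * ∫⁻ y, ‖f y‖ₑ := by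
  refine (enorm_integral_le_lintegral_enorm _).trans ?_
  rw [← lintegral_const_mul' _ _ ENNReal.ofReal_ne_top]
  refine lintegral_mono fun y => ?_
  rw [kernelTG_mul_eq_indicator]
  refine (enorm_indicator_le_enorm_self _ _).trans ?_
  rw [enorm_mul, ← ofReal_norm, norm_convKernel]
  gcongr
  exact hM _

/-- The estimate for finite exponents, for measurable functions. -/
theorem exists_lintegral_opTG_le
    (hI : I = Set.Icc 0 Real.pi ∨ I = Set.Ico Real.pi (2 * Real.pi)) (hψ : ContDiff ℝ ∞ ψ)
    (hψc : HasCompactSupport ψ) (hψ0 : (0 : Plane) ∉ tsupport ψ) {q : ℝ} (hq : 4 < q) :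
    ∃ C : ℝ≥0∞, C ≠ ⊤ ∧ ∀ lam : ℝ, 0 < lam → ∀ f : Plane → ℂ, Measurable f →
      ∫⁻ y, ‖f y‖ₑ ^ (q / (q - 3)) ≠ ⊤ →
      ∫⁻ x, ‖opTG I ψ lam f x‖ₑ ^ q
        ≤ C * ENNReal.ofReal (((2 * Real.pi * lam) ^ 2)⁻¹) *
          (∫⁻ y, ‖f y‖ₑ ^ (q / (q - 3))) ^ (q - 3) := by
  have hIm : MeasurableSet I := by
    rcases hI with rfl | rfl
    · exact measurableSet_Icc
    · exact measurableSet_Ico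
  obtain ⟨C, hC, H⟩ := exists_conv_strong hψ hψc hψ0 hq
  obtain ⟨M, hM⟩ := hψ.continuous.bounded_above_of_compact_support hψc
  obtain ⟨R, hR⟩ := hψc.isCompact.isBounded.exists_norm_le
  have hR' : ∀ z, ψ z ≠ 0 → ‖z‖ ≤ R := fun z hz => hR z (subset_tsupport _ hz)
  have hq3 : 0 < q - 3 := by linarith
  set r := q / (q - 3) with hr
  have hr1 : 1 ≤ r := by rw [hr, le_div_iff₀ hq3]; linarith
  have hrq : r * (q - 3) = q := by rw [hr]; field_simp
  have hρ1 : (2 : ℝ≥0∞) ^ ((1 - (q - 3)) / q) < 1 :=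
    ENNReal.rpow_lt_one_of_one_lt_of_neg (by norm_num)
      (div_neg_of_neg_of_pos (by linarith) (by linarith))
  refine ⟨(2 / (1 - 2 ^ ((1 - (q - 3)) / q))) ^ q * C, ENNReal.mul_ne_top ?_ hC,
    fun lam hlam f hf hN => ?_⟩
  · exact (ENNReal.rpow_lt_top_of_nonneg (by linarith)
      (ENNReal.div_ne_top (by norm_num) (tsub_pos_of_lt hρ1).ne')).ne
  have hV : volume (Metric.closedBall (0 : Plane) R) ≠ ⊤ := measure_closedBall_lt_top.ne
  have h := lintegral_cutoff_le (μ := (volume : Measure Plane)) (ν := volume)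
    (k := convKernel ψ lam) (continuous_convKernel hψ.continuous lam).measurable
    (q := q) (p := q - 3) (r := r) (by linarith) (by linarith) (by linarith)
    (fun f hf hN => integrable_convKernel_mul hψ.continuous hM hR' hr1 hf.aestronglyMeasurable hN)
    measurable_polarAngle (β := 2 * Real.pi) polarAngle_mem volume_polarAngle_eq
    (isSegmentFamily_angularCutoff hI) (measurableSet_angularCutoff hIm)
    (A := C * ENNReal.ofReal (((2 * Real.pi * lam) ^ 2)⁻¹))
    -- Finite but without decay in `lam`; the decay of the result comes from `A` alone.
    (C₀ := ENNReal.ofReal M ^ q * volume (Metric.closedBall (0 : Plane) R) ^ ((r - 1) * (q - 3)) *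
      volume (Metric.closedBall (0 : Plane) R))
    (ENNReal.mul_ne_top (ENNReal.mul_ne_top
      (ENNReal.rpow_lt_top_of_nonneg (by linarith) ENNReal.ofReal_ne_top).ne
      (ENNReal.rpow_lt_top_of_nonneg (mul_nonneg (by linarith) hq3.le) hV).ne) hV)
    (fun f hf hN => H lam hlam f hf hN)
    (fun f hf hN => by
      have := lintegral_cutoff_le_of_bounded_support (volume : Measure Plane)
        (k := convKernel ψ lam) (M := M) (R := R) (fun x y => by rw [norm_convKernel]; exact hM _)
        (fun x y h => convKernel_eq_zero hR' h) (angularCutoff I) (p := q - 3) (r := r)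
        (by linarith) hr1 hf
      rwa [hrq] at this) hf hN
  simp_rw [opTG_eq_setIntegral hIm]
  refine h.trans (le_of_eq ?_)
  ring

end operator

/-! ### Exponents and conclusion. -/

theorem eq_ofReal_of_scaling {q : ℝ} (hq : 4 < q) {r : ℝ≥0∞}
    (h : 3 / ENNReal.ofReal q + 1 / r = 1) : r = ENNReal.ofReal (q / (q - 3)) := by
  have hq0 : 0 < q := by linarith
  have h3 : (3 : ℝ≥0∞) / ENNReal.ofReal q = ENNReal.ofReal (3 / q) := by
    rw [ENNReal.ofReal_div_of_pos hq0]; simp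
  rw [h3] at h
  have h1 : 1 / r = ENNReal.ofReal ((q / (q - 3))⁻¹) := by
    have := ENNReal.eq_sub_of_add_eq' ENNReal.one_ne_top ((add_comm _ _).trans h)
    rw [this, ← ENNReal.ofReal_one, ← ENNReal.ofReal_sub _ (by positivity)]
    congr 1
    field_simp
  rw [one_div, ENNReal.ofReal_inv_of_pos (div_pos hq0 (by linarith)), inv_inj] at h1
  exact h1

theorem proposition3p1
    (I : Set ℝ) (hI : I = Set.Icc 0 Real.pi ∨ I = Set.Ico Real.pi (2 * Real.pi))
    (ψ : Plane → ℂ) (hψ : ContDiff ℝ ∞ ψ) (hψc : HasCompactSupport ψ)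
    (hψ0 : (0 : Plane) ∉ tsupport ψ)
    (q r : ℝ≥0∞) (hq : 4 < q) (hqr : 3 / q + 1 / r = 1) :
    ∃ C : ℝ, 0 < C ∧ ∀ lam : ℝ, 1 ≤ lam → ∀ f : Plane → ℂ, MemLp f r volume →
      (∀ x : Plane, Integrable (fun y => kernelTG I ψ lam x y * f y) volume) ∧
      MemLp (opTG I ψ lam f) q volume ∧
      eLpNorm (opTG I ψ lam f) q volume ≤
        ENNReal.ofReal (C * lam ^ (-(2 / q).toReal)) * eLpNorm f r volume := by
  have hIm : MeasurableSet I := by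
    rcases hI with rfl | rfl
    · exact measurableSet_Icc
    · exact measurableSet_Ico
  obtain ⟨M, hM⟩ := hψ.continuous.bounded_above_of_compact_support hψc
  obtain ⟨R, hR⟩ := hψc.isCompact.isBounded.exists_norm_le
  have hR' : ∀ z, ψ z ≠ 0 → ‖z‖ ≤ R := fun z hz => hR z (subset_tsupport _ hz)
  have hmeas : ∀ (lam : ℝ) (f : Plane → ℂ), AEStronglyMeasurable f volume →
      AEStronglyMeasurable (opTG I ψ lam f) volume := fun lam f hf => by
    rw [opTG_congr_ae hf.ae_eq_mk]
    exact (measurable_opTG hIm hψ.continuous hf.stronglyMeasurable_mk.measurable).aestronglyMeasurable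
  suffices h : ∃ C : ℝ, 0 < C ∧ ∀ lam : ℝ, 1 ≤ lam → ∀ f : Plane → ℂ, MemLp f r volume →
      (∀ x : Plane, Integrable (fun y => kernelTG I ψ lam x y * f y) volume) ∧
      eLpNorm (opTG I ψ lam f) q volume ≤
        ENNReal.ofReal (C * lam ^ (-(2 / q).toReal)) * eLpNorm f r volume by
    obtain ⟨C, hC, H⟩ := h
    refine ⟨C, hC, fun lam hlam f hf => ?_⟩
    obtain ⟨h1, h2⟩ := H lam hlam f hf
    exact ⟨h1, ⟨hmeas lam f hf.1, h2.trans_lt (ENNReal.mul_lt_top ENNReal.ofReal_lt_top hf.2)⟩, h2⟩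
  rcases eq_or_ne q ⊤ with rfl | hqt
  -- The endpoint q = ∞ forces r = 1 and has no decay in `lam`, so the sup bound of the kernel
  -- suffices.
  · have hr : r = 1 := by
      rw [ENNReal.div_top, zero_add, one_div, ENNReal.inv_eq_one] at hqr
      exact hqr
    subst hr
    refine ⟨max M 1, by positivity, fun lam hlam f hf => ⟨fun x => ?_, ?_⟩⟩
    · refine integrable_kernelTG_mul hIm hψ.continuous hM hR' le_rfl hf.1 ?_ x
      simpa [eLpNorm_one_eq_lintegral_enorm] using hf.2.ne
    · rw [eLpNorm_exponent_top, ENNReal.div_top, ENNReal.toReal_zero, neg_zero, Real.rpow_zero,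
        mul_one, eLpNorm_one_eq_lintegral_enorm]
      exact eLpNormEssSup_le_of_ae_enorm_bound (Filter.Eventually.of_forall fun x =>
        enorm_opTG_le (fun z => (hM z).trans (le_max_left _ _)) f x)
  obtain ⟨p, rfl⟩ : ∃ p : ℝ, q = ENNReal.ofReal p := ⟨q.toReal, (ENNReal.ofReal_toReal hqt).symm⟩
  have hp : 4 < p := by
    rw [show (4 : ℝ≥0∞) = ENNReal.ofReal 4 by simp] at hq
    exact (ENNReal.ofReal_lt_ofReal_iff_of_nonneg (by norm_num)).1 hq
  have hp0 : 0 < p := by linarith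
  have hp3 : 0 < p - 3 := by linarith
  obtain rfl := eq_ofReal_of_scaling hp hqr
  set r := p / (p - 3) with hr
  have hr1 : 1 ≤ r := by rw [hr, le_div_iff₀ hp3]; linarith
  have hr0 : 0 < r := by linarith
  have hq2 : (2 / ENNReal.ofReal p).toReal = 2 / p := by
    rw [ENNReal.toReal_div, ENNReal.toReal_ofReal hp0.le]; simp
  have norm_eq : ∀ (g : Plane → ℂ) (s : ℝ), 0 < s →
      eLpNorm g (ENNReal.ofReal s) volume = (∫⁻ x, ‖g x‖ₑ ^ s) ^ (1 / s) := fun g s hs => by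
    rw [eLpNorm_eq_lintegral_rpow_enorm_toReal (by simpa using hs) ENNReal.ofReal_ne_top,
      ENNReal.toReal_ofReal hs.le]
  obtain ⟨D, hD, H⟩ := exists_lintegral_opTG_le hI hψ hψc hψ0 hp
  have hDp : D ^ (1 / p) ≠ ⊤ := (ENNReal.rpow_lt_top_of_nonneg (by positivity) hD).ne
  -- The added 1 makes the constant positive even if `D` is 0.
  refine ⟨(D ^ (1 / p)).toReal + 1, by positivity, fun lam hlam f hf => ?_⟩
  have hlam0 : 0 < lam := by linarith
  have hN : ∫⁻ y, ‖f y‖ₑ ^ r ≠ ⊤ := by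
    have := (eLpNorm_lt_top_iff_lintegral_rpow_enorm_lt_top (by simpa using hr0)
      ENNReal.ofReal_ne_top).1 hf.2
    rw [ENNReal.toReal_ofReal hr0.le] at this
    exact this.ne
  refine ⟨integrable_kernelTG_mul hIm hψ.continuous hM hR' hr1 hf.1 hN, ?_⟩
  -- The estimate was proved for measurable functions; the integral does not distinguish f from a
  -- measurable representative, for any x.
  set g := hf.1.mk f with hg
  have hfg : f =ᵐ[volume] g := hf.1.ae_eq_mk
  have hgN : ∫⁻ y, ‖g y‖ₑ ^ r = ∫⁻ y, ‖f y‖ₑ ^ r := lintegral_congr_ae (by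
    filter_upwards [hfg] with y hy
    rw [hy])
  have h := H lam hlam0 g hf.1.stronglyMeasurable_mk.measurable (by rw [hgN]; exact hN)
  rw [hgN, ← opTG_congr_ae hfg] at h
  rw [hq2, norm_eq _ _ hp0, norm_eq _ _ hr0]
  have hL : ENNReal.ofReal (((2 * Real.pi * lam) ^ 2)⁻¹) ≤ ENNReal.ofReal (lam ^ (-2 : ℝ)) := by
    refine ENNReal.ofReal_le_ofReal ?_
    rw [Real.rpow_neg hlam0.le, Real.rpow_two]
    gcongr
    nlinarith [Real.pi_gt_three]
  calc (∫⁻ x, ‖opTG I ψ lam f x‖ₑ ^ p) ^ (1 / p)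
      ≤ (D * ENNReal.ofReal (lam ^ (-2 : ℝ)) * (∫⁻ y, ‖f y‖ₑ ^ r) ^ (p - 3)) ^ (1 / p) := by
        refine ENNReal.rpow_le_rpow (h.trans ?_) (by positivity)
        gcongr
    _ = D ^ (1 / p) * ENNReal.ofReal (lam ^ (-(2 / p))) * (∫⁻ y, ‖f y‖ₑ ^ r) ^ (1 / r) := by
        rw [ENNReal.mul_rpow_of_nonneg _ _ (by positivity),
          ENNReal.mul_rpow_of_nonneg _ _ (by positivity), ← ENNReal.rpow_mul,
          ENNReal.ofReal_rpow_of_pos (by positivity), ← Real.rpow_mul hlam0.le]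
        have e1 : (-2 : ℝ) * (1 / p) = -(2 / p) := by ring
        have e2 : (p - 3) * (1 / p) = 1 / r := by rw [hr]; field_simp
        rw [e1, e2]
    _ ≤ _ := by
        gcongr
        rw [ENNReal.ofReal_mul (by positivity)]
        gcongr
        rw [ENNReal.ofReal_add ENNReal.toReal_nonneg zero_le_one, ENNReal.ofReal_toReal hDp]
        exact le_self_add
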